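/- Consider the system for the unknowns $\gamma(t,\xi)\in\mathbb R^3$, $p(t,\xi)$, $\rho(t,\xi)>0$, $\xi=(\xi^1,\xi^2,\xi^3)$, $$\gamma_{tt}-\partial_{\xi^1}(\rho\,\gamma_{\xi^1})+P_{\xi^1}\,\gamma_{\xi^2}\times\gamma_{\xi^3}+P_{\xi^2}\,\gamma_{\xi^3}\times\gamma_{\xi^1}+P_{\xi^3}\,\gamma_{\xi^1}\times\gamma_{\xi^2}=0,$$ $$\rho\,[\gamma_{\xi^1},\gamma_{\xi^2},\gamma_{\xi^3}]=1,\qquad p_t=h(p,\rho)\,\rho_t,\qquad P=p+\tfrac12\rho^2|\gamma_{\xi^1}|^2,$$ where $h$ is a smooth function on a connected open set $\Omega$ of pairs $(p,\rho)$ with $\rho>0$, and $[\cdot,\cdot,\cdot]$ is the mixed product. Consider operators (vector fields) with coefficients smooth functions of $(t,\xi,\gamma,p,\rho)$, for $(t,\xi,\gamma)$ in a nonempty convex open set $Q\subset\mathbb R^7$ and $(p,\rho)\in\Omega$. The system admits an operator if the second prolongation of the operator annihilates the equations of the system on the manifold in the space of second jets that is given by these equations and by the total derivatives of the first-order ones.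 The kernel is the Lie algebra of the operators that are admitted for every smooth $h$ on $\Omega$. (1) The kernel is the semidirect sum of the ideal of operators of the reparametrization group, $a\,\partial_{\xi^1}+b^2\partial_{\xi^2}+b^3\partial_{\xi^3}$ with arbitrary smooth functions $a,b^2,b^3$ of $(\xi^2,\xi^3)$ such that $\partial b^2/\partial\xi^2+\partial b^3/\partial\xi^3=0$, and the subalgebra (extended Galilean algebra) spanned by $$T_0=\partial_t,\quad T_i=\partial_{\gamma^i},\quad R_i=\varepsilon_{ijk}\gamma^j\partial_{\gamma^k},\quad S=t\partial_t+\xi^j\partial_{\xi^j}+\gamma^j\partial_{\gamma^j},\quad G_i=t\,\partial_{\gamma^i}\qquad(i=1,2,3),$$ with summation over $j,k=1,2,3$. Moreover, for every $h$, each finite reparametrization $\bar\xi^1=\xi^1+a(\xi^2,\xi^3)$, $\bar\xi^2=\bar\xi^2(\xi^2,\xi^3)$, $\bar\xi^3=\bar\xi^3(\xi^2,\xi^3)$ with $\partial(\bar\xi^2,\bar\xi^3)/\partial(\xi^2,\xi^3)=1$ takes solutions to solutions. (2) For a given $h$, the admitted operators are exactly the sums of an operator of the kernel and an operator $$Y=c_1t\partial_t+(-4c_1+2c_2)\xi^1\partial_{\xi^1}+c_2\xi^2\partial_{\xi^2}+c_2\xi^3\partial_{\xi^3}+2c_1\gamma^j\partial_{\gamma^j}+\bigl(c_3+(4c_2-8c_1)p\bigr)\partial_p+(4c_2-10c_1)\rho\,\partial_\rho$$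 whose constants $c_1,c_2,c_3$ satisfy, identically for $(p,\rho)\in\Omega$, $$2c_1(h+4ph_p+5\rho h_\rho)-4c_2(ph_p+\rho h_\rho)-c_3h_p=0.$$ In particular $Y$ is admitted if and only if this equation holds, and $Y$ lies in the kernel only if $c_1=c_2=c_3=0$. -/

import Mathlib

open Set
open scoped ContDiff Matrix

noncomputable section

namespace MHD

/-- Independent variables: `x 0 = t`, `x 1 = ξ¹`, `x 2 = ξ²`, `x 3 = ξ³`. -/
abbrev Indep := Fin 4 → ℝ

/-- Dependent variables `(γ, p, ρ)`; in particular `u.2 = (p, ρ)`. -/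
abbrev Dep := (Fin 3 → ℝ) × (ℝ × ℝ)

/-- The space of independent and dependent variables. Since it is a vector space, a vector field
(an infinitesimal operator) on it is a map `Pt → Pt`; its value `(ξ, η)` at `z` stands for
`ξ^α ∂_{x^α} + η^γ ∂_γ + η^p ∂_p + η^ρ ∂_ρ`. -/
abbrev Pt := Indep × Dep

/-- The space of second jets `(x, u, u_α, u_{αβ})`. -/
abbrev Jet := Indep × Dep × (Fin 4 → Dep) × (Fin 4 → Fin 4 → Dep)

namespace Jet

variable (j : Jet)

/-- The point `(x, u)` under a jet. -/
def pt : Pt := (j.1, j.2.1)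
/-- First derivatives `u_α`. -/
def d1 (α : Fin 4) : Dep := j.2.2.1 α
/-- Second derivatives `u_{αβ}`. -/
def d2 (α β : Fin 4) : Dep := j.2.2.2 α β

/-- The density `ρ`. -/
def rho : ℝ := j.2.1.2.2
/-- The first derivative `γ_α`. -/
def g1 (α : Fin 4) : Fin 3 → ℝ := (j.d1 α).1
/-- The first derivative `p_α`. -/
def p1 (α : Fin 4) : ℝ := (j.d1 α).2.1
/-- The first derivative `ρ_α`. -/
def rho1 (α : Fin 4) : ℝ := (j.d1 α).2.2
/-- The second derivative `γ_{αβ}`. -/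
def g2 (α β : Fin 4) : Fin 3 → ℝ := (j.d2 α β).1

/-- The derivative with respect to `x^α` of the total pressure `P = p + ρ² |γ_{ξ¹}|² / 2`. -/
def totalPressure1 (α : Fin 4) : ℝ :=
  j.p1 α + j.rho * j.rho1 α * (j.g1 1 ⬝ᵥ j.g1 1) + j.rho ^ 2 * (j.g1 1 ⬝ᵥ j.g2 1 α)

end Jet

/-! ### The system -/

/-- `γ_tt - ∂_{ξ¹}(ρ γ_{ξ¹}) + P_{ξ¹} γ_{ξ²} × γ_{ξ³} + P_{ξ²} γ_{ξ³} × γ_{ξ¹}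
+ P_{ξ³} γ_{ξ¹} × γ_{ξ²}`. -/
def momentum (j : Jet) : Fin 3 → ℝ :=
  j.g2 0 0 - (j.rho1 1 • j.g1 1 + j.rho • j.g2 1 1)
    + j.totalPressure1 1 • (j.g1 2 ⨯₃ j.g1 3)
    + j.totalPressure1 2 • (j.g1 3 ⨯₃ j.g1 1)
    + j.totalPressure1 3 • (j.g1 1 ⨯₃ j.g1 2)

/-- `ρ [γ_{ξ¹}, γ_{ξ²}, γ_{ξ³}] - 1`. -/
def cauchy (j : Jet) : ℝ := j.rho * (j.g1 1 ⬝ᵥ (j.g1 2 ⨯₃ j.g1 3)) - 1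

/-- `p_t - h(p, ρ) ρ_t`. -/
def constitutive (h : ℝ × ℝ → ℝ) (j : Jet) : ℝ := j.p1 0 - h j.2.1.2 * j.rho1 0

/-- The jet satisfies the system with sound-speed function `h`. -/
def SystemAt (h : ℝ × ℝ → ℝ) (j : Jet) : Prop :=
  momentum j = 0 ∧ cauchy j = 0 ∧ constitutive h j = 0

/-- The second jet at `x` of a function `u`. -/
def jet (u : Indep → Dep) (x : Indep) : Jet :=
  (x, u x, fun α => fderiv ℝ u x (Pi.single α 1),
    fun α β => fderiv ℝ (fderiv ℝ u) x (Pi.single α 1) (Pi.single β 1))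

/-- `u = (γ, p, ρ)` is a smooth solution on `V`, with `(p, ρ)` in the domain `Ω` of `h`. -/
def IsSolution (Ω : Set (ℝ × ℝ)) (h : ℝ × ℝ → ℝ) (V : Set Indep) (u : Indep → Dep) : Prop :=
  ContDiffOn ℝ ∞ u V ∧ ∀ x ∈ V, (u x).2 ∈ Ω ∧ SystemAt h (jet u x)

/-- Total derivative `D_α F` of a function `F` on jets that depends on no second derivatives. -/
def totalDeriv (F : Jet → ℝ) (α : Fin 4) (j : Jet) : ℝ :=
  fderiv ℝ F j (Pi.single α 1, j.d1 α, fun β => j.d2 α β, 0)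

/-- The manifold in the space of second jets that is defined by the system: the second-order
equation, the first-order equations, and the total derivatives of the first-order equations (these
are equations of second order and hold, like the others, on the second jet of every solution). -/
def systemManifold (Ω : Set (ℝ × ℝ)) (h : ℝ × ℝ → ℝ) : Set Jet :=
  {j | j.2.1.2 ∈ Ω ∧ (∀ α β, j.d2 α β = j.d2 β α) ∧ SystemAt h j ∧
    ∀ α, totalDeriv cauchy α j = 0 ∧ totalDeriv (constitutive h) α j = 0}

/-! ### Prolongation of infinitesimal operators -/

/-- The total derivative `D_α X` of the coefficients of an operator. -/
def coeffD1 (X : Pt → Pt) (j : Jet) (α : Fin 4) : Pt :=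
  fderiv ℝ X j.pt (Pi.single α 1, j.d1 α)

/-- The second total derivative `D_α D_β X` of the coefficients of an operator. -/
def coeffD2 (X : Pt → Pt) (j : Jet) (α β : Fin 4) : Pt :=
  fderiv ℝ (fderiv ℝ X) j.pt (Pi.single α 1, j.d1 α) (Pi.single β 1, j.d1 β)
    + fderiv ℝ X j.pt (0, j.d2 α β)

/-- The second prolongation of `X = (ξ, η)`, with the coefficients
`ζ_α = D_α η - (D_α ξ^ν) u_ν` and
`ζ_{αβ} = D_α D_β η - (D_α ξ^ν) u_{νβ} - (D_β ξ^ν) u_{να} - (D_α D_β ξ^ν) u_ν`. -/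
def prolong (X : Pt → Pt) (j : Jet) : Jet :=
  ((X j.pt).1, (X j.pt).2,
    fun α => (coeffD1 X j α).2 - ∑ ν, (coeffD1 X j α).1 ν • j.d1 ν,
    fun α β => (coeffD2 X j α β).2
      - ∑ ν, (coeffD1 X j α).1 ν • j.d2 ν β
      - ∑ ν, (coeffD1 X j β).1 ν • j.d2 ν α
      - ∑ ν, (coeffD2 X j α β).1 ν • j.d1 ν)

/-- The domain of the operators: `(t, ξ, γ)` in `Q` and `(p, ρ)` in `Ω`. -/
def dom (Q : Set (Indep × (Fin 3 → ℝ))) (Ω : Set (ℝ × ℝ)) : Set Pt :=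
  {z | (z.1, z.2.1) ∈ Q ∧ z.2.2 ∈ Ω}

/-- The system with sound-speed function `h` admits the operator `X`: the prolonged operator
annihilates the equations of the system on the manifold that the system defines. -/
def Admits (Q : Set (Indep × (Fin 3 → ℝ))) (Ω : Set (ℝ × ℝ)) (h : ℝ × ℝ → ℝ)
    (X : Pt → Pt) : Prop :=
  ContDiffOn ℝ ∞ X (dom Q Ω) ∧
    ∀ j ∈ systemManifold Ω h, j.pt ∈ dom Q Ω →
      fderiv ℝ momentum j (prolong X j) = 0 ∧
      fderiv ℝ cauchy j (prolong X j) = 0 ∧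
      fderiv ℝ (constitutive h) j (prolong X j) = 0

/-- The kernel: the operators admitted for every sound-speed function. -/
def InKernel (Q : Set (Indep × (Fin 3 → ℝ))) (Ω : Set (ℝ × ℝ)) (X : Pt → Pt) : Prop :=
  ∀ h : ℝ × ℝ → ℝ, ContDiffOn ℝ ∞ h Ω → Admits Q Ω h X

/-! ### The reparametrization group -/

/-- The finite transformation `ξ¹ ↦ ξ¹ + a(ξ², ξ³)`, `(ξ², ξ³) ↦ (b²(ξ², ξ³), b³(ξ², ξ³))`. -/
def reparam (a b₂ b₃ : ℝ × ℝ → ℝ) (x : Indep) : Indep :=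
  ![x 0, x 1 + a (x 2, x 3), b₂ (x 2, x 3), b₃ (x 2, x 3)]

/-- `a`, `b²`, `b³` are smooth on `W` and the Jacobian `∂(b², b³)/∂(ξ², ξ³)` equals `1`. -/
def IsReparam (W : Set (ℝ × ℝ)) (a b₂ b₃ : ℝ × ℝ → ℝ) : Prop :=
  ContDiffOn ℝ ∞ a W ∧ ContDiffOn ℝ ∞ b₂ W ∧ ContDiffOn ℝ ∞ b₃ W ∧
    ∀ w ∈ W, fderiv ℝ b₂ w (1, 0) * fderiv ℝ b₃ w (0, 1)
      - fderiv ℝ b₂ w (0, 1) * fderiv ℝ b₃ w (1, 0) = 1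

/-- The operators of the reparametrization group, `a ∂_{ξ¹} + b² ∂_{ξ²} + b³ ∂_{ξ³}` with `a`, `b²`,
`b³` smooth functions of `(ξ², ξ³)` and `∂b²/∂ξ² + ∂b³/∂ξ³ = 0` (the linearization at the identity
of the condition that the Jacobian is `1`). -/
def IsReparamOperator (D : Set Pt) (X : Pt → Pt) : Prop :=
  ∃ a b₂ b₃ : ℝ × ℝ → ℝ,
    (∀ f ∈ ({a, b₂, b₃} : Set (ℝ × ℝ → ℝ)),
      ContDiffOn ℝ ∞ f ((fun z : Pt => (z.1 2, z.1 3)) '' D)) ∧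
    (∀ w ∈ (fun z : Pt => (z.1 2, z.1 3)) '' D,
      fderiv ℝ b₂ w (1, 0) + fderiv ℝ b₃ w (0, 1) = 0) ∧
    ∀ z ∈ D, X z =
      (![0, a (z.1 2, z.1 3), b₂ (z.1 2, z.1 3), b₃ (z.1 2, z.1 3)], 0)

/-! ### The extended Galilean group and the extension operators -/

/-- `T₀ = ∂_t`. -/
def opT0 : Pt → Pt := fun _ => (Pi.single 0 1, 0)
/-- `T_i = ∂_{γ^i}`. -/
def opT (i : Fin 3) : Pt → Pt := fun _ => (0, Pi.single i 1, 0)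
/-- `R_i = ε_{ijk} γ^j ∂_{γ^k}`; the vector with components `ε_{ijk} γ^j` is `e_i × γ`. -/
def opR (i : Fin 3) : Pt → Pt := fun z => (0, (Pi.single i 1 : Fin 3 → ℝ) ⨯₃ z.2.1, 0)
/-- `S = t ∂_t + ξ^j ∂_{ξ^j} + γ^j ∂_{γ^j}`. -/
def opS : Pt → Pt := fun z => (z.1, z.2.1, 0)
/-- `G_i = t ∂_{γ^i}`. -/
def opG (i : Fin 3) : Pt → Pt := fun z => (0, Pi.single i (z.1 0), 0)

/-- The linear span of the generators of the extended Galilean group. -/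
def galileanSpan : Submodule ℝ (Pt → Pt) :=
  Submodule.span ℝ ({opT0, opS} ∪ range opT ∪ range opR ∪ range opG)

/-- On `D` the operator is a linear combination of generators of the extended Galilean group. -/
def IsGalileanOperator (D : Set Pt) (X : Pt → Pt) : Prop :=
  ∃ Z ∈ galileanSpan, EqOn X Z D

/-- `Y = c₁ t ∂_t + (-4c₁ + 2c₂) ξ¹ ∂_{ξ¹} + c₂ ξ² ∂_{ξ²} + c₂ ξ³ ∂_{ξ³} + 2c₁ γ^j ∂_{γ^j}
+ (c₃ + (4c₂ - 8c₁) p) ∂_p + (4c₂ - 10c₁) ρ ∂_ρ`. -/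
def opY (c₁ c₂ c₃ : ℝ) : Pt → Pt := fun z =>
  (![c₁ * z.1 0, (-4 * c₁ + 2 * c₂) * z.1 1, c₂ * z.1 2, c₂ * z.1 3],
    (2 * c₁) • z.2.1, c₃ + (4 * c₂ - 8 * c₁) * z.2.2.1, (4 * c₂ - 10 * c₁) * z.2.2.2)

/-- The classifying equation, identically for `(p, ρ)` in `Ω`. -/
def ClassEq (Ω : Set (ℝ × ℝ)) (h : ℝ × ℝ → ℝ) (c₁ c₂ c₃ : ℝ) : Prop :=
  ∀ w ∈ Ω,
    2 * c₁ * (h w + 4 * w.1 * fderiv ℝ h w (1, 0) + 5 * w.2 * fderiv ℝ h w (0, 1))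
      - 4 * c₂ * (w.1 * fderiv ℝ h w (1, 0) + w.2 * fderiv ℝ h w (0, 1))
      - c₃ * fderiv ℝ h w (1, 0) = 0

end MHD

end

noncomputable section

namespace MHD

/-! ### Linearization of the equations -/

/-! Admitted operators are characterized by their derivative. Let `T`, `A`, `l` be the weights of
`t`, `ξ¹`, `γ`. Balancing `γ_tt` against `∂_{ξ¹}(ρ γ_{ξ¹})` gives `ρ` the weight `2A - 2T`. The two
summands of `P` then give `p` the weight `2l + 2A - 4T`, and the Cauchy equation gives the `(ξ²,
ξ³)` block the trace `3l + A - 2T`. `HasSymmetryForm` records exactly this, together with a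
rotation, a Galilean boost, a shift of `p` and the free shears of the reparametrization group.

Sufficiency (`HasSymmetryForm.admits`): for such an operator the prolongation multiplies the
momentum by a scalar and rotates it, annihilates the Cauchy equation identically, and turns the
constitutive equation into `ρ_t` times the classifying equation.

Necessity (`Admits.hasSymmetryForm`): every first jet satisfying the first-order equations lifts to
the manifold, since `γ_tt` and `p_{tα}` can be solved for. So the determining equations hold for all
values of the remaining derivatives, and their coefficients can be separated. The Cauchy equation on
orthogonal frames decouples the coefficients (`Admits.cauchyForm`). The constitutive equation
removes the `t`-dependence of the `ξ`-coefficients and yields a pointwise classifying equation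
(`Admits.constitutiveForm`). The momentum equation makes the `γ`-block a scalar plus a skew matrix
and fixes the weights of `p` and `ρ` (`Admits.velocity_form`, `Admits.momentumForm`). Two formulas
for the `∂_ρ` coefficient are then available, from the Cauchy and the momentum equation.
Differentiating their equality kills the second derivatives that would let the weights vary
(`Admits.flatForm`), and on a connected domain the weights are constants.

Integration (`HasSymmetryForm.exists_eqOn`): after subtracting a Galilean operator and an `opY`,
what remains is constant in its `t` and `γ` components, zero in `p` and `ρ`, and depends only on
`(ξ², ξ³)` otherwise. Convexity of `Q` turns vanishing derivatives along the fibres into genuine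
functions of `(ξ², ξ³)`. The kernel follows by testing with `h = 1` and `h = p`. The ideal property
rests on the fact that commutators of planar fields of constant divergence are divergence-free.
Finite reparametrizations act by unimodular changes of frame, under which the system is invariant
(`SystemAt.of_unimodular`). -/

lemma hasDerivAt_dotProduct {f g : ℝ → Fin 3 → ℝ} {f' g' : Fin 3 → ℝ} {s : ℝ}
    (hf : HasDerivAt f f' s) (hg : HasDerivAt g g' s) :
    HasDerivAt (fun s => f s ⬝ᵥ g s) (f' ⬝ᵥ g s + f s ⬝ᵥ g') s := by
  rw [hasDerivAt_pi] at hf hg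
  simp only [dotProduct, ← Finset.sum_add_distrib]
  exact HasDerivAt.fun_sum fun i _ => (hf i).mul (hg i)

lemma hasDerivAt_cross {f g : ℝ → Fin 3 → ℝ} {f' g' : Fin 3 → ℝ} {s : ℝ}
    (hf : HasDerivAt f f' s) (hg : HasDerivAt g g' s) :
    HasDerivAt (fun s => f s ⨯₃ g s) (f' ⨯₃ g s + f s ⨯₃ g') s := by
  rw [hasDerivAt_pi] at hf hg ⊢
  simp only [cross_apply]
  intro i
  fin_cases i
  · refine (((hf 1).mul (hg 2)).sub ((hf 2).mul (hg 1))).congr_deriv ?_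
    simp; ring
  · refine (((hf 2).mul (hg 0)).sub ((hf 0).mul (hg 2))).congr_deriv ?_
    simp; ring
  · refine (((hf 0).mul (hg 1)).sub ((hf 1).mul (hg 0))).congr_deriv ?_
    simp; ring

/-- The linearization of `Jet.totalPressure1` at `j` in the direction `v`. -/
def totalPressureLin (j v : Jet) (α : Fin 4) : ℝ :=
  v.p1 α + (v.rho * j.rho1 α + j.rho * v.rho1 α) * (j.g1 1 ⬝ᵥ j.g1 1)
    + 2 * (j.rho * j.rho1 α * (v.g1 1 ⬝ᵥ j.g1 1))
    + 2 * (j.rho * v.rho * (j.g1 1 ⬝ᵥ j.g2 1 α))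
    + j.rho ^ 2 * (v.g1 1 ⬝ᵥ j.g2 1 α + j.g1 1 ⬝ᵥ v.g2 1 α)

/-- The linearization of `momentum` at `j` in the direction `v`. -/
def momentumLin (j v : Jet) : Fin 3 → ℝ :=
  v.g2 0 0 - (v.rho1 1 • j.g1 1 + j.rho1 1 • v.g1 1 + (v.rho • j.g2 1 1 + j.rho • v.g2 1 1))
    + (totalPressureLin j v 1 • (j.g1 2 ⨯₃ j.g1 3)
      + j.totalPressure1 1 • (v.g1 2 ⨯₃ j.g1 3 + j.g1 2 ⨯₃ v.g1 3))
    + (totalPressureLin j v 2 • (j.g1 3 ⨯₃ j.g1 1)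
      + j.totalPressure1 2 • (v.g1 3 ⨯₃ j.g1 1 + j.g1 3 ⨯₃ v.g1 1))
    + (totalPressureLin j v 3 • (j.g1 1 ⨯₃ j.g1 2)
      + j.totalPressure1 3 • (v.g1 1 ⨯₃ j.g1 2 + j.g1 1 ⨯₃ v.g1 2))

/-- The linearization of `cauchy` at `j` in the direction `v`. -/
def cauchyLin (j v : Jet) : ℝ :=
  v.rho * (j.g1 1 ⬝ᵥ (j.g1 2 ⨯₃ j.g1 3))
    + j.rho * (v.g1 1 ⬝ᵥ (j.g1 2 ⨯₃ j.g1 3)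
      + j.g1 1 ⬝ᵥ (v.g1 2 ⨯₃ j.g1 3 + j.g1 2 ⨯₃ v.g1 3))

section Line

variable (j v : Jet)

lemma hasDerivAt_rho_line : HasDerivAt (fun s : ℝ => (j + s • v).rho) v.rho 0 := by
  have h : HasDerivAt (fun s : ℝ => j.rho + s * v.rho) v.rho 0 := by
    simpa using ((hasDerivAt_id (0 : ℝ)).mul_const v.rho).const_add j.rho
  exact h

lemma hasDerivAt_rho1_line (α : Fin 4) :
    HasDerivAt (fun s : ℝ => (j + s • v).rho1 α) (v.rho1 α) 0 := by
  have h : HasDerivAt (fun s : ℝ => j.rho1 α + s * v.rho1 α) (v.rho1 α) 0 := by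
    simpa using ((hasDerivAt_id (0 : ℝ)).mul_const (v.rho1 α)).const_add (j.rho1 α)
  exact h

lemma hasDerivAt_p1_line (α : Fin 4) :
    HasDerivAt (fun s : ℝ => (j + s • v).p1 α) (v.p1 α) 0 := by
  have h : HasDerivAt (fun s : ℝ => j.p1 α + s * v.p1 α) (v.p1 α) 0 := by
    simpa using ((hasDerivAt_id (0 : ℝ)).mul_const (v.p1 α)).const_add (j.p1 α)
  exact h

lemma hasDerivAt_g1_line (α : Fin 4) :
    HasDerivAt (fun s : ℝ => (j + s • v).g1 α) (v.g1 α) 0 := by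
  have h : HasDerivAt (fun s : ℝ => j.g1 α + s • v.g1 α) (v.g1 α) 0 := by
    simpa using ((hasDerivAt_id (0 : ℝ)).smul_const (v.g1 α)).const_add (j.g1 α)
  exact h

lemma hasDerivAt_g2_line (α β : Fin 4) :
    HasDerivAt (fun s : ℝ => (j + s • v).g2 α β) (v.g2 α β) 0 := by
  have h : HasDerivAt (fun s : ℝ => j.g2 α β + s • v.g2 α β) (v.g2 α β) 0 := by
    simpa using ((hasDerivAt_id (0 : ℝ)).smul_const (v.g2 α β)).const_add (j.g2 α β)
  exact h

lemma hasDerivAt_totalPressure1_line (α : Fin 4) :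
    HasDerivAt (fun s : ℝ => (j + s • v).totalPressure1 α) (totalPressureLin j v α) 0 := by
  have hg := hasDerivAt_g1_line j v 1
  have hr := hasDerivAt_rho_line j v
  refine (((hasDerivAt_p1_line j v α).add ((hr.mul (hasDerivAt_rho1_line j v α)).mul
    (hasDerivAt_dotProduct hg hg))).add ((hr.pow 2).mul
    (hasDerivAt_dotProduct hg (hasDerivAt_g2_line j v 1 α)))).congr_deriv ?_
  simp [totalPressureLin, dotProduct_comm (v.g1 1) (j.g1 1)]
  ring

lemma hasDerivAt_momentum_line :
    HasDerivAt (fun s : ℝ => momentum (j + s • v)) (momentumLin j v) 0 := by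
  have hg := hasDerivAt_g1_line j v
  have hP := hasDerivAt_totalPressure1_line j v
  refine (((((hasDerivAt_g2_line j v 0 0).sub (((hasDerivAt_rho1_line j v 1).smul (hg 1)).add
    ((hasDerivAt_rho_line j v).smul (hasDerivAt_g2_line j v 1 1)))).add
    ((hP 1).smul (hasDerivAt_cross (hg 2) (hg 3)))).add
    ((hP 2).smul (hasDerivAt_cross (hg 3) (hg 1)))).add
    ((hP 3).smul (hasDerivAt_cross (hg 1) (hg 2)))).congr_deriv ?_
  simp only [momentumLin, zero_smul, add_zero]
  abel

lemma hasDerivAt_cauchy_line :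
    HasDerivAt (fun s : ℝ => cauchy (j + s • v)) (cauchyLin j v) 0 := by
  have hg := hasDerivAt_g1_line j v
  refine (((hasDerivAt_rho_line j v).mul (hasDerivAt_dotProduct (hg 1)
    (hasDerivAt_cross (hg 2) (hg 3)))).sub_const 1).congr_deriv ?_
  simp [cauchyLin]

end Line

lemma differentiable_momentum : Differentiable ℝ momentum := by
  rw [differentiable_pi]
  intro i
  fin_cases i <;>
  · simp only [momentum, Jet.totalPressure1, Jet.g2, Jet.g1, Jet.rho, Jet.rho1, Jet.p1, Jet.d1,
      Jet.d2, cross_apply, dotProduct, Fin.sum_univ_three, Pi.add_apply, Pi.sub_apply,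
      Pi.smul_apply, smul_eq_mul]
    simp
    fun_prop

lemma differentiable_cauchy : Differentiable ℝ cauchy := by
  unfold cauchy
  simp only [Jet.g1, Jet.rho, Jet.d1, cross_apply, dotProduct, Fin.sum_univ_three]
  simp
  fun_prop

/-- Reduces each Fréchet derivative on jet space to a one-variable derivative along a line, where
the product rules for `⬝ᵥ` and `⨯₃` apply directly. -/
lemma fderiv_apply_eq_of_line {E F : Type*} [NormedAddCommGroup E] [NormedSpace ℝ E]
    [NormedAddCommGroup F] [NormedSpace ℝ F] {f : E → F} {x v : E} {d : F}
    (hf : DifferentiableAt ℝ f x) (hd : HasDerivAt (fun s : ℝ => f (x + s • v)) d 0) :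
    fderiv ℝ f x v = d := by
  rw [← hf.lineDeriv_eq_fderiv]
  exact hd.deriv

lemma fderiv_momentum (j v : Jet) : fderiv ℝ momentum j v = momentumLin j v :=
  fderiv_apply_eq_of_line (differentiable_momentum j) (hasDerivAt_momentum_line j v)

lemma fderiv_cauchy (j v : Jet) : fderiv ℝ cauchy j v = cauchyLin j v :=
  fderiv_apply_eq_of_line (differentiable_cauchy j) (hasDerivAt_cauchy_line j v)

lemma fderiv_constitutive {h : ℝ × ℝ → ℝ} {j : Jet} (hh : DifferentiableAt ℝ h j.2.1.2) (v : Jet) :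
    fderiv ℝ (constitutive h) j v
      = v.p1 0 - (fderiv ℝ h j.2.1.2 v.2.1.2 * j.rho1 0 + h j.2.1.2 * v.rho1 0) := by
  have hd : DifferentiableAt ℝ (fun j : Jet => h j.2.1.2) j :=
    DifferentiableAt.comp (g := h) (f := fun j : Jet => j.2.1.2) j hh (by fun_prop)
  refine fderiv_apply_eq_of_line ?_ ?_
  · unfold constitutive
    simp only [Jet.p1, Jet.rho1, Jet.d1]
    exact DifferentiableAt.sub (by fun_prop) (hd.mul (by fun_prop))
  · have h1 : HasDerivAt (fun s : ℝ => h (j + s • v).2.1.2) (fderiv ℝ h j.2.1.2 v.2.1.2) 0 := by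
      have h2 : HasDerivAt (fun s : ℝ => (j + s • v).2.1.2) v.2.1.2 0 := by
        have h : HasDerivAt (fun s : ℝ => j.2.1.2 + s • v.2.1.2) v.2.1.2 0 := by
          simpa using ((hasDerivAt_id (0 : ℝ)).smul_const v.2.1.2).const_add j.2.1.2
        exact h
      refine HasFDerivAt.comp_hasDerivAt (l := h) (0 : ℝ) ?_ h2
      simpa using hh.hasFDerivAt
    refine ((hasDerivAt_p1_line j v 0).sub (h1.mul (hasDerivAt_rho1_line j v 0))).congr_deriv ?_
    simp

/-! ### Second jets on the manifold of the system -/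

lemma isOpen_dom {Q : Set (Indep × (Fin 3 → ℝ))} {Ω : Set (ℝ × ℝ)} (hQ : IsOpen Q)
    (hΩ : IsOpen Ω) : IsOpen (dom Q Ω) :=
  (hQ.preimage (by fun_prop : Continuous fun z : Pt => (z.1, z.2.1))).inter
    (hΩ.preimage (by fun_prop : Continuous fun z : Pt => z.2.2))

lemma totalDeriv_cauchy (α : Fin 4) (j : Jet) :
    totalDeriv cauchy α j = j.rho1 α * (j.g1 1 ⬝ᵥ (j.g1 2 ⨯₃ j.g1 3))
      + j.rho * (j.g2 α 1 ⬝ᵥ (j.g1 2 ⨯₃ j.g1 3)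
        + j.g1 1 ⬝ᵥ (j.g2 α 2 ⨯₃ j.g1 3 + j.g1 2 ⨯₃ j.g2 α 3)) := by
  rw [totalDeriv, fderiv_cauchy]
  rfl

lemma totalDeriv_constitutive {h : ℝ × ℝ → ℝ} {j : Jet} (hh : DifferentiableAt ℝ h j.2.1.2)
    (α : Fin 4) :
    totalDeriv (constitutive h) α j = (j.d2 α 0).2.1
      - (fderiv ℝ h j.2.1.2 (j.d1 α).2 * j.rho1 0 + h j.2.1.2 * (j.d2 α 0).2.2) := by
  rw [totalDeriv, fderiv_constitutive hh]
  rfl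

/-- The second jet over `z` with `γ_α = g α`, `p_α = p α`, `ρ_α = r α`, `γ_{αβ} = G α β`,
`p_{αβ} = q α β`, and `ρ_{αβ} = 0`. -/
def mkJet (z : Pt) (g : Fin 4 → Fin 3 → ℝ) (p r : Fin 4 → ℝ) (G : Fin 4 → Fin 4 → Fin 3 → ℝ)
    (q : Fin 4 → Fin 4 → ℝ) : Jet :=
  (z.1, z.2, fun α => (g α, p α, r α), fun α β => (G α β, q α β, 0))

section mkJet

variable (z : Pt) (g : Fin 4 → Fin 3 → ℝ) (p r : Fin 4 → ℝ) (G : Fin 4 → Fin 4 → Fin 3 → ℝ)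
  (q : Fin 4 → Fin 4 → ℝ) (α β : Fin 4)

@[simp] lemma mkJet_pt : (mkJet z g p r G q).pt = z := rfl
@[simp] lemma mkJet_rho : (mkJet z g p r G q).rho = z.2.2.2 := rfl
@[simp] lemma mkJet_u : (mkJet z g p r G q).2.1 = z.2 := rfl
@[simp] lemma mkJet_d1 : (mkJet z g p r G q).d1 α = (g α, p α, r α) := rfl
@[simp] lemma mkJet_d2 : (mkJet z g p r G q).d2 α β = (G α β, q α β, 0) := rfl
@[simp] lemma mkJet_g1 : (mkJet z g p r G q).g1 α = g α := rfl
@[simp] lemma mkJet_p1 : (mkJet z g p r G q).p1 α = p α := rfl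
@[simp] lemma mkJet_rho1 : (mkJet z g p r G q).rho1 α = r α := rfl
@[simp] lemma mkJet_g2 : (mkJet z g p r G q).g2 α β = G α β := rfl

end mkJet

/-- Every first jet that satisfies the first-order equations, with derivatives `γ_{αβ}` that
satisfy the total derivatives of the Cauchy equation, extends to the manifold of the system: the
momentum equation is solved for `γ_tt` and the constitutive one for `p_{tα}`. -/
lemma mkJet_mem {Ω : Set (ℝ × ℝ)} {h : ℝ × ℝ → ℝ} {z : Pt} {g : Fin 4 → Fin 3 → ℝ}
    {p r : Fin 4 → ℝ} {G : Fin 4 → Fin 4 → Fin 3 → ℝ} (hz : z.2.2 ∈ Ω)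
    (hh : DifferentiableAt ℝ h z.2.2) (hp : p 0 = h z.2.2 * r 0)
    (hc : z.2.2.2 * (g 1 ⬝ᵥ (g 2 ⨯₃ g 3)) = 1) (hG : ∀ α β, G α β = G β α)
    (hD : ∀ α, r α * (g 1 ⬝ᵥ (g 2 ⨯₃ g 3)) + z.2.2.2 * (G α 1 ⬝ᵥ (g 2 ⨯₃ g 3)
      + g 1 ⬝ᵥ (G α 2 ⨯₃ g 3 + g 2 ⨯₃ G α 3)) = 0)
    (hM : momentum (mkJet z g p r G 0) = 0) :
    mkJet z g p r G (fun α β => if α = 0 then r 0 * fderiv ℝ h z.2.2 (p β, r β)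
      else if β = 0 then r 0 * fderiv ℝ h z.2.2 (p α, r α) else 0) ∈ systemManifold Ω h := by
  refine ⟨hz, fun α β => ?_, ⟨hM, ?_, ?_⟩, fun α => ⟨?_, ?_⟩⟩
  · simp only [mkJet_d2, hG α β]
    by_cases ha : α = 0 <;> by_cases hb : β = 0 <;> simp [ha, hb]
  · simp [cauchy, hc]
  · simp [constitutive, hp]
  · rw [totalDeriv_cauchy]
    exact hD α
  · rw [totalDeriv_constitutive hh]
    by_cases ha : α = 0
    · simp [ha, mul_comm]
    · simp [ha, mul_comm]

/-! ### The prolongation in coordinates -/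

section Coord

variable (X : Pt → Pt) (j : Jet) (α β : Fin 4)

lemma prolong_rho : (prolong X j).rho = (X j.pt).2.2.2 := rfl
lemma prolong_u : (prolong X j).2.1 = (X j.pt).2 := rfl

lemma prolong_g1 : (prolong X j).g1 α
    = (coeffD1 X j α).2.1 - ∑ ν, (coeffD1 X j α).1 ν • j.g1 ν := by
  simp [prolong, Jet.g1, Jet.d1, Prod.fst_sum]

lemma prolong_p1 : (prolong X j).p1 α
    = (coeffD1 X j α).2.2.1 - ∑ ν, (coeffD1 X j α).1 ν * j.p1 ν := by
  simp [prolong, Jet.p1, Jet.d1, Prod.fst_sum, Prod.snd_sum]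

lemma prolong_rho1 : (prolong X j).rho1 α
    = (coeffD1 X j α).2.2.2 - ∑ ν, (coeffD1 X j α).1 ν * j.rho1 ν := by
  simp [prolong, Jet.rho1, Jet.d1, Prod.snd_sum]

lemma prolong_g2 : (prolong X j).g2 α β
    = (coeffD2 X j α β).2.1 - ∑ ν, (coeffD1 X j α).1 ν • j.g2 ν β
      - ∑ ν, (coeffD1 X j β).1 ν • j.g2 ν α - ∑ ν, (coeffD2 X j α β).1 ν • j.g1 ν := by
  simp [prolong, Jet.g1, Jet.g2, Jet.d1, Jet.d2, Prod.fst_sum]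

end Coord

/-! ### Second derivatives of smooth operators -/

section Smooth

variable {E F : Type*} [NormedAddCommGroup E] [NormedSpace ℝ E] [NormedAddCommGroup F]
  [NormedSpace ℝ F] {X : E → F} {D : Set E}

lemma contDiffAt_of_mem (hX : ContDiffOn ℝ ∞ X D) (hD : IsOpen D) {z : E} (hz : z ∈ D) :
    ContDiffAt ℝ ∞ X z := hX.contDiffAt (hD.mem_nhds hz)

lemma differentiableAt_fderiv (hX : ContDiffOn ℝ ∞ X D) (hD : IsOpen D) {z : E} (hz : z ∈ D) :
    DifferentiableAt ℝ (fderiv ℝ X) z :=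
  ((contDiffAt_of_mem hX hD hz).fderiv_right (m := 1) (by norm_cast)).differentiableAt one_ne_zero

lemma fderiv_fderiv_comm (hX : ContDiffOn ℝ ∞ X D) (hD : IsOpen D) {z : E} (hz : z ∈ D)
    (v w : E) : fderiv ℝ (fderiv ℝ X) z v w = fderiv ℝ (fderiv ℝ X) z w v :=
  (contDiffAt_of_mem hX hD hz).isSymmSndFDerivAt
    (by simpa using (WithTop.coe_le_coe.2 le_top : ((2 : ℕ∞) : WithTop ℕ∞) ≤ ∞)) v w

/-- Second derivatives are obtained by differentiating an identity for the first ones. -/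
lemma map_fderiv_fderiv (hX : ContDiffOn ℝ ∞ X D) (hD : IsOpen D) {z : E} (hz : z ∈ D) (w : E)
    {G : Type*} [NormedAddCommGroup G] [NormedSpace ℝ G] (φ : F →L[ℝ] G) {f : E → G}
    (hf : ∀ z ∈ D, φ (fderiv ℝ X z w) = f z) (v : E) :
    φ (fderiv ℝ (fderiv ℝ X) z v w) = fderiv ℝ f z v := by
  have h1 : f =ᶠ[nhds z] fun z => φ (fderiv ℝ X z w) := by
    filter_upwards [hD.mem_nhds hz] with y hy using (hf y hy).symm
  have h2 : HasFDerivAt (fun z => fderiv ℝ X z w) ((fderiv ℝ (fderiv ℝ X) z).flip w) z := by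
    simpa using (differentiableAt_fderiv hX hD hz).hasFDerivAt.clm_apply (hasFDerivAt_const w z)
  have h3 : HasFDerivAt (fun z => φ (fderiv ℝ X z w))
      (φ.comp ((fderiv ℝ (fderiv ℝ X) z).flip w)) z := φ.hasFDerivAt.comp z h2
  rw [h1.fderiv_eq, h3.fderiv]
  rfl

end Smooth

/-! ### Operators of the extended form -/

/-- The operators on `D` whose derivative is that of a sum of an operator of the reparametrization
group, of the extended Galilean group and of an operator `opY`; `T`, `A`, `l` are the weights of
`t`, `ξ¹`, `γ`. -/
def HasSymmetryForm (D : Set Pt) (X : Pt → Pt) (T A l : ℝ) (w g : Fin 3 → ℝ) (c : ℝ) : Prop :=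
  ContDiffOn ℝ ∞ X D ∧ ∀ z ∈ D,
    (X z).2.2 = (c + (2 * l + 2 * A - 4 * T) * z.2.2.1, (2 * A - 2 * T) * z.2.2.2) ∧
    ∃ a₂ a₃ b₂₂ b₂₃ b₃₂ b₃₃ : ℝ, b₂₂ + b₃₃ = 3 * l + A - 2 * T ∧ ∀ v, fderiv ℝ X z v =
      (![T * v.1 0, A * v.1 1 + a₂ * v.1 2 + a₃ * v.1 3, b₂₂ * v.1 2 + b₂₃ * v.1 3,
          b₃₂ * v.1 2 + b₃₃ * v.1 3],
        l • v.2.1 + w ⨯₃ v.2.1 + v.1 0 • g, (2 * l + 2 * A - 4 * T) * v.2.2.1,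
        (2 * A - 2 * T) * v.2.2.2)

/-- A polynomial identity in the jet variables: all terms of the momentum have the same weight `l -
2T`, and rotations act on it as on a vector. Neither the equations nor `h` enter. The momentum
involves only `γ_tt` and `γ_{ξ¹α}`, so the possibly nonzero second derivatives of the coefficients
within the `(ξ², ξ³)` plane are never met. This is why `h2` suffices. -/
lemma momentumLin_prolong {X : Pt → Pt} {j : Jet} {T A l a₂ a₃ b₂₂ b₂₃ b₃₂ b₃₃ : ℝ}
    {w g : Fin 3 → ℝ} (hj : ∀ α β, j.d2 α β = j.d2 β α) (hb : b₂₂ + b₃₃ = 3 * l + A - 2 * T)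
    (hX : (X j.pt).2.2.2 = (2 * A - 2 * T) * j.rho)
    (h1 : ∀ v, fderiv ℝ X j.pt v =
      (![T * v.1 0, A * v.1 1 + a₂ * v.1 2 + a₃ * v.1 3, b₂₂ * v.1 2 + b₂₃ * v.1 3,
          b₃₂ * v.1 2 + b₃₃ * v.1 3],
        l • v.2.1 + w ⨯₃ v.2.1 + v.1 0 • g, (2 * l + 2 * A - 4 * T) * v.2.2.1,
        (2 * A - 2 * T) * v.2.2.2))
    (h2 : ∀ v v' : Pt, v.1 2 = 0 → v.1 3 = 0 → fderiv ℝ (fderiv ℝ X) j.pt v v' = 0) :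
    momentumLin j (prolong X j) = (l - 2 * T) • momentum j + w ⨯₃ momentum j := by
  have hg : ∀ α β, j.g2 α β = j.g2 β α := fun α β => by simp only [Jet.g2, hj α β]
  have e21 := hg 2 1
  have e31 := hg 3 1
  have d00 : coeffD2 X j 0 0 = (0, l • j.g2 0 0 + w ⨯₃ j.g2 0 0,
      (2 * l + 2 * A - 4 * T) * (j.d2 0 0).2.1, (2 * A - 2 * T) * (j.d2 0 0).2.2) := by
    rw [coeffD2, h2 _ _ (by simp) (by simp), h1, zero_add]
    simp [Jet.g2]
  have d1 : ∀ α, coeffD2 X j 1 α = (0, l • j.g2 1 α + w ⨯₃ j.g2 1 α,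
      (2 * l + 2 * A - 4 * T) * (j.d2 1 α).2.1, (2 * A - 2 * T) * (j.d2 1 α).2.2) := by
    intro α
    rw [coeffD2, h2 _ _ (by simp) (by simp), h1, zero_add]
    simp [Jet.g2]
  have hb' : b₃₃ = 3 * l + A - 2 * T - b₂₂ := by linarith
  have hd : ∀ α, j.d1 α = (j.g1 α, j.p1 α, j.rho1 α) := fun α => rfl
  ext k
  simp only [hd, momentumLin, totalPressureLin, momentum, Jet.totalPressure1, prolong_g1, prolong_g2,
    prolong_p1, prolong_rho1, prolong_rho, d00, d1, hX, coeffD1, h1, Fin.sum_univ_four, e21, e31,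
    hb']
  generalize j.g1 0 = g0
  generalize j.g1 1 = g1
  generalize j.g1 2 = g2
  generalize j.g1 3 = g3
  generalize j.g2 0 0 = G00
  generalize j.g2 1 1 = G11
  generalize j.g2 1 2 = G12
  generalize j.g2 1 3 = G13
  clear hd
  fin_cases k
  all_goals
    simp [dotProduct, cross_apply, Fin.sum_univ_three, Matrix.vecHead, Matrix.vecTail]
  all_goals ring

/-- The entries of the derivative that may vary with the point multiply only the `ξ²` and `ξ³`
components. Along the other directions the derivative is constant. -/
lemma HasSymmetryForm.fderiv_fderiv_eq_zero {D : Set Pt} (hD : IsOpen D) {X : Pt → Pt}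
    {T A l c : ℝ} {w g : Fin 3 → ℝ} (hX : HasSymmetryForm D X T A l w g c) {z : Pt} (hz : z ∈ D)
    {v : Pt} (v' : Pt) (h2 : v.1 2 = 0) (h3 : v.1 3 = 0) :
    fderiv ℝ (fderiv ℝ X) z v v' = 0 := by
  rw [fderiv_fderiv_comm hX.1 hD hz]
  have := map_fderiv_fderiv hX.1 hD hz v (ContinuousLinearMap.id ℝ Pt)
    (f := fun _ => (![T * v.1 0, A * v.1 1, 0, 0], l • v.2.1 + w ⨯₃ v.2.1 + v.1 0 • g,
      (2 * l + 2 * A - 4 * T) * v.2.2.1, (2 * A - 2 * T) * v.2.2.2)) ?_ v'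
  · simpa using this
  · intro y hy
    obtain ⟨-, a₂, a₃, b₂₂, b₂₃, b₃₂, b₃₃, -, h⟩ := hX.2 y hy
    simp [h, h2, h3]

lemma pair_apply (f : ℝ × ℝ →L[ℝ] ℝ) (x y : ℝ) : f (x, y) = x * f (1, 0) + y * f (0, 1) := by
  have : ((x, y) : ℝ × ℝ) = x • (1, 0) + y • (0, 1) := by simp
  rw [this, map_add, map_smul, map_smul, smul_eq_mul, smul_eq_mul]

/-- The constants in `hc` solve `T = s + c₁`, `A = s - 4c₁ + 2c₂`, `l = s + 2c₁` for `c₁` and `c₂`,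
where `s` is the weight of the scaling `opS`. Only the constitutive equation constrains them through
`h`. -/
theorem HasSymmetryForm.admits {Q : Set (Indep × (Fin 3 → ℝ))} (hQ : IsOpen Q)
    {Ω : Set (ℝ × ℝ)} (hΩ : IsOpen Ω) {h : ℝ × ℝ → ℝ} (hh : ContDiffOn ℝ ∞ h Ω) {X : Pt → Pt}
    {T A l c : ℝ} {w g : Fin 3 → ℝ} (hX : HasSymmetryForm (dom Q Ω) X T A l w g c)
    (hc : ClassEq Ω h (l - T) ((A + 5 * l - 6 * T) / 2) c) : Admits Q Ω h X := by
  refine ⟨hX.1, fun j hj hz => ?_⟩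
  obtain ⟨hj, hs, ⟨hM, hC, hE⟩, -⟩ := hj
  obtain ⟨hu, a₂, a₃, b₂₂, b₂₃, b₃₂, b₃₃, hb, hX'⟩ := hX.2 _ hz
  have hρ : (X j.pt).2.2.2 = (2 * A - 2 * T) * j.rho := by rw [hu]; rfl
  have hd : ∀ α, j.d1 α = (j.g1 α, j.p1 α, j.rho1 α) := fun α => rfl
  have hb' : b₃₃ = 3 * l + A - 2 * T - b₂₂ := by linarith
  refine ⟨?_, ?_, ?_⟩
  · rw [fderiv_momentum, momentumLin_prolong hs hb hρ hX' fun v v' h2 h3 =>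
      hX.fderiv_fderiv_eq_zero (isOpen_dom hQ hΩ) hz v' h2 h3, hM]
    simp
  · rw [fderiv_cauchy]
    simp only [cauchyLin, prolong_g1, prolong_rho, hρ, coeffD1, hX', hd, Fin.sum_univ_four, hb']
    generalize j.g1 0 = g0
    generalize j.g1 1 = g1
    generalize j.g1 2 = g2
    generalize j.g1 3 = g3
    simp [dotProduct, cross_apply, Fin.sum_univ_three, Matrix.vecHead, Matrix.vecTail]
    ring
  · rw [fderiv_constitutive ((hh.contDiffAt (hΩ.mem_nhds hj)).differentiableAt (by simp))]
    simp only [prolong_p1, prolong_rho1, prolong_u, hu, coeffD1, hX', hd, Fin.sum_univ_four]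
    have hE' : j.p1 0 = h j.2.1.2 * j.rho1 0 := sub_eq_zero.1 hE
    have hcl := hc _ hj
    rw [pair_apply]
    simp [hE', Jet.pt]
    linear_combination j.rho1 0 * hcl

/-! ### The determining equations of first order -/

/-- The unit vector along `x^α`. -/
def eX (α : Fin 4) : Pt := (Pi.single α 1, 0)
/-- The unit vector along `γ^k`. -/
def eγ (k : Fin 3) : Pt := (0, Pi.single k 1, 0)
/-- The unit vector along `p`. -/
def eP : Pt := (0, 0, 1, 0)
/-- The unit vector along `ρ`. -/
def eR : Pt := (0, 0, 0, 1)

lemma pt_eq_sum (v : Pt) : v = (v.1 0 • eX 0 + v.1 1 • eX 1 + v.1 2 • eX 2 + v.1 3 • eX 3)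
    + (v.2.1 0 • eγ 0 + v.2.1 1 • eγ 1 + v.2.1 2 • eγ 2) + v.2.2.1 • eP + v.2.2.2 • eR := by
  refine Prod.ext ?_ (Prod.ext ?_ (Prod.ext ?_ ?_))
  · ext i
    fin_cases i <;> simp [eX, eγ, eP, eR]
  · ext i
    fin_cases i <;> simp [eX, eγ, eP, eR]
  · simp [eX, eγ, eP, eR]
  · simp [eX, eγ, eP, eR]

lemma clm_apply_pt {F : Type*} [NormedAddCommGroup F] [NormedSpace ℝ F] (L : Pt →L[ℝ] F) (v : Pt) :
    L v = (v.1 0 • L (eX 0) + v.1 1 • L (eX 1) + v.1 2 • L (eX 2) + v.1 3 • L (eX 3))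
    + (v.2.1 0 • L (eγ 0) + v.2.1 1 • L (eγ 1) + v.2.1 2 • L (eγ 2)) + v.2.2.1 • L eP
    + v.2.2.2 • L eR := by
  conv_lhs => rw [pt_eq_sum v]
  simp only [map_add, map_smul]

lemma clm_apply_dir {F : Type*} [NormedAddCommGroup F] [NormedSpace ℝ F] (L : Pt →L[ℝ] F)
    (α : Fin 4) (g : Fin 3 → ℝ) (p r : ℝ) : L (Pi.single α 1, g, p, r) =
      L (eX α) + (g 0 • L (eγ 0) + g 1 • L (eγ 1) + g 2 • L (eγ 2)) + p • L eP + r • L eR := by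
  rw [clm_apply_pt L]
  fin_cases α <;> simp

section FirstOrder

variable {Q : Set (Indep × (Fin 3 → ℝ))} {Ω : Set (ℝ × ℝ)} {h : ℝ × ℝ → ℝ} {X : Pt → Pt} {z : Pt}

/-- Every first jet that satisfies the first-order equations extends to the manifold. -/
lemma exists_mem_systemManifold {g : Fin 4 → Fin 3 → ℝ} {p r : Fin 4 → ℝ} (hz : z.2.2 ∈ Ω)
    (hh : DifferentiableAt ℝ h z.2.2) (hp : p 0 = h z.2.2 * r 0)
    (hc : z.2.2.2 * (g 1 ⬝ᵥ (g 2 ⨯₃ g 3)) = 1) :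
    ∃ G q, mkJet z g p r G q ∈ systemManifold Ω h := by
  -- Each total derivative of the Cauchy equation is met by a single second derivative proportional
  -- to a frame vector: `γ_{tξ¹}` for `α = 0` and `γ_{ξ^iξ^i}` for `α = i`. The entry `a` at `(0,
  -- 0)` stays free; the momentum is `a` plus a term independent of `a`, so it can be solved for
  -- `a`.
  set G' : (Fin 3 → ℝ) → Fin 4 → Fin 4 → Fin 3 → ℝ := fun a =>
    ![![a, -(r 0 / z.2.2.2) • g 1, 0, 0],
      ![-(r 0 / z.2.2.2) • g 1, -(r 1 / z.2.2.2) • g 1, 0, 0],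
      ![0, 0, -(r 2 / z.2.2.2) • g 2, 0], ![0, 0, 0, -(r 3 / z.2.2.2) • g 3]] with hG'
  have hz0 : z.2.2.2 ≠ 0 := left_ne_zero_of_mul_eq_one hc
  refine ⟨G' (-momentum (mkJet z g p r (G' 0) 0)), _, mkJet_mem hz hh hp hc ?_ ?_ ?_⟩
  · intro α β
    fin_cases α <;> fin_cases β <;> simp [hG']
  · intro α
    have hr : ∀ a D : ℝ, a * D + z.2.2.2 * (-(a / z.2.2.2) * D) = 0 := fun a D => by
      field_simp; ring
    fin_cases α
    · simpa [hG'] using hr (r 0) (g 1 ⬝ᵥ (g 2 ⨯₃ g 3))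
    · simpa [hG'] using hr (r 1) (g 1 ⬝ᵥ (g 2 ⨯₃ g 3))
    · simpa [hG'] using hr (r 2) (g 1 ⬝ᵥ (g 2 ⨯₃ g 3))
    · simpa [hG'] using hr (r 3) (g 1 ⬝ᵥ (g 2 ⨯₃ g 3))
  · have h1 : ∀ a, momentum (mkJet z g p r (G' a) 0) = a + momentum (mkJet z g p r (G' 0) 0) := by
      intro a
      have e1 : ∀ α, G' a 1 α = G' 0 1 α := fun α => by fin_cases α <;> simp [hG']
      have e0 : G' a 0 0 = a := by simp [hG']
      have e0' : G' 0 0 0 = 0 := by simp [hG']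
      simp only [momentum, Jet.totalPressure1, mkJet_g2, mkJet_p1, mkJet_rho, mkJet_rho1, mkJet_g1,
        e1, e0, e0']
      abel
    rw [h1]
    simp

/-- The two first-order determining equations on an arbitrary admissible first jet. The total
derivatives `d` and the prolonged `ζ` are variables fixed by equations, so that callers can supply
explicit vectors. -/
lemma Admits.first_order (hΩo : IsOpen Ω) (hh : ContDiffOn ℝ ∞ h Ω) (hX : Admits Q Ω h X)
    (hz : z ∈ dom Q Ω) {g : Fin 4 → Fin 3 → ℝ}
    {p r : Fin 4 → ℝ} (hp : p 0 = h z.2.2 * r 0) (hc : z.2.2.2 * (g 1 ⬝ᵥ (g 2 ⨯₃ g 3)) = 1)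
    {d : Fin 4 → Pt} (hd : ∀ α, d α = fderiv ℝ X z (eX α) + (g α 0 • fderiv ℝ X z (eγ 0)
      + g α 1 • fderiv ℝ X z (eγ 1) + g α 2 • fderiv ℝ X z (eγ 2)) + p α • fderiv ℝ X z eP
      + r α • fderiv ℝ X z eR)
    {ζ : Fin 4 → Fin 3 → ℝ} (hζ : ∀ α, ζ α = (d α).2.1 - ((d α).1 0 • g 0 + (d α).1 1 • g 1
      + (d α).1 2 • g 2 + (d α).1 3 • g 3)) :
    (X z).2.2.2 * (g 1 ⬝ᵥ (g 2 ⨯₃ g 3)) + z.2.2.2 * (ζ 1 ⬝ᵥ (g 2 ⨯₃ g 3)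
      + g 1 ⬝ᵥ (ζ 2 ⨯₃ g 3 + g 2 ⨯₃ ζ 3)) = 0 ∧
    ((d 0).2.2.1 - ((d 0).1 0 * p 0 + (d 0).1 1 * p 1 + (d 0).1 2 * p 2 + (d 0).1 3 * p 3))
      - (((X z).2.2.1 * fderiv ℝ h z.2.2 (1, 0) + (X z).2.2.2 * fderiv ℝ h z.2.2 (0, 1)) * r 0
        + h z.2.2 * ((d 0).2.2.2
          - ((d 0).1 0 * r 0 + (d 0).1 1 * r 1 + (d 0).1 2 * r 2 + (d 0).1 3 * r 3))) = 0 := by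
  have hdiff := (hh.contDiffAt (hΩo.mem_nhds hz.2)).differentiableAt (by simp)
  obtain ⟨G, q, hj⟩ := exists_mem_systemManifold hz.2 hdiff hp hc
  obtain ⟨-, h1, h2⟩ := hX.2 _ hj hz
  have hD : ∀ α, coeffD1 X (mkJet z g p r G q) α = d α := fun α => by
    rw [hd, coeffD1, mkJet_d1, clm_apply_dir]
    rfl
  have hζ' : ∀ α, (prolong X (mkJet z g p r G q)).g1 α = ζ α := fun α => by
    rw [prolong_g1, hD, hζ, Fin.sum_univ_four]
    rfl
  rw [fderiv_cauchy] at h1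
  rw [fderiv_constitutive hdiff, prolong_p1, prolong_rho1, prolong_u, hD, Fin.sum_univ_four,
    Fin.sum_univ_four] at h2
  constructor
  · simpa only [cauchyLin, hζ', prolong_rho, mkJet_g1, mkJet_rho, mkJet_pt] using h1
  · simpa only [mkJet_p1, mkJet_rho1, mkJet_u, mkJet_pt, ← pair_apply] using h2

end FirstOrder

/-! ### Consequences of the Cauchy equation -/

section FirstOrder

variable {Q : Set (Indep × (Fin 3 → ℝ))} {Ω : Set (ℝ × ℝ)} {h : ℝ × ℝ → ℝ} {X : Pt → Pt} {z : Pt}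

/-- The Cauchy equation on the frames `γ_{ξ^i} = s_i e_{i + m}` with `t_i = 1 / s_i`. -/
lemma Admits.cauchy_frame (hΩo : IsOpen Ω) (hh : ContDiffOn ℝ ∞ h Ω) (hX : Admits Q Ω h X)
    (hz : z ∈ dom Q Ω) (m : Fin 3) (v : Fin 3 → ℝ) {s₁ s₂ s₃ t₁ t₂ t₃ : ℝ} (h₁ : s₁ * t₁ = 1)
    (h₂ : s₂ * t₂ = 1) (h₃ : s₃ * t₃ = 1) (hs : z.2.2.2 * (s₁ * s₂ * s₃) = 1)
    (p₁ p₂ p₃ r₁ r₂ r₃ : ℝ) {d₁ d₂ d₃ : Pt}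
    (hd₁ : d₁ = fderiv ℝ X z (eX 1) + s₁ • fderiv ℝ X z (eγ m) + p₁ • fderiv ℝ X z eP
      + r₁ • fderiv ℝ X z eR)
    (hd₂ : d₂ = fderiv ℝ X z (eX 2) + s₂ • fderiv ℝ X z (eγ (m + 1)) + p₂ • fderiv ℝ X z eP
      + r₂ • fderiv ℝ X z eR)
    (hd₃ : d₃ = fderiv ℝ X z (eX 3) + s₃ • fderiv ℝ X z (eγ (m + 2)) + p₃ • fderiv ℝ X z eP
      + r₃ • fderiv ℝ X z eR) :
    (X z).2.2.2 + z.2.2.2 * ((d₁.2.1 m - d₁.1 0 * v m) * t₁ - d₁.1 1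
      + ((d₂.2.1 (m + 1) - d₂.1 0 * v (m + 1)) * t₂ - d₂.1 2)
      + ((d₃.2.1 (m + 2) - d₃.1 0 * v (m + 2)) * t₃ - d₃.1 3)) = 0 := by
  -- The inverses `t_i` are `ρ` times the lengths of the cofactor vectors. On these frames the
  -- determinant variation therefore sees only diagonal entries.
  have e₁ : t₁ = z.2.2.2 * (s₂ * s₃) := by linear_combination t₁ * (-hs) + z.2.2.2 * (s₂ * s₃) * h₁
  have e₂ : t₂ = z.2.2.2 * (s₁ * s₃) := by linear_combination t₂ * (-hs) + z.2.2.2 * (s₁ * s₃) * h₂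
  have e₃ : t₃ = z.2.2.2 * (s₁ * s₂) := by linear_combination t₃ * (-hs) + z.2.2.2 * (s₁ * s₂) * h₃
  obtain ⟨d₀, hd₀⟩ : ∃ d₀, d₀ = fderiv ℝ X z (eX 0) + (v 0 • fderiv ℝ X z (eγ 0)
      + v 1 • fderiv ℝ X z (eγ 1) + v 2 • fderiv ℝ X z (eγ 2)) := ⟨_, rfl⟩
  have key := (hX.first_order hΩo hh hz
    (g := ![v, Pi.single m s₁, Pi.single (m + 1) s₂, Pi.single (m + 2) s₃]) (p := ![0, p₁, p₂, p₃])
    (r := ![0, r₁, r₂, r₃]) (by simp) ?_ (d := ![d₀, d₁, d₂, d₃]) ?_ (fun _ => rfl)).1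
  · subst e₁ e₂ e₃
    clear hd₀ hd₁ hd₂ hd₃
    fin_cases m <;> simp [cross_apply, dotProduct, Fin.sum_univ_three] at key ⊢ <;>
      linear_combination z.2.2.2 * key
        + (z.2.2.2 * (d₁.1 1 + d₂.1 2 + d₃.1 3) - (X z).2.2.2) * hs
  · fin_cases m <;> simp [cross_apply, dotProduct, Fin.sum_univ_three] <;>
      linear_combination hs
  · intro α
    fin_cases m <;> fin_cases α <;> simp [hd₀, hd₁, hd₂, hd₃]

/-- The form of the derivative `L` of an operator at a point with density `ρ` that follows from the
Cauchy equation; `y` is the coefficient of `∂_ρ`. -/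
structure CauchyForm (L : Pt →L[ℝ] Pt) (ρ y : ℝ) : Prop where
  x1 : (L (eX 1)).1 0 = 0 ∧ (L (eX 1)).2.1 = 0
  x2 : (L (eX 2)).1 0 = 0 ∧ (L (eX 2)).2.1 = 0
  x3 : (L (eX 3)).1 0 = 0 ∧ (L (eX 3)).2.1 = 0
  g : ∀ k, (L (eγ k)).1 = 0
  p : (L eP).1 = 0 ∧ (L eP).2.1 = 0
  r : (L eR).1 = 0 ∧ (L eR).2.1 = 0
  y_eq : y = ρ * ((L (eX 1)).1 1 + (L (eX 2)).1 2 + (L (eX 3)).1 3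
    - ((L (eγ 0)).2.1 0 + (L (eγ 1)).2.1 1 + (L (eγ 2)).2.1 2))

lemma eq_zero_of_forall_affine {a b p r : ℝ}
    (H : ∀ s, s ≠ 0 → ∀ x y : ℝ, a + s * b + x * p + y * r = 0) :
    a = 0 ∧ b = 0 ∧ p = 0 ∧ r = 0 := by
  have h1 := H 1 (by norm_num) 0 0
  have h2 := H 2 (by norm_num) 0 0
  have h3 := H 1 (by norm_num) 1 0
  have h4 := H 1 (by norm_num) 0 1
  refine ⟨?_, ?_, ?_, ?_⟩ <;> linarith

lemma eq_zero_of_forall_inv {a b : ℝ} (H : ∀ s, s ≠ 0 → a * s⁻¹ - b * s = 0) :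
    a = 0 ∧ b = 0 := by
  have h1 := H 1 (by norm_num)
  have h2 := H 2 (by norm_num)
  norm_num at h1 h2
  constructor <;> linarith

lemma eq_zero_of_forall_inv_const {a b : ℝ} (H : ∀ s, s ≠ 0 → a * s⁻¹ - b = 0) :
    a = 0 ∧ b = 0 := by
  have h1 := H 1 (by norm_num)
  have h2 := H 2 (by norm_num)
  norm_num at h1 h2
  constructor <;> linarith

lemma ext_fin4 {f : Fin 4 → ℝ} (h0 : f 0 = 0) (h1 : f 1 = 0) (h2 : f 2 = 0) (h3 : f 3 = 0) :
    f = 0 := by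
  ext i
  fin_cases i <;> assumption

/-- On orthogonal frames the Cauchy determining equation is polynomial in the free data `v`, `s_i`,
`s_i⁻¹`, `p_i`, `r_i`, subject to `ρ s₁s₂s₃ = 1`. Separating it, for each cyclic labelling `m` of
the axes, gives all the entries. -/
theorem Admits.cauchyForm (hΩo : IsOpen Ω) (hpos : ∀ w ∈ Ω, 0 < w.2) (hh : ContDiffOn ℝ ∞ h Ω)
    (hX : Admits Q Ω h X) (hz : z ∈ dom Q Ω) :
    CauchyForm (fderiv ℝ X z) z.2.2.2 (X z).2.2.2 := by
  have hρ : z.2.2.2 ≠ 0 := (hpos _ hz.2).ne'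
  have frame := fun m v {s₁ s₂ s₃ : ℝ} (h1 : s₁ ≠ 0) (h2 : s₂ ≠ 0) (h3 : s₃ ≠ 0)
    (hs : z.2.2.2 * (s₁ * s₂ * s₃) = 1) p₁ p₂ p₃ r₁ r₂ r₃ =>
    hX.cauchy_frame hΩo hh hz m v (mul_inv_cancel₀ h1) (mul_inv_cancel₀ h2) (mul_inv_cancel₀ h3)
      hs p₁ p₂ p₃ r₁ r₂ r₃ rfl rfl rfl
  generalize fderiv ℝ X z = L at frame ⊢
  generalize z.2.2.2 = ρ at frame hρ ⊢
  generalize (X z).2.2.2 = y at frame ⊢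
  have hne : ∀ m : Fin 3, m + 1 ≠ m ∧ m + 2 ≠ m := by decide
  -- The velocity enters only through the coefficient of `∂_t`. Subtracting the equation for `v = 0`
  -- from that for `v = e_m` leaves `D_{ξ¹} ξ^t = 0`, which is affine in `s₁`, `p₁`, `r₁`.
  have ht₁ : ∀ m, (L (eX 1)).1 0 = 0 ∧ (L (eγ m)).1 0 = 0 ∧ (L eP).1 0 = 0 ∧ (L eR).1 0 = 0 := by
    intro m
    refine eq_zero_of_forall_affine fun s hs x y => ?_
    have e1 := frame m (Pi.single m 1) hs one_ne_zero (s₃ := (ρ * s)⁻¹) (by positivity)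
      (by field_simp) x 0 0 y 0 0
    have e2 := frame m 0 hs one_ne_zero (s₃ := (ρ * s)⁻¹) (by positivity) (by field_simp) x 0 0 y 0 0
    obtain ⟨n1, n2⟩ := hne m
    simp [n1, n2] at e1 e2
    field_simp at e1 e2
    refine mul_left_cancel₀ hρ ?_
    linear_combination e2 - e1
  have ht₂ : (L (eX 2)).1 0 = 0 := by
    have e1 := frame 0 (Pi.single 1 1) one_ne_zero one_ne_zero (s₃ := ρ⁻¹) (by positivity)
      (by field_simp) 0 0 0 0 0 0
    have e2 := frame 0 0 one_ne_zero one_ne_zero (s₃ := ρ⁻¹) (by positivity)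
      (by field_simp) 0 0 0 0 0 0
    simp [(ht₁ _).2.1] at e1 e2
    refine mul_left_cancel₀ hρ ?_
    linear_combination e2 - e1
  have ht₃ : (L (eX 3)).1 0 = 0 := by
    have e1 := frame 0 (Pi.single 2 1) (s₁ := ρ⁻¹) (by positivity) one_ne_zero one_ne_zero
      (by field_simp) 0 0 0 0 0 0
    have e2 := frame 0 0 (s₁ := ρ⁻¹) (by positivity) one_ne_zero one_ne_zero
      (by field_simp) 0 0 0 0 0 0
    simp [(ht₁ _).2.1] at e1 e2
    refine mul_left_cancel₀ hρ ?_
    linear_combination e2 - e1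
  have hp₁ : ∀ m, (L eP).2.1 m = 0 ∧ (L eP).1 1 = 0 := fun m => by
    refine eq_zero_of_forall_inv_const fun s hs => ?_
    have e1 := frame m 0 hs one_ne_zero (s₃ := (ρ * s)⁻¹) (by positivity) (by field_simp) 1 0 0 0 0 0
    have e2 := frame m 0 hs one_ne_zero (s₃ := (ρ * s)⁻¹) (by positivity) (by field_simp) 0 0 0 0 0 0
    simp at e1 e2
    refine mul_left_cancel₀ hρ ?_
    linear_combination e1 - e2
  have hr₁ : ∀ m, (L eR).2.1 m = 0 ∧ (L eR).1 1 = 0 := fun m => by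
    refine eq_zero_of_forall_inv_const fun s hs => ?_
    have e1 := frame m 0 hs one_ne_zero (s₃ := (ρ * s)⁻¹) (by positivity) (by field_simp) 0 0 0 1 0 0
    have e2 := frame m 0 hs one_ne_zero (s₃ := (ρ * s)⁻¹) (by positivity) (by field_simp) 0 0 0 0 0 0
    simp at e1 e2
    refine mul_left_cancel₀ hρ ?_
    linear_combination e1 - e2
  have hP : (L eP).2.1 = 0 := funext fun m => (hp₁ m).1
  have hR : (L eR).2.1 = 0 := funext fun m => (hr₁ m).1
  have base := fun p₁ p₂ p₃ r₁ r₂ r₃ => frame 0 0 one_ne_zero one_ne_zero (s₃ := ρ⁻¹)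
    (by positivity) (by field_simp) p₁ p₂ p₃ r₁ r₂ r₃
  simp only [Prod.fst_add, Prod.snd_add, Prod.smul_fst, Prod.smul_snd, hP, hR, Pi.add_apply,
    Pi.smul_apply, smul_zero, smul_eq_mul, Pi.zero_apply] at base
  have hP0 : (L eP).1 = 0 := ext_fin4 (ht₁ 0).2.2.1 (hp₁ 0).2
    (mul_left_cancel₀ hρ (by linear_combination base 0 0 0 0 0 0 - base 0 1 0 0 0 0))
    (mul_left_cancel₀ hρ (by linear_combination base 0 0 0 0 0 0 - base 0 0 1 0 0 0))
  have hR0 : (L eR).1 = 0 := ext_fin4 (ht₁ 0).2.2.2 (hr₁ 0).2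
    (mul_left_cancel₀ hρ (by linear_combination base 0 0 0 0 0 0 - base 0 0 0 0 1 0))
    (mul_left_cancel₀ hρ (by linear_combination base 0 0 0 0 0 0 - base 0 0 0 0 0 1))
  -- Reversing two of the three `s_i` keeps their product. Of the four sign patterns, the
  -- combinations odd in one `s_i` isolate its off-diagonal terms, and the average gives the formula
  -- for `y`.
  have signs : ∀ (m : Fin 3) {s₁ s₂ s₃ : ℝ}, s₁ ≠ 0 → s₂ ≠ 0 → s₃ ≠ 0 → ρ * (s₁ * s₂ * s₃) = 1 →
      (L (eX 1)).2.1 m * s₁⁻¹ - (L (eγ m)).1 1 * s₁ = 0 ∧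
      (L (eX 2)).2.1 (m + 1) * s₂⁻¹ - (L (eγ (m + 1))).1 2 * s₂ = 0 ∧
      (L (eX 3)).2.1 (m + 2) * s₃⁻¹ - (L (eγ (m + 2))).1 3 * s₃ = 0 ∧
      y = ρ * ((L (eX 1)).1 1 + (L (eX 2)).1 2 + (L (eX 3)).1 3
        - ((L (eγ m)).2.1 m + (L (eγ (m + 1))).2.1 (m + 1) + (L (eγ (m + 2))).2.1 (m + 2))) := by
    intro m s₁ s₂ s₃ h1 h2 h3 hs
    have e1 := frame m 0 h1 h2 h3 hs 0 0 0 0 0 0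
    have e2 := frame m 0 (neg_ne_zero.2 h1) (neg_ne_zero.2 h2) h3 (by linear_combination hs)
      0 0 0 0 0 0
    have e3 := frame m 0 (neg_ne_zero.2 h1) h2 (neg_ne_zero.2 h3) (by linear_combination hs)
      0 0 0 0 0 0
    have e4 := frame m 0 h1 (neg_ne_zero.2 h2) (neg_ne_zero.2 h3) (by linear_combination hs)
      0 0 0 0 0 0
    have i1 := mul_inv_cancel₀ h1
    have i2 := mul_inv_cancel₀ h2
    have i3 := mul_inv_cancel₀ h3
    simp only [inv_neg] at e1 e2 e3 e4
    generalize s₁⁻¹ = t₁ at *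
    generalize s₂⁻¹ = t₂ at *
    generalize s₃⁻¹ = t₃ at *
    simp at e1 e2 e3 e4
    refine ⟨?_, ?_, ?_, ?_⟩
    · refine mul_left_cancel₀ hρ ?_
      linear_combination (e1 + e4 - e2 - e3) / 4
    · refine mul_left_cancel₀ hρ ?_
      linear_combination (e1 + e3 - e2 - e4) / 4
    · refine mul_left_cancel₀ hρ ?_
      linear_combination (e1 + e2 - e3 - e4) / 4
    · linear_combination (e1 + e2 + e3 + e4) / 4 - ρ * (L (eγ m)).2.1 m * i1
        - ρ * (L (eγ (m + 1))).2.1 (m + 1) * i2 - ρ * (L (eγ (m + 2))).2.1 (m + 2) * i3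
  have h1 : ∀ m, (L (eX 1)).2.1 m = 0 ∧ (L (eγ m)).1 1 = 0 := fun m =>
    eq_zero_of_forall_inv fun s hs => (signs m hs one_ne_zero (s₃ := (ρ * s)⁻¹) (by positivity)
      (by field_simp)).1
  have h2 : ∀ m, (L (eX 2)).2.1 (m + 1) = 0 ∧ (L (eγ (m + 1))).1 2 = 0 := fun m =>
    eq_zero_of_forall_inv fun s hs => (signs m one_ne_zero hs (s₃ := (ρ * s)⁻¹) (by positivity)
      (by field_simp)).2.1
  have h3 : ∀ m, (L (eX 3)).2.1 (m + 2) = 0 ∧ (L (eγ (m + 2))).1 3 = 0 := fun m =>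
    eq_zero_of_forall_inv fun s hs => (signs m (s₁ := (ρ * s)⁻¹) (by positivity) one_ne_zero hs
      (by field_simp)).2.2.1
  have s1 : ∀ m : Fin 3, m - 1 + 1 = m := by decide
  have s2 : ∀ m : Fin 3, m - 2 + 2 = m := by decide
  refine ⟨⟨(ht₁ 0).1, funext fun m => (h1 m).1⟩,
    ⟨ht₂, funext fun m => by have := (h2 (m - 1)).1; rwa [s1] at this⟩,
    ⟨ht₃, funext fun m => by have := (h3 (m - 2)).1; rwa [s2] at this⟩,
    fun m => ext_fin4 (ht₁ m).2.1 (h1 m).2 (by simpa only [s1] using (h2 (m - 1)).2)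
      (by simpa only [s2] using (h3 (m - 2)).2), ⟨hP0, hP⟩, ⟨hR0, hR⟩, ?_⟩
  exact (signs 0 one_ne_zero one_ne_zero (s₃ := ρ⁻¹) (by positivity) (by field_simp)).2.2.2

end FirstOrder

/-! ### Consequences of the constitutive equation -/

section FirstOrder

variable {Q : Set (Indep × (Fin 3 → ℝ))} {Ω : Set (ℝ × ℝ)} {h : ℝ × ℝ → ℝ} {X : Pt → Pt} {z : Pt}

/-- The form of the derivative `L` of an operator `y` that follows from the constitutive equation;
`a`, `a₁`, `a₂` are the values of `h`, `h_p`, `h_ρ`. -/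
structure ConstitutiveForm (L : Pt →L[ℝ] Pt) (y : ℝ × ℝ) (a a₁ a₂ : ℝ) : Prop where
  t : (L (eX 0)).1 1 = 0 ∧ (L (eX 0)).1 2 = 0 ∧ (L (eX 0)).1 3 = 0
  t_eq : (L (eX 0)).2.2.1 = a * (L (eX 0)).2.2.2
  g_eq : ∀ k, (L (eγ k)).2.2.1 = a * (L (eγ k)).2.2.2
  class_eq : a * (L eP).2.2.1 + (L eR).2.2.1 - a * (a * (L eP).2.2.2 + (L eR).2.2.2)
    = y.1 * a₁ + y.2 * a₂

/-- On a fixed frame `γ_t = v`, `ρ_t = r` and the spatial derivatives `p_i` are free, with `p_t = h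
r`. The coefficients of `p_i` and `v` give the independence statements, and the coefficient of `r`
gives the classifying relation. The contributions of `ξ^t_t` cancel because `p_t = h ρ_t`. -/
theorem Admits.constitutiveForm (hΩo : IsOpen Ω) (hpos : ∀ w ∈ Ω, 0 < w.2)
    (hh : ContDiffOn ℝ ∞ h Ω) (hX : Admits Q Ω h X) (hz : z ∈ dom Q Ω) :
    ConstitutiveForm (fderiv ℝ X z) (X z).2.2 (h z.2.2) (fderiv ℝ h z.2.2 (1, 0))
      (fderiv ℝ h z.2.2 (0, 1)) := by
  have hρ : z.2.2.2 ≠ 0 := (hpos _ hz.2).ne'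
  have hC := hX.cauchyForm hΩo hpos hh hz
  have key : ∀ (v : Fin 3 → ℝ) (r p₁ p₂ p₃ : ℝ), _ := fun v r p₁ p₂ p₃ =>
    (hX.first_order hΩo hh hz
      (g := ![v, Pi.single 0 1, Pi.single 1 1, Pi.single 2 z.2.2.2⁻¹])
      (p := ![h z.2.2 * r, p₁, p₂, p₃]) (r := ![r, 0, 0, 0]) (by simp)
      (by simp [cross_apply, dotProduct, Fin.sum_univ_three, hρ]) (fun _ => rfl) (fun _ => rfl)).2
  simp [hC.g, hC.p, hC.r] at key
  have k0 := key 0 0 0 0 0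
  have k1 := key 0 0 1 0 0
  have k2 := key 0 0 0 1 0
  have k3 := key 0 0 0 0 1
  have kr := key 0 1 0 0 0
  have kv : ∀ k, _ := fun k => key (Pi.single k 1) 0 0 0 0
  simp at k0 k1 k2 k3 kr kv
  have t1 : (fderiv ℝ X z (eX 0)).1 1 = 0 := by linarith
  have t2 : (fderiv ℝ X z (eX 0)).1 2 = 0 := by linarith
  have t3 : (fderiv ℝ X z (eX 0)).1 3 = 0 := by linarith
  refine ⟨⟨t1, t2, t3⟩, by linarith, fun k => ?_, by linarith⟩
  have := kv k
  fin_cases k <;> simp at this ⊢ <;> linarith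

end FirstOrder

section SecondOrder

variable {Q : Set (Indep × (Fin 3 → ℝ))} {Ω : Set (ℝ × ℝ)} {h : ℝ × ℝ → ℝ} {X : Pt → Pt} {z : Pt}

/-! ### The determining equations of second order -/

/-- The form of the second derivative `H` of an admitted operator that follows from the first-order
determining equations. -/
structure SecondForm (H : Pt →L[ℝ] Pt →L[ℝ] Pt) : Prop where
  symm : ∀ v w, H v w = H w v
  t : ∀ v, (H v (eX 0)).1 1 = 0 ∧ (H v (eX 0)).1 2 = 0 ∧ (H v (eX 0)).1 3 = 0
  x1 : ∀ v, (H v (eX 1)).1 0 = 0 ∧ (H v (eX 1)).2.1 = 0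
  x2 : ∀ v, (H v (eX 2)).1 0 = 0 ∧ (H v (eX 2)).2.1 = 0
  x3 : ∀ v, (H v (eX 3)).1 0 = 0 ∧ (H v (eX 3)).2.1 = 0
  g : ∀ v k, (H v (eγ k)).1 = 0
  p : ∀ v, (H v eP).1 = 0 ∧ (H v eP).2.1 = 0
  r : ∀ v, (H v eR).1 = 0 ∧ (H v eR).2.1 = 0

lemma map_fderiv_fderiv_eq_zero {D : Set Pt} (hX : ContDiffOn ℝ ∞ X D) (hD : IsOpen D)
    (hz : z ∈ D) (w : Pt) {F : Type*} [NormedAddCommGroup F] [NormedSpace ℝ F] (φ : Pt →L[ℝ] F)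
    (hf : ∀ z ∈ D, φ (fderiv ℝ X z w) = 0) (v : Pt) : φ (fderiv ℝ (fderiv ℝ X) z v w) = 0 := by
  rw [map_fderiv_fderiv hX hD hz w φ hf]
  simp

/-- The projection of an operator to its `∂_{x^α}` coefficients. -/
def pX : Pt →L[ℝ] Indep := ContinuousLinearMap.fst ℝ _ _
/-- The coefficient of `∂_{x^α}`. -/
def pXi (α : Fin 4) : Pt →L[ℝ] ℝ := (ContinuousLinearMap.proj α).comp pX
/-- The projection of an operator to its `∂_γ` coefficients. -/
def pG : Pt →L[ℝ] (Fin 3 → ℝ) :=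
  (ContinuousLinearMap.fst ℝ _ _).comp (ContinuousLinearMap.snd ℝ _ _)
/-- The coefficient of `∂_{γ^k}`. -/
def pGk (k : Fin 3) : Pt →L[ℝ] ℝ := (ContinuousLinearMap.proj k).comp pG
/-- The coefficient of `∂_p`. -/
def pP : Pt →L[ℝ] ℝ := (ContinuousLinearMap.fst ℝ _ _).comp
  ((ContinuousLinearMap.snd ℝ _ _).comp (ContinuousLinearMap.snd ℝ _ _))
/-- The coefficient of `∂_ρ`. -/
def pR : Pt →L[ℝ] ℝ := (ContinuousLinearMap.snd ℝ _ _).comp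
  ((ContinuousLinearMap.snd ℝ _ _).comp (ContinuousLinearMap.snd ℝ _ _))

theorem Admits.secondForm (hQo : IsOpen Q) (hΩo : IsOpen Ω) (hpos : ∀ w ∈ Ω, 0 < w.2)
    (hh : ContDiffOn ℝ ∞ h Ω) (hX : Admits Q Ω h X) (hz : z ∈ dom Q Ω) :
    SecondForm (fderiv ℝ (fderiv ℝ X) z) := by
  have C := fun z (hz : z ∈ dom Q Ω) => hX.cauchyForm hΩo hpos hh hz
  have E := fun z (hz : z ∈ dom Q Ω) => hX.constitutiveForm hΩo hpos hh hz
  have H0 := fun w {F : Type} [NormedAddCommGroup F] [NormedSpace ℝ F] (φ : Pt →L[ℝ] F) =>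
    map_fderiv_fderiv_eq_zero hX.1 (isOpen_dom hQo hΩo) hz w φ
  exact ⟨fderiv_fderiv_comm hX.1 (isOpen_dom hQo hΩo) hz,
    fun v => ⟨H0 _ (pXi 1) (fun z hz => (E z hz).t.1) v, H0 _ (pXi 2) (fun z hz => (E z hz).t.2.1) v,
      H0 _ (pXi 3) (fun z hz => (E z hz).t.2.2) v⟩,
    fun v => ⟨H0 _ (pXi 0) (fun z hz => (C z hz).x1.1) v, H0 _ pG (fun z hz => (C z hz).x1.2) v⟩,
    fun v => ⟨H0 _ (pXi 0) (fun z hz => (C z hz).x2.1) v, H0 _ pG (fun z hz => (C z hz).x2.2) v⟩,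
    fun v => ⟨H0 _ (pXi 0) (fun z hz => (C z hz).x3.1) v, H0 _ pG (fun z hz => (C z hz).x3.2) v⟩,
    fun v k => H0 _ pX (fun z hz => (C z hz).g k) v,
    fun v => ⟨H0 _ pX (fun z hz => (C z hz).p.1) v, H0 _ pG (fun z hz => (C z hz).p.2) v⟩,
    fun v => ⟨H0 _ pX (fun z hz => (C z hz).r.1) v, H0 _ pG (fun z hz => (C z hz).r.2) v⟩⟩

/-- The derivative of the coefficient of `∂_ρ`. -/
lemma Admits.rho_form (hQo : IsOpen Q) (hΩo : IsOpen Ω) (hpos : ∀ w ∈ Ω, 0 < w.2)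
    (hh : ContDiffOn ℝ ∞ h Ω) (hX : Admits Q Ω h X) (hz : z ∈ dom Q Ω) {L : Pt →L[ℝ] Pt}
    (hL : L = fderiv ℝ X z) {H : Pt →L[ℝ] Pt →L[ℝ] Pt} (hH : H = fderiv ℝ (fderiv ℝ X) z)
    (w : Pt) : (L w).2.2.2 = w.2.2.2 * ((L (eX 1)).1 1 + (L (eX 2)).1 2 + (L (eX 3)).1 3
        - ((L (eγ 0)).2.1 0 + (L (eγ 1)).2.1 1 + (L (eγ 2)).2.1 2))
      + z.2.2.2 * ((H w (eX 1)).1 1 + (H w (eX 2)).1 2 + (H w (eX 3)).1 3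
        - ((H w (eγ 0)).2.1 0 + (H w (eγ 1)).2.1 1 + (H w (eγ 2)).2.1 2)) := by
  have hD := isOpen_dom hQo hΩo
  have h1 : (fun z => pR (X z)) =ᶠ[nhds z] fun z => z.2.2.2 * (pXi 1 (fderiv ℝ X z (eX 1))
      + pXi 2 (fderiv ℝ X z (eX 2)) + pXi 3 (fderiv ℝ X z (eX 3)) - (pGk 0 (fderiv ℝ X z (eγ 0))
      + pGk 1 (fderiv ℝ X z (eγ 1)) + pGk 2 (fderiv ℝ X z (eγ 2)))) := by
    filter_upwards [hD.mem_nhds hz] with y hy using (hX.cauchyForm hΩo hpos hh hy).y_eq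
  have hd : HasFDerivAt X L z := hL ▸
    ((contDiffAt_of_mem hX.1 hD hz).differentiableAt (by simp)).hasFDerivAt
  have hl : ∀ (φ : Pt →L[ℝ] ℝ) (e : Pt), HasFDerivAt (fun z => φ (fderiv ℝ X z e))
      (φ.comp (H.flip e)) z := by
    intro φ e
    have h2 : HasFDerivAt (fun z => fderiv ℝ X z e) (H.flip e) z := by
      simpa [hH] using
        (differentiableAt_fderiv hX.1 hD hz).hasFDerivAt.clm_apply (hasFDerivAt_const e z)
    exact φ.hasFDerivAt.comp z h2
  have hr : HasFDerivAt (fun z : Pt => z.2.2.2) pR z := pR.hasFDerivAt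
  have h2 := hr.mul ((((hl (pXi 1) (eX 1)).add (hl (pXi 2) (eX 2))).add (hl (pXi 3) (eX 3))).sub
    (((hl (pGk 0) (eγ 0)).add (hl (pGk 1) (eγ 1))).add (hl (pGk 2) (eγ 2))))
  have h3 := congrArg (fun M => M w) ((pR.hasFDerivAt.comp z hd).unique (h2.congr_of_eventuallyEq h1))
  simp [← hL] at h3
  change (L w).2.2.2 = _ at h3
  rw [h3]
  simp only [pXi, pGk, pX, pG, pR]
  simp
  ring

/-- The momentum determining equation on the second jet that is given by `γ_α = g α`, `p_α = p α`,
`ρ_α = r α`, `γ_{αβ} = G α β`. -/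
theorem Admits.second_order (hΩo : IsOpen Ω) (hpos : ∀ w ∈ Ω, 0 < w.2)
    (hh : ContDiffOn ℝ ∞ h Ω) (hX : Admits Q Ω h X)
    (hz : z ∈ dom Q Ω) {g : Fin 4 → Fin 3 → ℝ} {p r : Fin 4 → ℝ} {G : Fin 4 → Fin 4 → Fin 3 → ℝ}
    (hp : p 0 = h z.2.2 * r 0) (hc : z.2.2.2 * (g 1 ⬝ᵥ (g 2 ⨯₃ g 3)) = 1)
    (hG : ∀ α β, G α β = G β α)
    (hD : ∀ α, r α * (g 1 ⬝ᵥ (g 2 ⨯₃ g 3)) + z.2.2.2 * (G α 1 ⬝ᵥ (g 2 ⨯₃ g 3)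
      + g 1 ⬝ᵥ (G α 2 ⨯₃ g 3 + g 2 ⨯₃ G α 3)) = 0)
    (hM : momentum (mkJet z g p r G 0) = 0)
    {L : Pt →L[ℝ] Pt} (hL : L = fderiv ℝ X z) {H : Pt →L[ℝ] Pt →L[ℝ] Pt}
    (hH : H = fderiv ℝ (fderiv ℝ X) z) {d : Fin 4 → Pt} (hd : ∀ α, d α = L (eX α) + (g α 0 • L (eγ 0)
      + g α 1 • L (eγ 1) + g α 2 • L (eγ 2)) + p α • L eP + r α • L eR)
    {dd : Fin 4 → Fin 4 → Pt}
    (hdd : ∀ α β, dd α β = H (Pi.single α 1, g α, p α, r α) (Pi.single β 1, g β, p β, r β)) :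
    momentumLin (mkJet z g p r G 0) (mkJet (X z)
      (fun α => (d α).2.1 - ((d α).1 0 • g 0 + (d α).1 1 • g 1 + (d α).1 2 • g 2 + (d α).1 3 • g 3))
      (fun α => (d α).2.2.1 - ((d α).1 0 * p 0 + (d α).1 1 * p 1 + (d α).1 2 * p 2
        + (d α).1 3 * p 3))
      (fun α => (d α).2.2.2 - ((d α).1 0 * r 0 + (d α).1 1 * r 1 + (d α).1 2 * r 2
        + (d α).1 3 * r 3))
      (fun α β => ((dd α β).2.1 + (G α β 0 • (L (eγ 0)).2.1 + G α β 1 • (L (eγ 1)).2.1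
          + G α β 2 • (L (eγ 2)).2.1))
        - ((d α).1 0 • G 0 β + (d α).1 1 • G 1 β + (d α).1 2 • G 2 β + (d α).1 3 • G 3 β)
        - ((d β).1 0 • G 0 α + (d β).1 1 • G 1 α + (d β).1 2 • G 2 α + (d β).1 3 • G 3 α)
        - ((dd α β).1 0 • g 0 + (dd α β).1 1 • g 1 + (dd α β).1 2 • g 2 + (dd α β).1 3 • g 3))
      0) = 0 := by
  have hdiff := (hh.contDiffAt (hΩo.mem_nhds hz.2)).differentiableAt (by simp)
  have hj := mkJet_mem hz.2 hdiff hp hc hG hD hM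
  have C := hX.cauchyForm hΩo hpos hh hz
  rw [← hL] at C
  -- The values `p_{αβ}` in `q` are those forced by the constitutive equation. They drop out of the
  -- prolonged momentum, because it contains no `p_{αβ}` and the `∂_x` and `∂_γ` coefficients do not
  -- depend on `p`. The conclusion can therefore be stated with `0` in place of `q`.
  set q : Fin 4 → Fin 4 → ℝ := _
  change mkJet z g p r G q ∈ _ at hj
  have h1 := (hX.2 _ hj hz).1
  have hd' : ∀ α, coeffD1 X (mkJet z g p r G q) α = d α := fun α => by
    rw [hd, coeffD1, mkJet_d1, clm_apply_dir, mkJet_pt, hL]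
  have hl : ∀ α β, L (0, (mkJet z g p r G q).d2 α β) = G α β 0 • L (eγ 0) + G α β 1 • L (eγ 1)
      + G α β 2 • L (eγ 2) + q α β • L eP := fun α β => by
    rw [clm_apply_pt]
    simp
  have hdd1 : ∀ α β, (coeffD2 X (mkJet z g p r G q) α β).1 = (dd α β).1 := fun α β => by
    rw [coeffD2, mkJet_pt, ← hL, hl]
    simp [C.g, C.p, ← hH, hdd]
  have hdd2 : ∀ α β, (coeffD2 X (mkJet z g p r G q) α β).2.1 = (dd α β).2.1
      + (G α β 0 • (L (eγ 0)).2.1 + G α β 1 • (L (eγ 1)).2.1 + G α β 2 • (L (eγ 2)).2.1) :=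
    fun α β => by
    rw [coeffD2, mkJet_pt, ← hL, hl]
    simp [C.p, ← hH, hdd]
  rw [fderiv_momentum] at h1
  simp only [momentumLin, totalPressureLin, Jet.totalPressure1, prolong_rho, prolong_g1, prolong_p1,
    prolong_rho1, prolong_g2, hd', hdd1, hdd2, Fin.sum_univ_four, mkJet_pt, mkJet_rho, mkJet_g1,
    mkJet_p1, mkJet_rho1, mkJet_g2] at h1 ⊢
  exact h1

end SecondOrder

/-! ### Velocity dependence of the momentum equation -/

section SecondOrder

variable {Q : Set (Indep × (Fin 3 → ℝ))} {Ω : Set (ℝ × ℝ)} {h : ℝ × ℝ → ℝ} {X : Pt → Pt} {z : Pt}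

/-- The vanishing mixed derivatives reduce `D_t²` of the coefficients, apart from terms in second
jets, to a polynomial of degree two in the velocity, without `p_t` and `ρ_t`. -/
lemma SecondForm.dir_t {H : Pt →L[ℝ] Pt →L[ℝ] Pt} (S : SecondForm H) (v : Fin 3 → ℝ) (p r : ℝ) :
    (H (Pi.single 0 1, v, p, r) (Pi.single 0 1, v, p, r)).1 = Pi.single 0 ((H (eX 0) (eX 0)).1 0) ∧
    (H (Pi.single 0 1, v, p, r) (Pi.single 0 1, v, p, r)).2.1 = (H (eX 0) (eX 0)).2.1
      + (2 : ℝ) • (v 0 • (H (eX 0) (eγ 0)).2.1 + v 1 • (H (eX 0) (eγ 1)).2.1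
        + v 2 • (H (eX 0) (eγ 2)).2.1)
      + (v 0 • (v 0 • (H (eγ 0) (eγ 0)).2.1 + v 1 • (H (eγ 0) (eγ 1)).2.1
          + v 2 • (H (eγ 0) (eγ 2)).2.1)
        + v 1 • (v 0 • (H (eγ 1) (eγ 0)).2.1 + v 1 • (H (eγ 1) (eγ 1)).2.1
          + v 2 • (H (eγ 1) (eγ 2)).2.1)
        + v 2 • (v 0 • (H (eγ 2) (eγ 0)).2.1 + v 1 • (H (eγ 2) (eγ 1)).2.1
          + v 2 • (H (eγ 2) (eγ 2)).2.1)) := by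
  have hγ : ∀ k w, (H (eγ k) w).1 = 0 := fun k w => by rw [S.symm]; exact S.g w k
  have hp : ∀ w, (H eP w).1 = 0 ∧ (H eP w).2.1 = 0 := fun w => by rw [S.symm]; exact S.p w
  have hr : ∀ w, (H eR w).1 = 0 ∧ (H eR w).2.1 = 0 := fun w => by rw [S.symm]; exact S.r w
  constructor
  · rw [clm_apply_dir (H _), clm_apply_dir H]
    ext i
    have := S.t (eX 0)
    fin_cases i <;> simp [S.g, S.p, S.r, hγ, hp, hr, this]
  · rw [clm_apply_dir (H _), clm_apply_dir H]
    ext i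
    simp [S.p, S.r, hp, hr, S.symm _ (eX 0)]
    ring

/-- For spatial directions the `∂_x` part no longer depends on the frame, and the `∂_γ` part is
purely bilinear in it through `η_{γγ}`. -/
lemma SecondForm.dir_x {H : Pt →L[ℝ] Pt →L[ℝ] Pt} (S : SecondForm H) {α β : Fin 4}
    (hα : α ≠ 0) (hβ : β ≠ 0) (v w : Fin 3 → ℝ) (p r p' r' : ℝ) :
    (H (Pi.single α 1, v, p, r) (Pi.single β 1, w, p', r')).1 = (H (eX α) (eX β)).1 ∧
    (H (Pi.single α 1, v, p, r) (Pi.single β 1, w, p', r')).2.1 =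
      (v 0 • (w 0 • (H (eγ 0) (eγ 0)).2.1 + w 1 • (H (eγ 0) (eγ 1)).2.1
          + w 2 • (H (eγ 0) (eγ 2)).2.1)
        + v 1 • (w 0 • (H (eγ 1) (eγ 0)).2.1 + w 1 • (H (eγ 1) (eγ 1)).2.1
          + w 2 • (H (eγ 1) (eγ 2)).2.1)
        + v 2 • (w 0 • (H (eγ 2) (eγ 0)).2.1 + w 1 • (H (eγ 2) (eγ 1)).2.1
          + w 2 • (H (eγ 2) (eγ 2)).2.1)) := by
  have hγ : ∀ k w, (H (eγ k) w).1 = 0 := fun k w => by rw [S.symm]; exact S.g w k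
  have hp : ∀ w, (H eP w).1 = 0 ∧ (H eP w).2.1 = 0 := fun w => by rw [S.symm]; exact S.p w
  have hr : ∀ w, (H eR w).1 = 0 ∧ (H eR w).2.1 = 0 := fun w => by rw [S.symm]; exact S.r w
  have hx' : ∀ β : Fin 4, β ≠ 0 → ∀ v, (H v (eX β)).2.1 = 0 := by
    intro β hβ v
    fin_cases β
    · exact absurd rfl hβ
    · exact (S.x1 v).2
    · exact (S.x2 v).2
    · exact (S.x3 v).2
  have hx : ∀ w, (H (eX α) w).2.1 = 0 := fun w => by rw [S.symm]; exact hx' α hα w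
  constructor
  · rw [clm_apply_dir (H _), clm_apply_dir H]
    ext i
    simp [S.g, S.p, S.r, hγ, hp, hr]
  · rw [clm_apply_dir (H _), clm_apply_dir H]
    ext i
    simp [S.p, S.r, hp, hr, hx, hx' β hβ]
    ring

/-- The dependence of the momentum equation on the velocity `γ_t`. -/
theorem Admits.velocity_form (hQo : IsOpen Q) (hΩo : IsOpen Ω) (hpos : ∀ w ∈ Ω, 0 < w.2)
    (hh : ContDiffOn ℝ ∞ h Ω) (hX : Admits Q Ω h X) (hz : z ∈ dom Q Ω)
    {H : Pt →L[ℝ] Pt →L[ℝ] Pt} (hH : H = fderiv ℝ (fderiv ℝ X) z) :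
    (∀ k l, (H (eγ k) (eγ l)).2.1 = 0) ∧
    ∀ k, (2 : ℝ) • (H (eX 0) (eγ k)).2.1 = Pi.single k ((H (eX 0) (eX 0)).1 0) := by
  have hρ : z.2.2.2 ≠ 0 := (hpos _ hz.2).ne'
  have C := hX.cauchyForm hΩo hpos hh hz
  have E := hX.constitutiveForm hΩo hpos hh hz
  have S := hX.secondForm hQo hΩo hpos hh hz
  rw [← hH] at S
  -- A constant frame with zero second derivatives and constant `p`, `ρ` satisfies the system for
  -- every velocity `v`.
  have key := fun v : Fin 3 → ℝ => hX.second_order hΩo hpos hh hz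
    (g := ![v, ![1, 0, 0], ![0, 1, 0], ![0, 0, z.2.2.2⁻¹]]) (p := 0) (r := 0) (G := 0) (by simp)
      (by simp [cross_apply, dotProduct, Fin.sum_univ_three, hρ]) (fun _ _ => rfl) (fun _ => by simp)
      (by simp [momentum, Jet.totalPressure1]) rfl hH (fun _ => rfl) (fun _ _ => rfl)
  have x0 : ∀ v, (H v (eX 1)).1 0 = 0 ∧ (H v (eX 2)).1 0 = 0 ∧ (H v (eX 3)).1 0 = 0 :=
    fun v => ⟨(S.x1 v).1, (S.x2 v).1, (S.x3 v).1⟩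
  have n1 : (1 : Fin 4) ≠ 0 := by decide
  have n2 : (2 : Fin 4) ≠ 0 := by decide
  have n3 : (3 : Fin 4) ≠ 0 := by decide
  simp only [momentumLin, totalPressureLin, Jet.totalPressure1, mkJet_rho, mkJet_g1,
    mkJet_p1, mkJet_rho1, mkJet_g2] at key
  simp only [Pi.zero_apply, Matrix.cons_val_zero, Matrix.cons_val_one, Matrix.cons_val, C.x1, C.x2,
    C.x3, C.g, E.t, (S.dir_t _ _ _).1, (S.dir_t _ _ _).2, (S.dir_x n1 n1 _ _ _ _ _ _).1,
    (S.dir_x n1 n1 _ _ _ _ _ _).2, (S.dir_x n1 n2 _ _ _ _ _ _).1,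
    (S.dir_x n1 n2 _ _ _ _ _ _).2, (S.dir_x n1 n3 _ _ _ _ _ _).1, (S.dir_x n1 n3 _ _ _ _ _ _).2,
    x0, Prod.fst_add, Prod.smul_fst, Pi.add_apply, smul_zero, zero_smul,
    add_zero, zero_add,
    mul_zero, Pi.single_eq_same,
    Pi.single_eq_of_ne n1, Pi.single_eq_of_ne n2, Pi.single_eq_of_ne n3] at key
  -- Only `ζ_tt` depends on `v`. Subtracting the equation for `v = 0` removes everything else and
  -- leaves `2 η_{tγ} v + η_{γγ}(v, v) = ξ^t_{tt} v`.
  have hΦ : ∀ (v : Fin 3 → ℝ), (2 : ℝ) • (v 0 • (H (eX 0) (eγ 0)).2.1 + v 1 • (H (eX 0) (eγ 1)).2.1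
        + v 2 • (H (eX 0) (eγ 2)).2.1)
      + (v 0 • (v 0 • (H (eγ 0) (eγ 0)).2.1 + v 1 • (H (eγ 0) (eγ 1)).2.1
          + v 2 • (H (eγ 0) (eγ 2)).2.1)
        + v 1 • (v 0 • (H (eγ 1) (eγ 0)).2.1 + v 1 • (H (eγ 1) (eγ 1)).2.1
          + v 2 • (H (eγ 1) (eγ 2)).2.1)
        + v 2 • (v 0 • (H (eγ 2) (eγ 0)).2.1 + v 1 • (H (eγ 2) (eγ 1)).2.1
          + v 2 • (H (eγ 2) (eγ 2)).2.1)) = (H (eX 0) (eX 0)).1 0 • v := by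
    intro v
    have a := key v
    have b := key 0
    rw [← sub_eq_zero, ← sub_eq_zero.2 (a.trans b.symm)]
    simp only [Pi.zero_apply, zero_smul, smul_zero, add_zero]
    abel
  -- Comparing `v = e_k` with `v = -e_k` separates the quadratic from the linear part.
  have hk : ∀ k, (H (eγ k) (eγ k)).2.1 = 0 ∧
      (2 : ℝ) • (H (eX 0) (eγ k)).2.1 = Pi.single k ((H (eX 0) (eX 0)).1 0) := by
    intro k
    constructor
    all_goals
      ext i
      have a := congrFun (hΦ (Pi.single k 1)) i
      have b := congrFun (hΦ (-Pi.single k 1)) i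
      fin_cases k <;> fin_cases i <;> simp at a b ⊢ <;> linarith
  -- The off-diagonal entries follow by polarization, with `v = e_k + e_l` and the symmetry of `H`.
  refine ⟨fun k l => ?_, fun k => (hk k).2⟩
  ext i
  have a := congrFun (hΦ (Pi.single k 1 + Pi.single l 1)) i
  have e0 := congrFun (hΦ (Pi.single k 1)) i
  have e1 := congrFun (hΦ (Pi.single l 1)) i
  have e2 := congrFun (hk k).1 i
  have e3 := congrFun (hk l).1 i
  have e4 := congrArg (fun w : Pt => w.2.1 i) (S.symm (eγ k) (eγ l))
  simp only [Pi.add_apply, Pi.smul_apply, smul_eq_mul] at a e0 e1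
  fin_cases k <;> fin_cases l <;> simp at a e0 e1 e2 e3 e4 ⊢ <;> linarith

end SecondOrder

/-! ### The density coefficient and the momentum equation on orthogonal frames -/

section SecondOrder

variable {Q : Set (Indep × (Fin 3 → ℝ))} {Ω : Set (ℝ × ℝ)} {h : ℝ × ℝ → ℝ} {X : Pt → Pt} {z : Pt}

/-- The Cauchy equation writes the `∂_ρ` coefficient as `ρ` times a difference of traces.
Differentiating this with `η_{γγ} = 0` shows that it does not depend on `γ` or `p` and that it is
homogeneous in `ρ`. The constitutive form then removes `γ` from the `∂_p` coefficient. -/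
lemma Admits.rho_coeff (hQo : IsOpen Q) (hΩo : IsOpen Ω) (hpos : ∀ w ∈ Ω, 0 < w.2)
    (hh : ContDiffOn ℝ ∞ h Ω) (hX : Admits Q Ω h X) (hz : z ∈ dom Q Ω)
    {L : Pt →L[ℝ] Pt} (hL : L = fderiv ℝ X z) {H : Pt →L[ℝ] Pt →L[ℝ] Pt}
    (hH : H = fderiv ℝ (fderiv ℝ X) z) :
    (∀ k, (L (eγ k)).2.2.2 = 0) ∧ (∀ k, (L (eγ k)).2.2.1 = 0) ∧ (L eP).2.2.2 = 0 ∧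
    z.2.2.2 * (L eR).2.2.2 = (X z).2.2.2 ∧
    (L (eX 1)).2.2.2
      = z.2.2.2 * ((H (eX 1) (eX 1)).1 1 + (H (eX 1) (eX 2)).1 2 + (H (eX 1) (eX 3)).1 3) ∧
    (L (eX 2)).2.2.2
      = z.2.2.2 * ((H (eX 2) (eX 1)).1 1 + (H (eX 2) (eX 2)).1 2 + (H (eX 2) (eX 3)).1 3) ∧
    (L (eX 3)).2.2.2
      = z.2.2.2 * ((H (eX 3) (eX 1)).1 1 + (H (eX 3) (eX 2)).1 2 + (H (eX 3) (eX 3)).1 3) := by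
  have C := hX.cauchyForm hΩo hpos hh hz
  have E := hX.constitutiveForm hΩo hpos hh hz
  have S := hX.secondForm hQo hΩo hpos hh hz
  have V := (hX.velocity_form hQo hΩo hpos hh hz hH).1
  have R := hX.rho_form hQo hΩo hpos hh hz hL hH
  rw [← hH] at S
  rw [← hL] at C E
  have hγ : ∀ k w, (H (eγ k) w).1 = 0 := fun k w => by rw [S.symm]; exact S.g w k
  have hp : ∀ w, (H eP w).1 = 0 ∧ (H eP w).2.1 = 0 := fun w => by rw [S.symm]; exact S.p w
  have hr : ∀ w, (H eR w).1 = 0 ∧ (H eR w).2.1 = 0 := fun w => by rw [S.symm]; exact S.r w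
  have hx1 : ∀ w, (H (eX 1) w).2.1 = 0 := fun w => by rw [S.symm]; exact (S.x1 w).2
  have hx2 : ∀ w, (H (eX 2) w).2.1 = 0 := fun w => by rw [S.symm]; exact (S.x2 w).2
  have hx3 : ∀ w, (H (eX 3) w).2.1 = 0 := fun w => by rw [S.symm]; exact (S.x3 w).2
  have hγρ : ∀ k, (L (eγ k)).2.2.2 = 0 := fun k => by
    rw [R, show (eγ k).2.2.2 = 0 from rfl]
    simp [hγ, V]
  refine ⟨hγρ, fun k => by rw [E.g_eq, hγρ, mul_zero], ?_, ?_, ?_, ?_, ?_⟩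
  · rw [R, show eP.2.2.2 = 0 from rfl]
    simp [hp]
  · rw [R, show eR.2.2.2 = 1 from rfl, C.y_eq]
    simp [hr]
  · rw [R, show (eX 1).2.2.2 = 0 from rfl]
    simp [hx1]
  · rw [R, show (eX 2).2.2.2 = 0 from rfl]
    simp [hx2]
  · rw [R, show (eX 3).2.2.2 = 0 from rfl]
    simp [hx3]

/-- The momentum determining equation on the orthogonal frames `γ_{ξ^i} = s_i e_i`, for fluid at
rest. -/
theorem Admits.momentum_frame (hQo : IsOpen Q) (hΩo : IsOpen Ω) (hpos : ∀ w ∈ Ω, 0 < w.2)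
    (hh : ContDiffOn ℝ ∞ h Ω) (hX : Admits Q Ω h X) (hz : z ∈ dom Q Ω)
    {L : Pt →L[ℝ] Pt} (hL : L = fderiv ℝ X z) {H : Pt →L[ℝ] Pt →L[ℝ] Pt}
    (hH : H = fderiv ℝ (fderiv ℝ X) z) {s₁ s₂ s₃ : ℝ} (hs : z.2.2.2 * (s₁ * s₂ * s₃) = 1)
    (p₁ p₂ p₃ r x y : ℝ) :
    ((H (eX 0) (eX 0)).2.1 0 - p₁ * (s₂ * s₃) * (L (eγ 0)).2.1 0
        + (z.2.2.2 * x - (p₂ + z.2.2.2 * r * s₁ ^ 2) * (s₁ * s₃)) * (L (eγ 1)).2.1 0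
        - p₃ * (s₁ * s₂) * (L (eγ 2)).2.1 0 + 2 * ((L (eX 0)).1 0 * (p₁ * (s₂ * s₃)))
        - (((L (eX 1)).2.2.2 - (L (eX 1)).1 2 * r) * s₁
          + z.2.2.2 * (x * (L (eγ 1)).2.1 0 - (H (eX 1) (eX 1)).1 1 * s₁))
        + ((L (eX 1)).2.2.1 + p₁ * (L eP).2.2.1
          - ((L (eX 1)).1 1 * p₁ + (L (eX 1)).1 2 * p₂ + (L (eX 1)).1 3 * p₃)
          + z.2.2.2 * ((L (eX 1)).2.2.2 - (L (eX 1)).1 2 * r) * (s₁ * s₁)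
          + z.2.2.2 ^ 2 * ((s₁ * (L (eγ 0)).2.1 1 - (L (eX 1)).1 2 * s₂) * x
            + s₁ * (x * (L (eγ 1)).2.1 0 - (H (eX 1) (eX 1)).1 1 * s₁))) * (s₂ * s₃)
        + p₁ * ((L (eγ 1)).2.1 1 - (L (eX 2)).1 2 + ((L (eγ 2)).2.1 2 - (L (eX 3)).1 3)) * (s₂ * s₃)
        - (p₂ + z.2.2.2 * r * (s₁ * s₁)) * (s₃ * (s₁ * (L (eγ 0)).2.1 1 - (L (eX 1)).1 2 * s₂))
        - p₃ * ((s₁ * (L (eγ 0)).2.1 2 - (L (eX 1)).1 3 * s₃) * s₂) = 0) ∧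
    ((H (eX 0) (eX 0)).2.1 1 - p₁ * (s₂ * s₃) * (L (eγ 0)).2.1 1
        + (z.2.2.2 * x - (p₂ + z.2.2.2 * r * s₁ ^ 2) * (s₁ * s₃)) * (L (eγ 1)).2.1 1
        - p₃ * (s₁ * s₂) * (L (eγ 2)).2.1 1
        - 2 * ((L (eX 0)).1 0 * (z.2.2.2 * x - (p₂ + z.2.2.2 * r * s₁ ^ 2) * (s₁ * s₃)))
        - ((X z).2.2.2 * x + z.2.2.2 * (x * (L (eγ 1)).2.1 1 - 2 * ((L (eX 1)).1 1 * x)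
          - (H (eX 1) (eX 1)).1 2 * s₂))
        - p₁ * ((s₂ * (L (eγ 1)).2.1 0 - (L (eX 2)).1 1 * s₁) * s₃)
        + ((L (eX 2)).2.2.1 + p₂ * (L eP).2.2.1 + r * (L eR).2.2.1
          - ((L (eX 2)).1 1 * p₁ + (L (eX 2)).1 2 * p₂ + (L (eX 2)).1 3 * p₃)
          + ((X z).2.2.2 * r + z.2.2.2 * ((L (eX 2)).2.2.2 + r * (L eR).2.2.2
            - (L (eX 2)).1 2 * r)) * (s₁ * s₁)
          + 2 * (z.2.2.2 * r * ((L (eγ 0)).2.1 0 - (L (eX 1)).1 1)) * (s₁ * s₁)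
          + z.2.2.2 ^ 2 * ((s₁ * (L (eγ 0)).2.1 2 - (L (eX 1)).1 3 * s₃) * y
            + s₁ * (y * (L (eγ 2)).2.1 0 - (H (eX 1) (eX 2)).1 1 * s₁))) * (s₃ * s₁)
        + (p₂ + z.2.2.2 * r * (s₁ * s₁)) * ((L (eγ 2)).2.1 2 - (L (eX 3)).1 3
          + ((L (eγ 0)).2.1 0 - (L (eX 1)).1 1)) * (s₃ * s₁)
        - p₃ * (s₁ * (s₂ * (L (eγ 1)).2.1 2 - (L (eX 2)).1 3 * s₃)) = 0) ∧
    ((H (eX 0) (eX 0)).2.1 2 - p₁ * (s₂ * s₃) * (L (eγ 0)).2.1 2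
        + (z.2.2.2 * x - (p₂ + z.2.2.2 * r * s₁ ^ 2) * (s₁ * s₃)) * (L (eγ 1)).2.1 2
        - p₃ * (s₁ * s₂) * (L (eγ 2)).2.1 2 + 2 * ((L (eX 0)).1 0 * (p₃ * (s₁ * s₂)))
        - z.2.2.2 * (x * (L (eγ 1)).2.1 2 - 2 * ((L (eX 1)).1 2 * y) - (H (eX 1) (eX 1)).1 3 * s₃)
        - p₁ * (s₂ * (s₃ * (L (eγ 2)).2.1 0 - (L (eX 3)).1 1 * s₁))
        - (p₂ + z.2.2.2 * r * (s₁ * s₁)) * ((s₃ * (L (eγ 2)).2.1 1 - (L (eX 3)).1 2 * s₂) * s₁)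
        + ((L (eX 3)).2.2.1 + p₃ * (L eP).2.2.1
          - ((L (eX 3)).1 1 * p₁ + (L (eX 3)).1 2 * p₂ + (L (eX 3)).1 3 * p₃)
          + z.2.2.2 * ((L (eX 3)).2.2.2 - (L (eX 3)).1 2 * r) * (s₁ * s₁)
          - z.2.2.2 ^ 2 * (s₁ * ((H (eX 1) (eX 3)).1 1 * s₁))) * (s₁ * s₂)
        + p₃ * ((L (eγ 0)).2.1 0 - (L (eX 1)).1 1
          + ((L (eγ 1)).2.1 1 - (L (eX 2)).1 2)) * (s₁ * s₂) = 0) := by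
  have hρ : z.2.2.2 ≠ 0 := (hpos _ hz.2).ne'
  have C := hX.cauchyForm hΩo hpos hh hz
  have E := hX.constitutiveForm hΩo hpos hh hz
  have S := hX.secondForm hQo hΩo hpos hh hz
  have V := hX.velocity_form hQo hΩo hpos hh hz hH
  rw [← hH] at S
  rw [← hL] at C E
  have hr : z.2.2.2 * (r / z.2.2.2) = r := by field_simp
  -- Only `ρ_{ξ²} = r` is nonzero among the derivatives of `ρ`, and `γ_{ξ²ξ²}` compensates it in the
  -- Cauchy equation. The free entries `γ_{ξ¹ξ¹} = x e₂` and `γ_{ξ¹ξ²} = y e₃` are orthogonal to the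
  -- cofactors concerned, hence harmless there, and also to `γ_{ξ¹}`, so they do not enter `P_α`.
  -- The entry `γ_tt` solves the momentum equation.
  have key := hX.second_order hΩo hpos hh hz
    (g := ![0, ![s₁, 0, 0], ![0, s₂, 0], ![0, 0, s₃]]) (p := ![0, p₁, p₂, p₃]) (r := ![0, 0, r, 0])
    (G := ![![![-(p₁ * (s₂ * s₃)), z.2.2.2 * x - (p₂ + z.2.2.2 * r * s₁ ^ 2) * (s₁ * s₃),
      -(p₃ * (s₁ * s₂))], 0, 0, 0],
      ![0, ![0, x, 0], ![0, 0, y], 0], ![0, ![0, 0, y], ![0, -(r / z.2.2.2) * s₂, 0], 0], 0])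
    (by simp) (by simp [cross_apply, dotProduct, Fin.sum_univ_three]; linear_combination hs)
    (fun α β => by fin_cases α <;> fin_cases β <;> simp) (fun α => by
      fin_cases α <;> simp [cross_apply, dotProduct, Fin.sum_univ_three]
      linear_combination - s₁ * s₂ * s₃ * hr) (by
      ext k
      fin_cases k <;> simp [momentum, Jet.totalPressure1, cross_apply, dotProduct, Fin.sum_univ_three]
      all_goals ring) hL hH (fun _ => rfl) (fun _ _ => rfl)
  have n1 : (1 : Fin 4) ≠ 0 := by decide
  have n2 : (2 : Fin 4) ≠ 0 := by decide
  have n3 : (3 : Fin 4) ≠ 0 := by decide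
  simp only [momentumLin, totalPressureLin, Jet.totalPressure1, mkJet_rho, mkJet_g1,
    mkJet_p1, mkJet_rho1, mkJet_g2] at key
  have k0 := congrFun key 0
  have k1 := congrFun key 1
  have k2 := congrFun key 2
  have x0 : ∀ v, (H v (eX 1)).1 0 = 0 ∧ (H v (eX 2)).1 0 = 0 ∧ (H v (eX 3)).1 0 = 0 :=
    fun v => ⟨(S.x1 v).1, (S.x2 v).1, (S.x3 v).1⟩
  obtain ⟨hγρ, hγp, hPρ, hRρ, hX₁, hX₂, hX₃⟩ := hX.rho_coeff hQo hΩo hpos hh hz hL hH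
  simp [dotProduct, cross_apply, Fin.sum_univ_three, C.x1, C.x2,
    C.x3, C.g, C.p, C.r, E.t, (S.dir_x n1 n1 _ _ _ _ _ _).1,
    (S.dir_x n1 n1 _ _ _ _ _ _).2, (S.dir_x n1 n2 _ _ _ _ _ _).1,
    (S.dir_x n1 n2 _ _ _ _ _ _).2, (S.dir_x n1 n3 _ _ _ _ _ _).1, (S.dir_x n1 n3 _ _ _ _ _ _).2,
    (S.dir_t _ _ _).1, (S.dir_t _ _ _).2, x0, V.1, hγρ, hγp, hPρ] at k0 k1 k2
  clear key
  simp only [Matrix.vecHead, Matrix.vecTail, Pi.smul_apply, smul_eq_mul, Function.comp_apply,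
    Fin.succ_zero_eq_one, Fin.succ_one_eq_two] at k0 k1 k2
  exact ⟨by linear_combination k0, by linear_combination k1, by linear_combination k2⟩


end SecondOrder

/-! ### Separating the momentum equation -/

section SecondOrder

variable {Q : Set (Indep × (Fin 3 → ℝ))} {Ω : Set (ℝ × ℝ)} {h : ℝ × ℝ → ℝ} {X : Pt → Pt} {z : Pt}

/-- The algebraic consequences of the momentum determining equation on orthogonal frames. -/
lemma eq_of_momentum_frame {b00 b01 b02 b10 b11 b12 b20 b21 b22 k00 k11 k12 k13 k21 k22 k23 k31 k32
    k33 a1 a2 a3 c1 c2 c3 P R σ n0 n1 n2 m11 m12 m13 m21 m31 ρ y : ℝ} (hρ : ρ ≠ 0)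
    (hy : y = ρ * (k11 + k22 + k33 - (b00 + b11 + b22))) (hσ : ρ * σ = y)
    (M : ∀ {s₁ s₂ s₃ : ℝ}, ρ * (s₁ * s₂ * s₃) = 1 → ∀ p₁ p₂ p₃ r x y' : ℝ,
    (n0 - p₁ * (s₂ * s₃) * b00
        + (ρ * x - (p₂ + ρ * r * s₁ ^ 2) * (s₁ * s₃)) * b10
        - p₃ * (s₁ * s₂) * b20 + 2 * (k00 * (p₁ * (s₂ * s₃)))
        - ((c1 - k12 * r) * s₁
          + ρ * (x * b10 - m11 * s₁))
        + (a1 + p₁ * P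
          - (k11 * p₁ + k12 * p₂ + k13 * p₃)
          + ρ * (c1 - k12 * r) * (s₁ * s₁)
          + ρ ^ 2 * ((s₁ * b01 - k12 * s₂) * x
            + s₁ * (x * b10 - m11 * s₁))) * (s₂ * s₃)
        + p₁ * (b11 - k22 + (b22 - k33)) * (s₂ * s₃)
        - (p₂ + ρ * r * (s₁ * s₁)) * (s₃ * (s₁ * b01 - k12 * s₂))
        - p₃ * ((s₁ * b02 - k13 * s₃) * s₂) = 0) ∧
    (n1 - p₁ * (s₂ * s₃) * b01
        + (ρ * x - (p₂ + ρ * r * s₁ ^ 2) * (s₁ * s₃)) * b11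
        - p₃ * (s₁ * s₂) * b21
        - 2 * (k00 * (ρ * x - (p₂ + ρ * r * s₁ ^ 2) * (s₁ * s₃)))
        - (y * x + ρ * (x * b11 - 2 * (k11 * x)
          - m12 * s₂))
        - p₁ * ((s₂ * b10 - k21 * s₁) * s₃)
        + (a2 + p₂ * P + r * R
          - (k21 * p₁ + k22 * p₂ + k23 * p₃)
          + (y * r + ρ * (c2 + r * σ
            - k22 * r)) * (s₁ * s₁)
          + 2 * (ρ * r * (b00 - k11)) * (s₁ * s₁)
          + ρ ^ 2 * ((s₁ * b02 - k13 * s₃) * y'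
            + s₁ * (y' * b20 - m21 * s₁))) * (s₃ * s₁)
        + (p₂ + ρ * r * (s₁ * s₁)) * (b22 - k33
          + (b00 - k11)) * (s₃ * s₁)
        - p₃ * (s₁ * (s₂ * b12 - k23 * s₃)) = 0) ∧
    (n2 - p₁ * (s₂ * s₃) * b02
        + (ρ * x - (p₂ + ρ * r * s₁ ^ 2) * (s₁ * s₃)) * b12
        - p₃ * (s₁ * s₂) * b22 + 2 * (k00 * (p₃ * (s₁ * s₂)))
        - ρ * (x * b12 - 2 * (k12 * y') - m13 * s₃)
        - p₁ * (s₂ * (s₃ * b20 - k31 * s₁))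
        - (p₂ + ρ * r * (s₁ * s₁)) * ((s₃ * b21 - k32 * s₂) * s₁)
        + (a3 + p₃ * P
          - (k31 * p₁ + k32 * p₂ + k33 * p₃)
          + ρ * (c3 - k32 * r) * (s₁ * s₁)
          - ρ ^ 2 * (s₁ * (m31 * s₁))) * (s₁ * s₂)
        + p₃ * (b00 - k11
          + (b11 - k22)) * (s₁ * s₂) = 0)) :
    (b01 + b10 = 0 ∧ b02 + b20 = 0 ∧ b12 + b21 = 0) ∧ (b11 = b00 ∧ b22 = b00) ∧
    P = k11 + k22 + k33 - 2 * k00 - b00 ∧ (k12 = 0 ∧ k13 = 0) ∧ y = ρ * (2 * k11 - 2 * k00) ∧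
    (n0 = 0 ∧ n1 = 0 ∧ n2 = 0) ∧ (a1 = 0 ∧ a2 = 0 ∧ a3 = 0) ∧ R = 0 ∧ c2 = ρ * m21 ∧ c3 = ρ * m31 := by
  -- In the application `b` is the `γ`-block and `k` the `x`-block of the derivative. The numbers
  -- `a_i`, `c_i` are the `ξ^i`-derivatives of the `∂_p` and `∂_ρ` coefficients. `P` and `R` are the
  -- `p`- and `ρ`-derivatives of the `∂_p` coefficient, and `σ` is the `ρ`-derivative of the `∂_ρ`
  -- coefficient. The `n` are components of `η_{tt}`, and the `m` are second derivatives of the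
  -- `ξ`-coefficients.
  obtain ⟨i, hi⟩ : ∃ i, ρ * i = 1 := ⟨ρ⁻¹, mul_inv_cancel₀ hρ⟩
  have hi0 : i ≠ 0 := right_ne_zero_of_mul_eq_one hi
  have hs : ρ * (1 * 1 * i) = 1 := by linear_combination hi
  -- The equations are affine in `p₁, p₂, p₃, r, x, y'`. The base evaluation and one evaluation per
  -- variable, on the frame `(1, 1, 1/ρ)`, give all their coefficients there.
  obtain ⟨z0, z1, z2⟩ := M hs 0 0 0 0 0 0
  obtain ⟨p10, p11, p12⟩ := M hs 1 0 0 0 0 0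
  obtain ⟨p20, p21, p22⟩ := M hs 0 1 0 0 0 0
  obtain ⟨p30, p31, p32⟩ := M hs 0 0 1 0 0 0
  obtain ⟨r0, r1, r2⟩ := M hs 0 0 0 1 0 0
  obtain ⟨x0, x1, x2⟩ := M hs 0 0 0 0 1 0
  obtain ⟨y0, y1, y2⟩ := M hs 0 0 0 0 0 1
  have sk01 : b01 + b10 = 0 :=
    mul_left_cancel₀ hi0 (by linear_combination z1 - p11)
  have sk02 : b02 + b20 = 0 :=
    mul_left_cancel₀ hi0 (by linear_combination z2 - p12)
  have sk12 : b12 + b21 = 0 :=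
    mul_left_cancel₀ hi0 (by linear_combination z2 - p22)
  have d0 : P + b11 + b22 - b00
      - (k11 + k22 + k33) + 2 * k00 = 0 :=
    mul_left_cancel₀ hi0 (by linear_combination p10 - z0)
  have d1 : P + b00 + b22 - b11
      - (k11 + k22 + k33) + 2 * k00 = 0 :=
    mul_left_cancel₀ hi0 (by linear_combination p21 - z1)
  have d2 : P + b00 + b11 - b22
      - (k11 + k22 + k33) + 2 * k00 = 0 := by
    linear_combination p32 - z2
  have hd1 : b11 = b00 := by linarith
  have hd2 : b22 = b00 := by linarith
  have hk12 : k12 = 0 := mul_left_cancel₀ hρ (by linear_combination (y2 - z2) / 2)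
  have hk13 : k13 = 0 := by
    linear_combination z1 - y1 + ρ ^ 2 * i * sk02 - k13 * (ρ * i + 1) * hi
  -- The coefficient of `x = γ_{ξ¹ξ¹}` compares the scaling of `γ_tt` with that of the tension `ρ
  -- γ_{ξ¹ξ¹}`.
  have hden : y = ρ * (2 * k11 - 2 * k00) := by
    linear_combination z1 - x1
  have hR1 : R = 0 := by
    refine mul_left_cancel₀ hi0 ?_
    linear_combination r1 - z1 - i * hσ - i * hy - i * hden + 2 * ρ * i * hd1
  -- With all free derivatives zero, the remaining constant terms differ in sign behaviour and in
  -- degree in the `s_i`. Reversing two signs isolates `n`, and doubling one length while halving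
  -- another separates `a_i` from `c_i - ρ m`.
  have e0 := (M (s₁ := -1) (s₂ := -1) (s₃ := i) (by linear_combination hi) 0 0 0 0 0 0).1
  have e1 := (M (s₁ := 1) (s₂ := -1) (s₃ := -i) (by linear_combination hi) 0 0 0 0 0 0).2.1
  have e2 := (M (s₁ := 2) (s₂ := 1) (s₃ := i / 2) (by linear_combination hi) 0 0 0 0 0 0).2.1
  have e3 := (M (s₁ := 1) (s₂ := 2) (s₃ := i / 2) (by linear_combination hi) 0 0 0 0 0 0).2.1
  have f0 := (M (s₁ := 1) (s₂ := i) (s₃ := 1) (by linear_combination hi) 0 0 0 0 0 0).2.2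
  have f1 := (M (s₁ := 1) (s₂ := -i) (s₃ := -1) (by linear_combination hi) 0 0 0 0 0 0).2.2
  have f2 := (M (s₁ := 2) (s₂ := i / 2) (s₃ := 1) (by linear_combination hi) 0 0 0 0 0 0).2.2
  have f3 := (M (s₁ := 1) (s₂ := i / 2) (s₃ := 2) (by linear_combination hi) 0 0 0 0 0 0).2.2
  clear M
  have hn0 : n0 = 0 := by
    linear_combination (z0 + e0) / 2
  have hn1 : n1 = 0 := by
    linear_combination (z1 + e1) / 2
  have hn2 : n2 = 0 := by
    linear_combination (f0 + f1) / 2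
  have hc2 : c2 = ρ * m21 := by
    linear_combination (e2 - z1) / 3 - (c2 - ρ * m21) * hi
  have hc3 : c3 = ρ * m31 := by
    linear_combination (f2 - f0) / 3 - (c3 - ρ * m31) * hi
  have ha1 : a1 = 0 := mul_left_cancel₀ hi0 (by
    linear_combination (z0 - e0) / 2 - (c1 - ρ * m11) * hi)
  have ha2 : a2 = 0 := mul_left_cancel₀ hi0 (by
    linear_combination (4 * z1 - 2 * e3) / 3 - 2 / 3 * hn1 - ρ * i * hc2)
  have ha3 : a3 = 0 := mul_left_cancel₀ hi0 (by
    linear_combination (4 * f0 - 2 * f3) / 3 - 2 / 3 * hn2 - ρ * i * hc3)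
  exact ⟨⟨sk01, sk02, sk12⟩, ⟨hd1, hd2⟩, by linarith, ⟨hk12, hk13⟩, hden, ⟨hn0, hn1, hn2⟩,
    ⟨ha1, ha2, ha3⟩, hR1, hc2, hc3⟩

/-- The form of the first and second derivatives of an operator `y` at a point with density `ρ`
that follows from the momentum equation. -/
structure MomentumForm (L : Pt →L[ℝ] Pt) (H : Pt →L[ℝ] Pt →L[ℝ] Pt) (ρ y : ℝ) : Prop where
  skew : (L (eγ 0)).2.1 1 + (L (eγ 1)).2.1 0 = 0 ∧ (L (eγ 0)).2.1 2 + (L (eγ 2)).2.1 0 = 0 ∧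
    (L (eγ 1)).2.1 2 + (L (eγ 2)).2.1 1 = 0
  diag : (L (eγ 1)).2.1 1 = (L (eγ 0)).2.1 0 ∧ (L (eγ 2)).2.1 2 = (L (eγ 0)).2.1 0
  pressure : (L eP).2.2.1 = (L (eX 1)).1 1 + (L (eX 2)).1 2 + (L (eX 3)).1 3
    - 2 * (L (eX 0)).1 0 - (L (eγ 0)).2.1 0
  field : (L (eX 1)).1 2 = 0 ∧ (L (eX 1)).1 3 = 0
  density : y = ρ * (2 * (L (eX 1)).1 1 - 2 * (L (eX 0)).1 0)
  accel : (H (eX 0) (eX 0)).2.1 = 0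
  pressure_x : (L (eX 1)).2.2.1 = 0 ∧ (L (eX 2)).2.2.1 = 0 ∧ (L (eX 3)).2.2.1 = 0
  pressure_r : (L eR).2.2.1 = 0
  density_x : (L (eX 2)).2.2.2 = ρ * (H (eX 1) (eX 2)).1 1 ∧
    (L (eX 3)).2.2.2 = ρ * (H (eX 1) (eX 3)).1 1

theorem Admits.momentumForm (hQo : IsOpen Q) (hΩo : IsOpen Ω) (hpos : ∀ w ∈ Ω, 0 < w.2)
    (hh : ContDiffOn ℝ ∞ h Ω) (hX : Admits Q Ω h X) (hz : z ∈ dom Q Ω)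
    {L : Pt →L[ℝ] Pt} (hL : L = fderiv ℝ X z) {H : Pt →L[ℝ] Pt →L[ℝ] Pt}
    (hH : H = fderiv ℝ (fderiv ℝ X) z) : MomentumForm L H z.2.2.2 (X z).2.2.2 := by
  have hρ : z.2.2.2 ≠ 0 := (hpos _ hz.2).ne'
  have C := hX.cauchyForm hΩo hpos hh hz
  rw [← hL] at C
  obtain ⟨-, -, -, hRρ, -⟩ := hX.rho_coeff hQo hΩo hpos hh hz hL hH
  have M := fun {s₁ s₂ s₃ : ℝ} (hs : z.2.2.2 * (s₁ * s₂ * s₃) = 1) =>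
    hX.momentum_frame hQo hΩo hpos hh hz hL hH hs
  obtain ⟨h1, h2, h3, h4, h5, ⟨n0, n1, n2⟩, h6, h7, h8, h9⟩ :=
    eq_of_momentum_frame hρ C.y_eq hRρ M
  refine ⟨h1, h2, h3, h4, h5, ?_, h6, h7, h8, h9⟩
  ext k
  fin_cases k
  exacts [n0, n1, n2]

end SecondOrder

/-! ### Admitted operators have the extended form -/

section Global

variable {Q : Set (Indep × (Fin 3 → ℝ))} {Ω : Set (ℝ × ℝ)} {h : ℝ × ℝ → ℝ} {X : Pt → Pt} {z : Pt}

lemma dom_eq_image : dom Q Ω =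
    (fun q : (Indep × (Fin 3 → ℝ)) × (ℝ × ℝ) => (q.1.1, q.1.2, q.2)) '' (Q ×ˢ Ω) := by
  ext z
  constructor
  · intro hz
    exact ⟨((z.1, z.2.1), z.2.2), ⟨hz.1, hz.2⟩, rfl⟩
  · rintro ⟨q, hq, rfl⟩
    exact ⟨hq.1, hq.2⟩

lemma isPreconnected_dom (hQ : Convex ℝ Q) (hΩ : IsPreconnected Ω) : IsPreconnected (dom Q Ω) := by
  rw [dom_eq_image]
  exact (hQ.isPreconnected.prod hΩ).image _ (by fun_prop)

lemma dom_nonempty (hQ : Q.Nonempty) (hΩ : Ω.Nonempty) : (dom Q Ω).Nonempty := by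
  rw [dom_eq_image]
  exact (hQ.prod hΩ).image _

lemma fderiv_const_of_fderiv_fderiv {D : Set Pt} (hD : IsOpen D) (hD' : IsPreconnected D)
    (hX : ContDiffOn ℝ ∞ X D) {F : Type*} [NormedAddCommGroup F] [NormedSpace ℝ F]
    (φ : Pt →L[ℝ] F) (e : Pt) (h0 : ∀ z ∈ D, ∀ v, φ (fderiv ℝ (fderiv ℝ X) z v e) = 0) {z z' : Pt}
    (hz : z ∈ D) (hz' : z' ∈ D) : φ (fderiv ℝ X z e) = φ (fderiv ℝ X z' e) := by
  have hd : ∀ z ∈ D, HasFDerivAt (fun z => φ (fderiv ℝ X z e))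
      (φ.comp ((fderiv ℝ (fderiv ℝ X) z).flip e)) z := by
    intro z hz
    have h2 : HasFDerivAt (fun z => fderiv ℝ X z e) ((fderiv ℝ (fderiv ℝ X) z).flip e) z := by
      simpa using
        (differentiableAt_fderiv hX hD hz).hasFDerivAt.clm_apply (hasFDerivAt_const e z)
    exact φ.hasFDerivAt.comp z h2
  refine hD.is_const_of_fderiv_eq_zero (𝕜 := ℝ) (f := fun z => φ (fderiv ℝ X z e)) hD'
    (fun z hz => (hd z hz).differentiableAt.differentiableWithinAt) (fun z hz => ?_) hz hz'
  rw [(hd z hz).fderiv]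
  exact ContinuousLinearMap.ext (h0 z hz)

lemma clm_apply_eq_zero {F : Type*} [NormedAddCommGroup F] [NormedSpace ℝ F] {L : Pt →L[ℝ] F}
    (h0 : L (eX 0) = 0) (h1 : L (eX 1) = 0) (h2 : L (eX 2) = 0) (h3 : L (eX 3) = 0)
    (hg : ∀ k, L (eγ k) = 0) (hp : L eP = 0) (hr : L eR = 0) (v : Pt) : L v = 0 := by
  rw [clm_apply_pt, h0, h1, h2, h3, hg, hg, hg, hp, hr]
  simp

/-- The second derivatives of an admitted operator that vanish. -/
structure FlatForm (H : Pt →L[ℝ] Pt →L[ℝ] Pt) : Prop where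
  t : ∀ v, (H v (eX 0)).1 0 = 0
  x : ∀ v, (H v (eX 1)).1 1 = 0
  g : ∀ v k, (H v (eγ k)).2.1 = 0
  v : ∀ v, (H v (eX 0)).2.1 = 0
  div : ∀ v, (H v (eX 1)).1 1 + (H v (eX 2)).1 2 + (H v (eX 3)).1 3 = 0

/-- The Cauchy and momentum equations give two expressions for the `∂_ρ` coefficient. Cancelling `ρ
> 0` and differentiating gives a linear relation `trace` between second derivatives, which clashes
with the other relations unless these derivatives vanish. -/
theorem Admits.flatForm (hQo : IsOpen Q) (hΩo : IsOpen Ω) (hpos : ∀ w ∈ Ω, 0 < w.2)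
    (hh : ContDiffOn ℝ ∞ h Ω) (hX : Admits Q Ω h X) (hz : z ∈ dom Q Ω)
    {H : Pt →L[ℝ] Pt →L[ℝ] Pt} (hH : H = fderiv ℝ (fderiv ℝ X) z) : FlatForm H := by
  have hρ : z.2.2.2 ≠ 0 := (hpos _ hz.2).ne'
  have hD := isOpen_dom hQo hΩo
  have S := hX.secondForm hQo hΩo hpos hh hz
  have V := hX.velocity_form hQo hΩo hpos hh hz hH
  have M := hX.momentumForm hQo hΩo hpos hh hz rfl hH
  obtain ⟨-, -, -, -, -, hX₂, hX₃⟩ := hX.rho_coeff hQo hΩo hpos hh hz rfl hH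
  rw [← hH] at S
  have hγ : ∀ k w, (H (eγ k) w).1 = 0 := fun k w => by rw [S.symm]; exact S.g w k
  have hp : ∀ w, (H eP w).1 = 0 ∧ (H eP w).2.1 = 0 := fun w => by rw [S.symm]; exact S.p w
  have hr : ∀ w, (H eR w).1 = 0 ∧ (H eR w).2.1 = 0 := fun w => by rw [S.symm]; exact S.r w
  have hx1 : ∀ w, (H (eX 1) w).1 0 = 0 ∧ (H (eX 1) w).2.1 = 0 := fun w => by
    rw [S.symm]; exact S.x1 w
  have hx2 : ∀ w, (H (eX 2) w).1 0 = 0 ∧ (H (eX 2) w).2.1 = 0 := fun w => by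
    rw [S.symm]; exact S.x2 w
  have hx3 : ∀ w, (H (eX 3) w).1 0 = 0 ∧ (H (eX 3) w).2.1 = 0 := fun w => by
    rw [S.symm]; exact S.x3 w
  have ht : ∀ w, (H (eX 0) w).1 1 = 0 ∧ (H (eX 0) w).1 2 = 0 ∧ (H (eX 0) w).1 3 = 0 :=
    fun w => by rw [S.symm]; exact S.t w
  have hk12 : ∀ v, (H v (eX 1)).1 2 = 0 := fun v => by
    have := map_fderiv_fderiv_eq_zero hX.1 hD hz (eX 1) (pXi 2)
      (fun z hz => (hX.momentumForm hQo hΩo hpos hh hz rfl rfl).field.1) v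
    rwa [← hH] at this
  have hk13 : ∀ v, (H v (eX 1)).1 3 = 0 := fun v => by
    have := map_fderiv_fderiv_eq_zero hX.1 hD hz (eX 1) (pXi 3)
      (fun z hz => (hX.momentumForm hQo hΩo hpos hh hz rfl rfl).field.2) v
    rwa [← hH] at this
  have trace : ∀ v, (H v (eX 1)).1 1 + (H v (eX 2)).1 2 + (H v (eX 3)).1 3
      - ((H v (eγ 0)).2.1 0 + (H v (eγ 1)).2.1 1 + (H v (eγ 2)).2.1 2)
      = 2 * (H v (eX 1)).1 1 - 2 * (H v (eX 0)).1 0 := by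
    intro v
    have hd : ∀ (φ : Pt →L[ℝ] ℝ) (e : Pt), HasFDerivAt (fun z => φ (fderiv ℝ X z e))
        (φ.comp (H.flip e)) z := by
      intro φ e
      have h2 : HasFDerivAt (fun z => fderiv ℝ X z e) (H.flip e) z := by
        simpa [hH] using
          (differentiableAt_fderiv hX.1 hD hz).hasFDerivAt.clm_apply (hasFDerivAt_const e z)
      exact φ.hasFDerivAt.comp z h2
    have h1 := (((hd (pXi 1) (eX 1)).add (hd (pXi 2) (eX 2))).add (hd (pXi 3) (eX 3))).sub
      (((hd (pGk 0) (eγ 0)).add (hd (pGk 1) (eγ 1))).add (hd (pGk 2) (eγ 2)))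
    have h2 := ((hd (pXi 1) (eX 1)).const_mul 2).sub ((hd (pXi 0) (eX 0)).const_mul 2)
    have h3 := congrArg (fun M => M v) (h1.unique (h2.congr_of_eventuallyEq ?_))
    · exact h3
    · filter_upwards [hD.mem_nhds hz] with y hy
      refine mul_left_cancel₀ (hpos _ hy.2).ne' ?_
      exact ((hX.cauchyForm hΩo hpos hh hy).y_eq.symm.trans
        (hX.momentumForm hQo hΩo hpos hh hy rfl rfl).density)
  -- In the direction `t`, `velocity_form` makes the trace of `η_{tγ}` equal to `3/2` of `ξ^t_{tt}`,
  -- whereas `trace` requires it to be twice that.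
  have t0 : (H (eX 0) (eX 0)).1 0 = 0 := by
    have e := trace (eX 0)
    have v0 := congrFun (V.2 0) 0
    have v1 := congrFun (V.2 1) 1
    have v2 := congrFun (V.2 2) 2
    simp [ht] at e v0 v1 v2
    linarith
  have hv : ∀ k, (H (eX 0) (eγ k)).2.1 = 0 := fun k => by
    have := V.2 k
    rw [t0] at this
    simpa using this
  -- Here the divergence reduces to its `ξ¹` term, since the `ξ²` and `ξ³` coefficients do not
  -- depend on `ξ¹`. The relation then reads `u = 2u`.
  have x1 : (H (eX 1) (eX 1)).1 1 = 0 := by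
    have e := trace (eX 1)
    simp [hx1, S.symm (eX 1) (eX 2), S.symm (eX 1) (eX 3), hk12, hk13] at e
    linarith
  -- The momentum equation identifies the `ξ²`-derivative of the divergence with that of `ξ¹_{ξ¹}`,
  -- whereas `trace` makes it twice as large. The direction `ξ³` is treated alike.
  have x2 : (H (eX 2) (eX 1)).1 1 = 0 := by
    have e := trace (eX 2)
    have e2 := mul_left_cancel₀ hρ (hX₂.symm.trans M.density_x.1)
    rw [S.symm (eX 1) (eX 2)] at e2
    simp [hx2] at e
    linarith
  have x3 : (H (eX 3) (eX 1)).1 1 = 0 := by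
    have e := trace (eX 3)
    have e2 := mul_left_cancel₀ hρ (hX₃.symm.trans M.density_x.2)
    rw [S.symm (eX 1) (eX 3)] at e2
    simp [hx3] at e
    linarith
  have T : ∀ v, (H v (eX 0)).1 0 = 0 :=
    clm_apply_eq_zero (L := (pXi 0).comp (H.flip (eX 0))) t0 (hx1 _).1 (hx2 _).1 (hx3 _).1
      (fun k => congrFun (hγ k _) 0) (congrFun (hp _).1 0) (congrFun (hr _).1 0)
  have A : ∀ v, (H v (eX 1)).1 1 = 0 :=
    clm_apply_eq_zero (L := (pXi 1).comp (H.flip (eX 1))) (ht _).1 x1 x2 x3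
      (fun k => congrFun (hγ k _) 1) (congrFun (hp _).1 1) (congrFun (hr _).1 1)
  have G : ∀ v k, (H v (eγ k)).2.1 = 0 := fun v k =>
    clm_apply_eq_zero (L := pG.comp (H.flip (eγ k))) (hv k) (hx1 _).2 (hx2 _).2 (hx3 _).2
      (fun l => V.1 l k) (hp _).2 (hr _).2 v
  refine ⟨T, A, G, ?_, fun v => ?_⟩
  · exact clm_apply_eq_zero (L := pG.comp (H.flip (eX 0))) M.accel (hx1 _).2 (hx2 _).2 (hx3 _).2
      (fun l => by have := hv l; rwa [S.symm] at this) (hp _).2 (hr _).2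
  · have := trace v
    simpa [G, A, T] using this

end Global

/-! ### From pointwise relations to constant weights -/

section Global

variable {Q : Set (Indep × (Fin 3 → ℝ))} {Ω : Set (ℝ × ℝ)} {h : ℝ × ℝ → ℝ} {X : Pt → Pt}

/-- `flatForm` and connectedness make `T`, `A`, `g` and the `γ`-block constant, so they may be read
off at one point `z₀`. The trace of the `(ξ², ξ³)` block is then constant as well, although its
entries may vary. -/
theorem Admits.hasSymmetryForm (hQo : IsOpen Q) (hQc : Convex ℝ Q) (hQn : Q.Nonempty)
    (hΩo : IsOpen Ω) (hΩc : IsConnected Ω) (hpos : ∀ w ∈ Ω, 0 < w.2)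
    (hh : ContDiffOn ℝ ∞ h Ω) (hX : Admits Q Ω h X) :
    ∃ T A l w g c, HasSymmetryForm (dom Q Ω) X T A l w g c ∧
      ClassEq Ω h (l - T) ((A + 5 * l - 6 * T) / 2) c := by
  have hD := isOpen_dom hQo hΩo
  have hD' := isPreconnected_dom hQc hΩc.isPreconnected
  obtain ⟨z₀, hz₀⟩ := dom_nonempty hQn hΩc.nonempty
  have F := fun z (hz : z ∈ dom Q Ω) => hX.flatForm hQo hΩo hpos hh hz rfl
  have C := fun z (hz : z ∈ dom Q Ω) => hX.cauchyForm hΩo hpos hh hz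
  have E := fun z (hz : z ∈ dom Q Ω) => hX.constitutiveForm hΩo hpos hh hz
  have M := fun z (hz : z ∈ dom Q Ω) => hX.momentumForm hQo hΩo hpos hh hz rfl rfl
  have R := fun z (hz : z ∈ dom Q Ω) => hX.rho_coeff hQo hΩo hpos hh hz rfl rfl
  set T := (fderiv ℝ X z₀ (eX 0)).1 0 with hT
  set A := (fderiv ℝ X z₀ (eX 1)).1 1 with hA
  set l := (fderiv ℝ X z₀ (eγ 0)).2.1 0 with hl
  -- The axial vector of the skew part of the `γ`-block.
  set w : Fin 3 → ℝ := ![(fderiv ℝ X z₀ (eγ 1)).2.1 2, -(fderiv ℝ X z₀ (eγ 0)).2.1 2,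
    (fderiv ℝ X z₀ (eγ 0)).2.1 1] with hw
  set g := (fderiv ℝ X z₀ (eX 0)).2.1 with hg
  have cT : ∀ z ∈ dom Q Ω, (fderiv ℝ X z (eX 0)).1 0 = T := fun z hz =>
    fderiv_const_of_fderiv_fderiv hD hD' hX.1 (pXi 0) (eX 0) (fun z hz => (F z hz).t) hz hz₀
  have cA : ∀ z ∈ dom Q Ω, (fderiv ℝ X z (eX 1)).1 1 = A := fun z hz =>
    fderiv_const_of_fderiv_fderiv hD hD' hX.1 (pXi 1) (eX 1) (fun z hz => (F z hz).x) hz hz₀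
  have cg : ∀ z ∈ dom Q Ω, (fderiv ℝ X z (eX 0)).2.1 = g := fun z hz =>
    fderiv_const_of_fderiv_fderiv hD hD' hX.1 pG (eX 0) (fun z hz => (F z hz).v) hz hz₀
  have cB : ∀ k, ∀ z ∈ dom Q Ω, (fderiv ℝ X z (eγ k)).2.1 = (fderiv ℝ X z₀ (eγ k)).2.1 :=
    fun k z hz => fderiv_const_of_fderiv_fderiv hD hD' hX.1 pG (eγ k)
      (fun z hz v => (F z hz).g v k) hz hz₀
  have B : ∀ v : Fin 3 → ℝ, v 0 • (fderiv ℝ X z₀ (eγ 0)).2.1 + v 1 • (fderiv ℝ X z₀ (eγ 1)).2.1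
      + v 2 • (fderiv ℝ X z₀ (eγ 2)).2.1 = l • v + w ⨯₃ v := by
    intro v
    obtain ⟨s1, s2, s3⟩ := (M z₀ hz₀).skew
    obtain ⟨d1, d2⟩ := (M z₀ hz₀).diag
    ext k
    fin_cases k
    · simp [cross_apply, hw, ← hl]
      linear_combination v 1 * s1 + v 2 * s2
    · simp [cross_apply, hw]
      linear_combination v 2 * s3 + v 1 * d1
    · simp [cross_apply, hw]
      linear_combination v 2 * d2
  have hσ : ∀ z ∈ dom Q Ω, (X z).2.2.2 = (2 * A - 2 * T) * z.2.2.2 := fun z hz => by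
    rw [(M z hz).density, cT z hz, cA z hz, mul_comm]
  have htr : ∀ z ∈ dom Q Ω, A + (fderiv ℝ X z (eX 2)).1 2 + (fderiv ℝ X z (eX 3)).1 3
      = 3 * l + 2 * A - 2 * T := fun z hz => by
    have h1 := (C z hz).y_eq
    rw [hσ z hz, mul_comm] at h1
    have h2 := mul_left_cancel₀ (hpos _ hz.2).ne' h1
    obtain ⟨d1, d2⟩ := (M z₀ hz₀).diag
    rw [cA z hz, cB 0 z hz, cB 1 z hz, cB 2 z hz, d1, d2, ← hl] at h2
    linarith
  have hform : ∀ z ∈ dom Q Ω, ∀ v, fderiv ℝ X z v =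
      (![T * v.1 0, A * v.1 1 + (fderiv ℝ X z (eX 2)).1 1 * v.1 2
          + (fderiv ℝ X z (eX 3)).1 1 * v.1 3,
          (fderiv ℝ X z (eX 2)).1 2 * v.1 2 + (fderiv ℝ X z (eX 3)).1 2 * v.1 3,
          (fderiv ℝ X z (eX 2)).1 3 * v.1 2 + (fderiv ℝ X z (eX 3)).1 3 * v.1 3],
        l • v.2.1 + w ⨯₃ v.2.1 + v.1 0 • g, (2 * l + 2 * A - 4 * T) * v.2.2.1,
        (2 * A - 2 * T) * v.2.2.2) := by
    intro z hz v
    have hρ := (hpos _ hz.2).ne'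
    obtain ⟨t1, t2, t3⟩ := (E z hz).t
    obtain ⟨Rγ, Pγ, RP, RR, R1, R2, R3⟩ := R z hz
    have div := (F z hz).div
    rw [div, mul_zero] at R1 R2 R3
    have RR' : (fderiv ℝ X z eR).2.2.2 = 2 * A - 2 * T := by
      refine mul_left_cancel₀ hρ ?_
      rw [RR, hσ z hz, mul_comm]
    have R0 : (fderiv ℝ X z (eX 0)).2.2.2 = 0 := by
      rw [hX.rho_form hQo hΩo hpos hh hz rfl rfl, div, show (eX 0).2.2.2 = 0 from rfl]
      simp [(F z hz).g]
    have P0 : (fderiv ℝ X z (eX 0)).2.2.1 = 0 := by rw [(E z hz).t_eq, R0, mul_zero]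
    have PP : (fderiv ℝ X z eP).2.2.1 = 2 * l + 2 * A - 4 * T := by
      rw [(M z hz).pressure, cT z hz, cA z hz, cB 0 z hz, htr z hz, ← hl]
      ring
    rw [clm_apply_pt]
    refine Prod.ext ?_ (Prod.ext ?_ (Prod.ext ?_ ?_))
    · ext i
      fin_cases i
      · simp [(C z hz).x1, (C z hz).x2, (C z hz).x3, (C z hz).g, (C z hz).p, (C z hz).r, cT z hz,
          mul_comm]
      · simp [t1, (C z hz).g, (C z hz).p, (C z hz).r, cA z hz, mul_comm]
      · simp [t2, (C z hz).g, (C z hz).p, (C z hz).r, (M z hz).field, mul_comm]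
      · simp [t3, (C z hz).g, (C z hz).p, (C z hz).r, (M z hz).field, mul_comm]
    · rw [← B]
      simp [(C z hz).x1, (C z hz).x2, (C z hz).x3, (C z hz).p, (C z hz).r, cg z hz, cB _ z hz]
      abel
    · simp [P0, (M z hz).pressure_x, (M z hz).pressure_r, Pγ, PP, mul_comm]
    · simp [R0, R1, R2, R3, RP, RR', Rγ, mul_comm]
  -- The derivative of the `∂_p` coefficient is constant and sees only `dp`, so this coefficient is
  -- affine in `p`. Its constant term becomes `c₃`.
  have hp : ∀ z ∈ dom Q Ω, (X z).2.2.1 - (2 * l + 2 * A - 4 * T) * z.2.2.1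
      = (X z₀).2.2.1 - (2 * l + 2 * A - 4 * T) * z₀.2.2.1 := by
    intro z hz
    have hd : ∀ z ∈ dom Q Ω, HasFDerivAt (fun z => pP (X z) - (2 * l + 2 * A - 4 * T) * pP z)
        (pP.comp (fderiv ℝ X z) - (2 * l + 2 * A - 4 * T) • pP) z := fun z hz =>
      (pP.hasFDerivAt.comp z ((contDiffAt_of_mem hX.1 hD hz).differentiableAt
        (by simp)).hasFDerivAt).sub (pP.hasFDerivAt.const_mul _)
    refine hD.is_const_of_fderiv_eq_zero (𝕜 := ℝ)
      (f := fun z => pP (X z) - (2 * l + 2 * A - 4 * T) * pP z) hD'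
      (fun z hz => (hd z hz).differentiableAt.differentiableWithinAt) (fun z hz => ?_) hz hz₀
    rw [(hd z hz).fderiv]
    refine ContinuousLinearMap.ext fun v => ?_
    change (fderiv ℝ X z v).2.2.1 - (2 * l + 2 * A - 4 * T) * v.2.2.1 = 0
    rw [hform z hz]
    simp
  set c := (X z₀).2.2.1 - (2 * l + 2 * A - 4 * T) * z₀.2.2.1
  refine ⟨T, A, l, w, g, c, ⟨hX.1, fun z hz => ⟨Prod.ext ?_ (hσ z hz), _, _, _, _, _, _, ?_,
    hform z hz⟩⟩, fun q hq => ?_⟩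
  · linear_combination hp z hz
  · linear_combination htr z hz
  · obtain ⟨q', hq'⟩ := hQn
    have hz : ((q'.1, q'.2, q) : Pt) ∈ dom Q Ω := ⟨hq', hq⟩
    have h1 := (E _ hz).class_eq
    have h2 := hp _ hz
    rw [hσ _ hz, hform _ hz eP, hform _ hz eR] at h1
    simp [eP, eR] at h1 h2
    linear_combination h1 + fderiv ℝ h q (1, 0) * h2

end Global

/-! ### Normal forms of the operators -/

/-- The projection to `(ξ², ξ³)`. -/
def pξ : Pt →L[ℝ] ℝ × ℝ := (pXi 2).prod (pXi 3)

@[simp] lemma pξ_apply (z : Pt) : pξ z = (z.1 2, z.1 3) := rfl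

/-- The general linear combination of the generators of the extended Galilean group. -/
def galOp (τ s : ℝ) (w g e : Fin 3 → ℝ) : Pt → Pt := fun z =>
  (Pi.single 0 τ + s • z.1, s • z.2.1 + w ⨯₃ z.2.1 + z.1 0 • g + e, 0)

/-- The operator `a ∂_{ξ¹} + b² ∂_{ξ²} + b³ ∂_{ξ³}`. -/
def reparamOp (a b₂ b₃ : ℝ × ℝ → ℝ) : Pt → Pt := fun z =>
  (![0, a (z.1 2, z.1 3), b₂ (z.1 2, z.1 3), b₃ (z.1 2, z.1 3)], 0)

lemma galOp_mem (τ s : ℝ) (w g e : Fin 3 → ℝ) : galOp τ s w g e ∈ galileanSpan := by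
  have h : galOp τ s w g e = τ • opT0 + s • opS + (w 0 • opR 0 + w 1 • opR 1 + w 2 • opR 2)
      + (g 0 • opG 0 + g 1 • opG 1 + g 2 • opG 2) + (e 0 • opT 0 + e 1 • opT 1 + e 2 • opT 2) := by
    funext z
    refine Prod.ext ?_ (Prod.ext ?_ ?_)
    · ext i
      fin_cases i <;> simp [galOp, opT0, opS, opR, opG, opT]
    · ext i
      fin_cases i <;>
        simp [galOp, opT0, opS, opR, opG, opT, cross_apply, Matrix.vecHead, Matrix.vecTail] <;> ring
    · simp [galOp, opT0, opS, opR, opG, opT]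
  have hT : ∀ i, opT i ∈ galileanSpan := fun i =>
    Submodule.subset_span (Or.inl (Or.inl (Or.inr ⟨i, rfl⟩)))
  have hR : ∀ i, opR i ∈ galileanSpan := fun i => Submodule.subset_span (Or.inl (Or.inr ⟨i, rfl⟩))
  have hG : ∀ i, opG i ∈ galileanSpan := fun i => Submodule.subset_span (Or.inr ⟨i, rfl⟩)
  have h0 : opT0 ∈ galileanSpan := Submodule.subset_span (by simp)
  have hS : opS ∈ galileanSpan := Submodule.subset_span (by simp)
  rw [h]
  have sm : ∀ (c : ℝ) {x : Pt → Pt}, x ∈ galileanSpan → c • x ∈ galileanSpan :=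
    fun c _ hx => galileanSpan.smul_mem c hx
  have ad : ∀ {x y : Pt → Pt}, x ∈ galileanSpan → y ∈ galileanSpan → x + y ∈ galileanSpan :=
    fun hx hy => galileanSpan.add_mem hx hy
  exact ad (ad (ad (ad (sm _ h0) (sm _ hS)) (ad (ad (sm _ (hR 0)) (sm _ (hR 1))) (sm _ (hR 2))))
    (ad (ad (sm _ (hG 0)) (sm _ (hG 1))) (sm _ (hG 2))))
    (ad (ad (sm _ (hT 0)) (sm _ (hT 1))) (sm _ (hT 2)))

lemma exists_galOp {Z : Pt → Pt} (hZ : Z ∈ galileanSpan) : ∃ τ s w g e, Z = galOp τ s w g e := by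
  induction hZ using Submodule.span_induction with
  | mem x hx =>
    rcases hx with (((rfl | hx) | ⟨i, rfl⟩) | ⟨i, rfl⟩) | ⟨i, rfl⟩
    · exact ⟨1, 0, 0, 0, 0, by funext z; simp [galOp, opT0]; rfl⟩
    · rw [mem_singleton_iff.1 hx]
      exact ⟨0, 1, 0, 0, 0, by funext z; simp [galOp, opS]⟩
    · exact ⟨0, 0, 0, 0, Pi.single i 1, by funext z; simp [galOp, opT]⟩
    · exact ⟨0, 0, Pi.single i 1, 0, 0, by funext z; simp [galOp, opR]⟩
    · exact ⟨0, 0, 0, Pi.single i 1, 0, by funext z; simp [galOp, opG, ← Pi.single_smul']⟩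
  | zero => exact ⟨0, 0, 0, 0, 0, by funext z; simp [galOp]; rfl⟩
  | add x y _ _ hx hy =>
    obtain ⟨τ, s, w, g, e, rfl⟩ := hx
    obtain ⟨τ', s', w', g', e', rfl⟩ := hy
    refine ⟨τ + τ', s + s', w + w', g + g', e + e', ?_⟩
    funext z
    simp only [galOp, Pi.add_apply, Prod.mk_add_mk, Pi.single_add, map_add, LinearMap.add_apply,
      add_smul, smul_add, add_zero]
    refine Prod.ext ?_ (Prod.ext ?_ rfl)
    · dsimp only
      abel
    · dsimp only
      abel
  | smul c x _ hx =>
    obtain ⟨τ, s, w, g, e, rfl⟩ := hx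
    refine ⟨c * τ, c * s, c • w, c • g, c • e, ?_⟩
    funext z
    simp only [galOp, Pi.smul_apply, Prod.smul_mk, map_smul, LinearMap.smul_apply,
      smul_add, smul_zero, mul_smul]
    refine Prod.ext ?_ (Prod.ext ?_ rfl)
    · dsimp only
      rw [← smul_eq_mul, Pi.single_smul']
    · dsimp only
      rw [smul_comm c (z.1 0) g]

lemma isGalileanOperator_iff {D : Set Pt} {X : Pt → Pt} :
    IsGalileanOperator D X ↔ ∃ τ s w g e, EqOn X (galOp τ s w g e) D := by
  constructor
  · rintro ⟨Z, hZ, h⟩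
    obtain ⟨τ, s, w, g, e, rfl⟩ := exists_galOp hZ
    exact ⟨τ, s, w, g, e, h⟩
  · rintro ⟨τ, s, w, g, e, h⟩
    exact ⟨_, galOp_mem τ s w g e, h⟩

lemma isOpen_image_pξ {D : Set Pt} (hD : IsOpen D) :
    IsOpen ((fun z : Pt => (z.1 2, z.1 3)) '' D) := by
  have hs : Function.Surjective pξ := fun w => ⟨(![0, 0, w.1, w.2], 0), by simp⟩
  exact pξ.isOpenMap hs D hD

/-! ### Derivatives of the normal forms -/

lemma contDiff_galOp (τ s : ℝ) (w g e : Fin 3 → ℝ) : ContDiff ℝ ∞ (galOp τ s w g e) := by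
  have h : ContDiff ℝ ∞ fun z : Pt => w ⨯₃ z.2.1 :=
    ((crossProduct w).toContinuousLinearMap.comp pG).contDiff
  unfold galOp
  fun_prop

lemma fderiv_galOp (τ s : ℝ) (w g e : Fin 3 → ℝ) (z v : Pt) : fderiv ℝ (galOp τ s w g e) z v
    = (s • v.1, s • v.2.1 + w ⨯₃ v.2.1 + v.1 0 • g, 0) := by
  refine fderiv_apply_eq_of_line ((contDiff_galOp τ s w g e).differentiable (by simp) z) ?_
  have h : (fun t : ℝ => galOp τ s w g e (z + t • v)) = fun t : ℝ => galOp τ s w g e z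
      + t • ((s • v.1, s • v.2.1 + w ⨯₃ v.2.1 + v.1 0 • g, 0) : Pt) := by
    funext t
    simp only [galOp, Prod.fst_add, Prod.snd_add, Prod.smul_fst, Prod.smul_snd, map_add, map_smul,
      Pi.add_apply, Pi.smul_apply, Prod.smul_mk, Prod.mk_add_mk, smul_zero, add_zero]
    refine Prod.ext ?_ (Prod.ext ?_ rfl)
    · dsimp only
      module
    · dsimp only
      module
  rw [h]
  simpa using ((hasDerivAt_id (0 : ℝ)).smul_const
    ((s • v.1, s • v.2.1 + w ⨯₃ v.2.1 + v.1 0 • g, 0) : Pt)).const_add (galOp τ s w g e z)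

lemma contDiff_opY (c₁ c₂ c₃ : ℝ) : ContDiff ℝ ∞ (opY c₁ c₂ c₃) := by
  have h : ContDiff ℝ ∞ fun z : Pt =>
      (![c₁ * z.1 0, (-4 * c₁ + 2 * c₂) * z.1 1, c₂ * z.1 2, c₂ * z.1 3] : Indep) := by
    rw [contDiff_pi]
    intro i
    fin_cases i <;> simp <;> fun_prop
  unfold opY
  fun_prop

lemma fderiv_opY (c₁ c₂ c₃ : ℝ) (z v : Pt) : fderiv ℝ (opY c₁ c₂ c₃) z v = opY c₁ c₂ 0 v := by
  refine fderiv_apply_eq_of_line ((contDiff_opY c₁ c₂ c₃).differentiable (by simp) z) ?_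
  have h : (fun t : ℝ => opY c₁ c₂ c₃ (z + t • v)) = fun t : ℝ => opY c₁ c₂ c₃ z
      + t • opY c₁ c₂ 0 v := by
    funext t
    refine Prod.ext ?_ (Prod.ext ?_ (Prod.ext ?_ ?_))
    · ext i
      fin_cases i <;> simp [opY] <;> ring
    · simp [opY]
      module
    · simp [opY]
      ring
    · simp [opY]
      ring
  rw [h]
  simpa using ((hasDerivAt_id (0 : ℝ)).smul_const (opY c₁ c₂ 0 v)).const_add (opY c₁ c₂ c₃ z)

section Reparam

variable {D : Set Pt} {a b₂ b₃ : ℝ × ℝ → ℝ}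

lemma contDiffOn_comp_pξ (ha : ContDiffOn ℝ ∞ a ((fun z : Pt => (z.1 2, z.1 3)) '' D)) :
    ContDiffOn ℝ ∞ (fun z : Pt => a (z.1 2, z.1 3)) D :=
  ha.comp (pξ.contDiff.contDiffOn) fun _ hz => mem_image_of_mem _ hz

lemma contDiffOn_reparamOp (ha : ContDiffOn ℝ ∞ a ((fun z : Pt => (z.1 2, z.1 3)) '' D))
    (h₂ : ContDiffOn ℝ ∞ b₂ ((fun z : Pt => (z.1 2, z.1 3)) '' D))
    (h₃ : ContDiffOn ℝ ∞ b₃ ((fun z : Pt => (z.1 2, z.1 3)) '' D)) :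
    ContDiffOn ℝ ∞ (reparamOp a b₂ b₃) D := by
  refine ContDiffOn.prodMk ?_ contDiffOn_const
  rw [contDiffOn_pi]
  intro i
  fin_cases i
  · exact contDiffOn_const
  · exact contDiffOn_comp_pξ ha
  · exact contDiffOn_comp_pξ h₂
  · exact contDiffOn_comp_pξ h₃

lemma hasDerivAt_comp_pξ_line {z : Pt} (ha : DifferentiableAt ℝ a (z.1 2, z.1 3)) (v : Pt) :
    HasDerivAt (fun t : ℝ => a ((z + t • v).1 2, (z + t • v).1 3))
      (fderiv ℝ a (z.1 2, z.1 3) (v.1 2, v.1 3)) 0 := by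
  have h1 : HasDerivAt (fun t : ℝ => pξ (z + t • v)) (pξ v) 0 := by
    have : HasDerivAt (fun t : ℝ => pξ z + t • pξ v) (pξ v) 0 := by
      simpa using ((hasDerivAt_id (0 : ℝ)).smul_const (pξ v)).const_add (pξ z)
    exact this
  refine HasFDerivAt.comp_hasDerivAt (l := a) (0 : ℝ) ?_ h1
  simpa using ha.hasFDerivAt

lemma fderiv_reparamOp {z : Pt} (ha : DifferentiableAt ℝ a (z.1 2, z.1 3))
    (h₂ : DifferentiableAt ℝ b₂ (z.1 2, z.1 3)) (h₃ : DifferentiableAt ℝ b₃ (z.1 2, z.1 3))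
    (v : Pt) : fderiv ℝ (reparamOp a b₂ b₃) z v = (![0, fderiv ℝ a (z.1 2, z.1 3) (v.1 2, v.1 3),
      fderiv ℝ b₂ (z.1 2, z.1 3) (v.1 2, v.1 3), fderiv ℝ b₃ (z.1 2, z.1 3) (v.1 2, v.1 3)], 0) := by
  refine fderiv_apply_eq_of_line ?_ ?_
  · refine DifferentiableAt.prodMk ?_ (differentiableAt_const _)
    have hd : ∀ {f : ℝ × ℝ → ℝ}, DifferentiableAt ℝ f (z.1 2, z.1 3) →
        DifferentiableAt ℝ (fun z : Pt => f (z.1 2, z.1 3)) z := fun hf =>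
      DifferentiableAt.comp z (by exact hf) pξ.differentiableAt
    rw [differentiableAt_pi]
    intro i
    fin_cases i
    · exact differentiableAt_const _
    · exact hd ha
    · exact hd h₂
    · exact hd h₃
  · refine HasDerivAt.prodMk ?_ (hasDerivAt_const _ _)
    rw [hasDerivAt_pi]
    intro i
    fin_cases i
    · exact hasDerivAt_const _ _
    · exact hasDerivAt_comp_pξ_line ha v
    · exact hasDerivAt_comp_pξ_line h₂ v
    · exact hasDerivAt_comp_pξ_line h₃ v

end Reparam

section Integration

variable {Q : Set (Indep × (Fin 3 → ℝ))} {Ω : Set (ℝ × ℝ)}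

/-! ### Functions that depend on `(ξ², ξ³)` only -/

/-- First `(p, ρ)` is moved inside the connected set `Ω`, then `(t, ξ, γ)` along a segment on which
`ξ²` and `ξ³` are constant. Convexity of `Q` keeps the segment inside; in a merely connected `Q` a
fibre could be disconnected. -/
lemma eq_of_fderiv_eq_zero_of_fiber (hQo : IsOpen Q) (hQc : Convex ℝ Q) (hΩo : IsOpen Ω)
    (hΩc : IsPreconnected Ω) {f : Pt → ℝ} (hf : ContDiffOn ℝ ∞ f (dom Q Ω))
    (h0 : ∀ z ∈ dom Q Ω, ∀ v : Pt, v.1 2 = 0 → v.1 3 = 0 → fderiv ℝ f z v = 0)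
    {z z' : Pt} (hz : z ∈ dom Q Ω) (hz' : z' ∈ dom Q Ω) (h2 : z.1 2 = z'.1 2)
    (h3 : z.1 3 = z'.1 3) : f z = f z' := by
  have hd : ∀ y ∈ dom Q Ω, HasFDerivAt f (fderiv ℝ f y) y := fun y hy =>
    ((hf.contDiffAt ((isOpen_dom hQo hΩo).mem_nhds hy)).differentiableAt (by simp)).hasFDerivAt
  have step1 : f z = f (z.1, z.2.1, z'.2.2) := by
    have hu : ∀ u ∈ Ω, HasFDerivAt (fun u : ℝ × ℝ => f (z.1, z.2.1, u))
        ((fderiv ℝ f (z.1, z.2.1, u)).comp ((0 : ℝ × ℝ →L[ℝ] Indep).prod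
          ((0 : ℝ × ℝ →L[ℝ] (Fin 3 → ℝ)).prod (ContinuousLinearMap.id ℝ (ℝ × ℝ))))) u := by
      intro u hu
      exact HasFDerivAt.comp (g := f) u (hd _ ⟨hz.1, hu⟩)
        ((hasFDerivAt_const _ _).prodMk ((hasFDerivAt_const _ _).prodMk (hasFDerivAt_id u)))
    refine hΩo.is_const_of_fderiv_eq_zero (𝕜 := ℝ) (f := fun u : ℝ × ℝ => f (z.1, z.2.1, u)) hΩc
      (fun u h => (hu u h).differentiableAt.differentiableWithinAt) (fun u h => ?_) hz.2 hz'.2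
    rw [(hu u h).fderiv]
    exact ContinuousLinearMap.ext fun w => h0 (z.1, z.2.1, u) ⟨hz.1, h⟩ (0, 0, w) rfl rfl
  rw [step1]
  let q : ℝ → Indep × (Fin 3 → ℝ) := AffineMap.lineMap (z.1, z.2.1) (z'.1, z'.2.1)
  have hq : ∀ t, HasDerivAt q ((z'.1, z'.2.1) - (z.1, z.2.1)) t := fun t =>
    AffineMap.hasDerivAt_lineMap
  have hqc : Continuous q := continuous_iff_continuousAt.2 fun t => (hq t).continuousAt
  have hS : IsPreconnected (q ⁻¹' Q) := by
    refine Convex.isPreconnected ?_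
    exact hQc.affine_preimage (AffineMap.lineMap (z.1, z.2.1) (z'.1, z'.2.1))
  have hg : ∀ t ∈ q ⁻¹' Q, HasDerivAt (fun t => f ((q t).1, (q t).2, z'.2.2)) 0 t := by
    intro t ht
    have h1 : HasDerivAt (fun t : ℝ => ((AffineMap.lineMap z.1 z'.1 t,
        AffineMap.lineMap z.2.1 z'.2.1 t, z'.2.2) : Pt)) (z'.1 - z.1, z'.2.1 - z.2.1, 0) t :=
      HasDerivAt.prodMk AffineMap.hasDerivAt_lineMap
        (HasDerivAt.prodMk AffineMap.hasDerivAt_lineMap (hasDerivAt_const t z'.2.2))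
    have h2' := HasFDerivAt.comp_hasDerivAt (l := f) t
      (hd (AffineMap.lineMap z.1 z'.1 t, AffineMap.lineMap z.2.1 z'.2.1 t, z'.2.2)
        ⟨ht, hz'.2⟩) h1
    rw [h0 (AffineMap.lineMap z.1 z'.1 t, AffineMap.lineMap z.2.1 z'.2.1 t, z'.2.2) ⟨ht, hz'.2⟩
      (z'.1 - z.1, z'.2.1 - z.2.1, 0) (by simp [h2]) (by simp [h3])] at h2'
    exact h2'
  have h01 := (hQo.preimage hqc).is_const_of_fderiv_eq_zero (𝕜 := ℝ)
    (f := fun t => f ((q t).1, (q t).2, z'.2.2)) hS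
    (fun t ht => (hg t ht).differentiableAt.differentiableWithinAt)
    (fun t ht => by rw [(hg t ht).hasFDerivAt.fderiv]; ext; simp)
    (x := 0) (y := 1) (by simpa [q] using hz.1) (by simpa [q] using hz'.1)
  simpa [q] using h01

/-- The fibrewise constancy of `f` makes the value independent of the chosen preimage. Smoothness is
local and comes from composing `f` with a smooth section of the projection. -/
lemma exists_factor (hQo : IsOpen Q) (hQc : Convex ℝ Q) (hΩo : IsOpen Ω)
    (hΩc : IsPreconnected Ω) {f : Pt → ℝ} (hf : ContDiffOn ℝ ∞ f (dom Q Ω))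
    (h0 : ∀ z ∈ dom Q Ω, ∀ v : Pt, v.1 2 = 0 → v.1 3 = 0 → fderiv ℝ f z v = 0) :
    ∃ a : ℝ × ℝ → ℝ, ContDiffOn ℝ ∞ a ((fun z : Pt => (z.1 2, z.1 3)) '' dom Q Ω) ∧
      ∀ z ∈ dom Q Ω, f z = a (z.1 2, z.1 3) := by
  classical
  let a : ℝ × ℝ → ℝ := fun w =>
    if h : ∃ z ∈ dom Q Ω, ((z.1 2, z.1 3) : ℝ × ℝ) = w then f h.choose else 0
  have ha : ∀ z ∈ dom Q Ω, f z = a (z.1 2, z.1 3) := by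
    intro z hz
    have h : ∃ y ∈ dom Q Ω, ((y.1 2, y.1 3) : ℝ × ℝ) = (z.1 2, z.1 3) := ⟨z, hz, rfl⟩
    simp only [a, dif_pos h]
    obtain ⟨h1, h2⟩ := h.choose_spec
    exact eq_of_fderiv_eq_zero_of_fiber hQo hQc hΩo hΩc hf h0 hz h1 (congrArg Prod.fst h2).symm
      (congrArg Prod.snd h2).symm
  refine ⟨a, ?_, ha⟩
  rintro _ ⟨z, hz, rfl⟩
  refine ContDiffAt.contDiffWithinAt ?_
  -- The affine section through `z` that changes only `ξ²` and `ξ³`.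
  let σ : ℝ × ℝ → Pt := fun w => z + (w.1 - z.1 2) • eX 2 + (w.2 - z.1 3) • eX 3
  have hσ : ContDiff ℝ ∞ σ := by
    unfold σ
    fun_prop
  have hσz : σ (z.1 2, z.1 3) = z := by simp [σ]
  have hev : ∀ᶠ w in nhds ((z.1 2, z.1 3) : ℝ × ℝ), σ w ∈ dom Q Ω :=
    hσ.continuous.continuousAt.eventually_mem
      (by rw [hσz]; exact (isOpen_dom hQo hΩo).mem_nhds hz)
  have h1 : ContDiffAt ℝ ∞ (f ∘ σ) ((z.1 2, z.1 3) : ℝ × ℝ) := by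
    refine ContDiffAt.comp _ ?_ hσ.contDiffAt
    rw [hσz]
    exact hf.contDiffAt ((isOpen_dom hQo hΩo).mem_nhds hz)
  refine h1.congr_of_eventuallyEq ?_
  filter_upwards [hev] with w hw
  rw [Function.comp_apply, ha _ hw]
  simp [σ, eX]

/-! ### The extended form in coordinates -/

lemma EqOn.fderiv_eq_of_isOpen {D : Set Pt} (hD : IsOpen D) {X Y : Pt → Pt} (h : EqOn X Y D)
    {z : Pt} (hz : z ∈ D) : fderiv ℝ X z = fderiv ℝ Y z :=
  (h.eventuallyEq_of_mem (hD.mem_nhds hz)).fderiv_eq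

lemma differentiableAt_of_image {D : Set Pt} (hD : IsOpen D) {a : ℝ × ℝ → ℝ}
    (ha : ContDiffOn ℝ ∞ a ((fun z : Pt => (z.1 2, z.1 3)) '' D)) {z : Pt} (hz : z ∈ D) :
    DifferentiableAt ℝ a (z.1 2, z.1 3) :=
  (ha.contDiffAt ((isOpen_image_pξ hD).mem_nhds (mem_image_of_mem _ hz))).differentiableAt (by simp)

theorem hasSymmetryForm_of_eqOn {D : Set Pt} (hD : IsOpen D) {X A B : Pt → Pt} {c₁ c₂ c₃ : ℝ}
    (hA : IsReparamOperator D A) (hB : IsGalileanOperator D B)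
    (hX : EqOn X (A + B + opY c₁ c₂ c₃) D) :
    ∃ s w g, HasSymmetryForm D X (s + c₁) (s - 4 * c₁ + 2 * c₂) (s + 2 * c₁) w g c₃ := by
  obtain ⟨a, b₂, b₃, hs, hdiv, hA⟩ := hA
  obtain ⟨τ, s, w, g, e, hB⟩ := isGalileanOperator_iff.1 hB
  have ha := hs a (by simp)
  have h₂ := hs b₂ (by simp)
  have h₃ := hs b₃ (by simp)
  have hX' : EqOn X (fun z => reparamOp a b₂ b₃ z + galOp τ s w g e z + opY c₁ c₂ c₃ z) D :=
    fun z hz => by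
      rw [hX hz, Pi.add_apply, Pi.add_apply, hA z hz, hB hz]
      rfl
  refine ⟨s, w, g, ?_, fun z hz => ⟨?_, fderiv ℝ a (z.1 2, z.1 3) (1, 0),
    fderiv ℝ a (z.1 2, z.1 3) (0, 1), s + c₂ + fderiv ℝ b₂ (z.1 2, z.1 3) (1, 0),
    fderiv ℝ b₂ (z.1 2, z.1 3) (0, 1), fderiv ℝ b₃ (z.1 2, z.1 3) (1, 0),
    s + c₂ + fderiv ℝ b₃ (z.1 2, z.1 3) (0, 1), ?_, fun v => ?_⟩⟩
  · exact (((contDiffOn_reparamOp ha h₂ h₃).add (contDiff_galOp τ s w g e).contDiffOn).add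
      (contDiff_opY c₁ c₂ c₃).contDiffOn).congr hX'
  · rw [hX' hz]
    refine Prod.ext ?_ ?_
    · simp only [reparamOp, galOp, opY, Prod.snd_add, Prod.fst_add, Prod.fst_zero, Prod.snd_zero]
      ring
    · simp only [reparamOp, galOp, opY, Prod.snd_add, Prod.snd_zero]
      ring
  · linear_combination hdiv _ (mem_image_of_mem _ hz)
  · have d1 := differentiableAt_of_image hD ha hz
    have d2 := differentiableAt_of_image hD h₂ hz
    have d3 := differentiableAt_of_image hD h₃ hz
    have dR : DifferentiableAt ℝ (reparamOp a b₂ b₃) z :=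
      ((contDiffOn_reparamOp ha h₂ h₃).contDiffAt (hD.mem_nhds hz)).differentiableAt (by simp)
    have dG := (contDiff_galOp τ s w g e).differentiable (by simp) z
    have dY := (contDiff_opY c₁ c₂ c₃).differentiable (by simp) z
    rw [EqOn.fderiv_eq_of_isOpen hD hX' hz, fderiv_fun_add (dR.fun_add dG) dY, fderiv_fun_add dR dG,
      add_apply, add_apply, fderiv_galOp, fderiv_opY,
      fderiv_reparamOp d1 d2 d3, pair_apply (fderiv ℝ a _), pair_apply (fderiv ℝ b₂ _),
      pair_apply (fderiv ℝ b₃ _)]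
    refine Prod.ext ?_ (Prod.ext ?_ (Prod.ext ?_ ?_))
    · ext i
      fin_cases i <;> simp [opY, Matrix.vecHead, Matrix.vecTail] <;> ring
    · simp [opY]
      module
    · simp [opY, -mul_eq_mul_right_iff]
      ring
    · simp [opY, -mul_eq_mul_right_iff]
      ring

/-- The weights determine the scaling parameter `2T - l` and the constants of `opY`. Subtracting
these operators leaves a field `W` whose derivative is that of a reparametrization operator. -/
theorem HasSymmetryForm.exists_eqOn (hQo : IsOpen Q) (hQc : Convex ℝ Q) (hQn : Q.Nonempty)
    (hΩo : IsOpen Ω) (hΩc : IsConnected Ω) {X : Pt → Pt} {T A l c : ℝ} {w g : Fin 3 → ℝ}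
    (hX : HasSymmetryForm (dom Q Ω) X T A l w g c) :
    ∃ A' B', IsReparamOperator (dom Q Ω) A' ∧ IsGalileanOperator (dom Q Ω) B' ∧
      EqOn X (A' + B' + opY (l - T) ((A + 5 * l - 6 * T) / 2) c) (dom Q Ω) := by
  have hD := isOpen_dom hQo hΩo
  have hD' := isPreconnected_dom hQc hΩc.isPreconnected
  obtain ⟨z₀, hz₀⟩ := dom_nonempty hQn hΩc.nonempty
  -- The translations are left at zero here. They are recovered afterwards from the constant `t` and
  -- `γ` components of `W`.
  set G := galOp 0 (2 * T - l) w g 0 with hG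
  set Y := opY (l - T) ((A + 5 * l - 6 * T) / 2) c with hY
  set W : Pt → Pt := fun z => X z - G z - Y z with hW
  have cG := contDiff_galOp 0 (2 * T - l) w g 0
  have cY := contDiff_opY (l - T) ((A + 5 * l - 6 * T) / 2) c
  have cW : ContDiffOn ℝ ∞ W (dom Q Ω) := (hX.1.sub cG.contDiffOn).sub cY.contDiffOn
  have dW : ∀ z ∈ dom Q Ω, DifferentiableAt ℝ W z := fun z hz =>
    (contDiffAt_of_mem cW hD hz).differentiableAt (by simp)
  have fW : ∀ z ∈ dom Q Ω, ∃ a₂ a₃ b₂₂ b₂₃ b₃₂ b₃₃ : ℝ, b₂₂ + b₃₃ = 0 ∧ ∀ v, fderiv ℝ W z v =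
      (![0, a₂ * v.1 2 + a₃ * v.1 3, b₂₂ * v.1 2 + b₂₃ * v.1 3, b₃₂ * v.1 2 + b₃₃ * v.1 3], 0) := by
    intro z hz
    obtain ⟨-, a₂, a₃, b₂₂, b₂₃, b₃₂, b₃₃, hb, hv⟩ := hX.2 z hz
    refine ⟨a₂, a₃, b₂₂ - (2 * T - l) - (A + 5 * l - 6 * T) / 2, b₂₃, b₃₂,
      b₃₃ - (2 * T - l) - (A + 5 * l - 6 * T) / 2, by linarith, fun v => ?_⟩
    have dX := (contDiffAt_of_mem hX.1 hD hz).differentiableAt (by simp)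
    have dG := cG.differentiable (by simp) z
    have dY := cY.differentiable (by simp) z
    rw [hW, fderiv_fun_sub (dX.fun_sub dG) dY, fderiv_fun_sub dX dG, sub_apply,
      sub_apply, fderiv_galOp, fderiv_opY, hv]
    refine Prod.ext ?_ (Prod.ext ?_ (Prod.ext ?_ ?_))
    · ext i
      fin_cases i <;> simp [opY, Matrix.vecHead, Matrix.vecTail] <;> ring
    · simp [opY]
      module
    · simp [opY, -mul_eq_mul_right_iff]
      ring
    · simp [opY, -mul_eq_mul_right_iff]
      ring
  have dφ : ∀ {F : Type} [NormedAddCommGroup F] [NormedSpace ℝ F] (φ : Pt →L[ℝ] F),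
      ∀ z ∈ dom Q Ω, HasFDerivAt (fun z => φ (W z)) (φ.comp (fderiv ℝ W z)) z :=
    fun φ z hz => φ.hasFDerivAt.comp z (dW z hz).hasFDerivAt
  have const : ∀ {F : Type} [NormedAddCommGroup F] [NormedSpace ℝ F] (φ : Pt →L[ℝ] F),
      (∀ z ∈ dom Q Ω, ∀ v, φ (fderiv ℝ W z v) = 0) → ∀ z ∈ dom Q Ω, φ (W z) = φ (W z₀) := by
    intro F _ _ φ h z hz
    refine hD.is_const_of_fderiv_eq_zero (𝕜 := ℝ) (f := fun z => φ (W z)) hD'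
      (fun z hz => (dφ φ z hz).differentiableAt.differentiableWithinAt) (fun z hz => ?_) hz hz₀
    rw [(dφ φ z hz).fderiv]
    exact ContinuousLinearMap.ext (h z hz)
  have hW0 : ∀ z ∈ dom Q Ω, (W z).1 0 = (W z₀).1 0 := const (pXi 0) fun z hz v => by
    obtain ⟨a₂, a₃, b₂₂, b₂₃, b₃₂, b₃₃, -, hv⟩ := fW z hz
    rw [hv]
    rfl
  have hWg : ∀ z ∈ dom Q Ω, (W z).2.1 = (W z₀).2.1 := const pG fun z hz v => by
    obtain ⟨a₂, a₃, b₂₂, b₂₃, b₃₂, b₃₃, -, hv⟩ := fW z hz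
    rw [hv]
    rfl
  have hWu : ∀ z ∈ dom Q Ω, (W z).2.2 = 0 := fun z hz => by
    obtain ⟨hu, -⟩ := hX.2 z hz
    simp only [hW, Prod.snd_sub, hu]
    refine Prod.ext ?_ ?_ <;> simp [hG, hY, galOp, opY] <;> ring
  have factor : ∀ i : Fin 4, i ≠ 0 → ∃ a : ℝ × ℝ → ℝ,
      ContDiffOn ℝ ∞ a ((fun z : Pt => (z.1 2, z.1 3)) '' dom Q Ω) ∧
      ∀ z ∈ dom Q Ω, (W z).1 i = a (z.1 2, z.1 3) := by
    intro i hi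
    refine exists_factor hQo hQc hΩo hΩc.isPreconnected
      ((pXi i).contDiff.comp_contDiffOn cW) fun z hz v h2 h3 => ?_
    obtain ⟨a₂, a₃, b₂₂, b₂₃, b₃₂, b₃₃, -, hv⟩ := fW z hz
    have h1 : fderiv ℝ (fun z => (W z).1 i) z v = (fderiv ℝ W z v).1 i := by
      have := (dφ (pXi i) z hz).fderiv
      exact congrArg (fun M => M v) this
    rw [h1, hv, h2, h3]
    fin_cases i <;> simp
  obtain ⟨a, ha, ha'⟩ := factor 1 (by decide)
  obtain ⟨b₂, h₂, h₂'⟩ := factor 2 (by decide)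
  obtain ⟨b₃, h₃, h₃'⟩ := factor 3 (by decide)
  refine ⟨reparamOp a b₂ b₃, galOp ((W z₀).1 0) (2 * T - l) w g ((W z₀).2.1),
    ⟨a, b₂, b₃, ?_, ?_, fun _ _ => rfl⟩, isGalileanOperator_iff.2 ⟨_, _, _, _, _, fun _ _ => rfl⟩, ?_⟩
  · rintro f (rfl | rfl | rfl)
    exacts [ha, h₂, h₃]
  · rintro _ ⟨z, hz, rfl⟩
    obtain ⟨a₂, a₃, b₂₂, b₂₃, b₃₂, b₃₃, hb, hv⟩ := fW z hz
    have hd : ∀ {i : Fin 4} {b : ℝ × ℝ → ℝ}, (∀ z ∈ dom Q Ω, (W z).1 i = b (z.1 2, z.1 3)) →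
        ContDiffOn ℝ ∞ b ((fun z : Pt => (z.1 2, z.1 3)) '' dom Q Ω) → ∀ v : Pt,
        fderiv ℝ b (z.1 2, z.1 3) (v.1 2, v.1 3) = (fderiv ℝ W z v).1 i := by
      intro i b hb hs v
      have h1 : HasFDerivAt (fun z : Pt => b (z.1 2, z.1 3))
          ((fderiv ℝ b (z.1 2, z.1 3)).comp pξ) z :=
        (differentiableAt_of_image hD hs hz).hasFDerivAt.comp z pξ.hasFDerivAt
      have h2 := (dφ (pXi i) z hz).unique (h1.congr_of_eventuallyEq
        (by filter_upwards [hD.mem_nhds hz] with y hy using hb y hy))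
      exact (congrArg (fun M => M v) h2).symm
    have e2 := hd h₂' h₂ (eX 2)
    have e3 := hd h₃' h₃ (eX 3)
    rw [hv] at e2 e3
    simp [eX] at e2 e3
    simp only [e2, e3]
    exact hb
  · intro z hz
    have h1 : X z = W z + G z + Y z := by
      simp only [hW]
      abel
    rw [h1, Pi.add_apply, Pi.add_apply]
    congr 1
    refine Prod.ext ?_ (Prod.ext ?_ ?_)
    · ext i
      fin_cases i
      · simp [hG, galOp, reparamOp, Matrix.vecHead, Matrix.vecTail, hW0 z hz]
      · simp [hG, galOp, reparamOp, Matrix.vecHead, Matrix.vecTail, ha' z hz]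
      · simp [hG, galOp, reparamOp, Matrix.vecHead, Matrix.vecTail, h₂' z hz]
      · simp [hG, galOp, reparamOp, Matrix.vecHead, Matrix.vecTail, h₃' z hz]
    · simp [hG, galOp, reparamOp, Matrix.vecHead, Matrix.vecTail, hWg z hz]
      abel
    · simp [hG, galOp, reparamOp, Matrix.vecHead, Matrix.vecTail, hWu z hz]

end Integration

/-! ### The group classification -/

lemma exists_ne_zero_add_smul_mem {D : Set Pt} (hD : IsOpen D) {z : Pt} (hz : z ∈ D) (v : Pt) :
    ∃ t : ℝ, t ≠ 0 ∧ z + t • v ∈ D := by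
  have hc : Continuous fun t : ℝ => z + t • v := by fun_prop
  have h : ∀ᶠ t : ℝ in nhds 0, z + t • v ∈ D :=
    hc.continuousAt.eventually_mem (hD.mem_nhds (by simpa using hz))
  obtain ⟨t, ht, h0⟩ := ((h.filter_mono nhdsWithin_le_nhds).and
    (self_mem_nhdsWithin (a := (0 : ℝ)) (s := {0}ᶜ))).exists
  exact ⟨t, h0, ht⟩

lemma IsReparamOperator.snd_eq_zero {D : Set Pt} {A : Pt → Pt} (hA : IsReparamOperator D A)
    {z : Pt} (hz : z ∈ D) : (A z).2 = 0 := by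
  obtain ⟨a, b₂, b₃, -, -, hA⟩ := hA
  rw [hA z hz]

lemma IsGalileanOperator.snd_snd_eq_zero {D : Set Pt} {B : Pt → Pt} (hB : IsGalileanOperator D B)
    {z : Pt} (hz : z ∈ D) : (B z).2.2 = 0 := by
  obtain ⟨τ, s, w, g, e, hB⟩ := isGalileanOperator_iff.1 hB
  rw [hB hz]
  rfl

lemma isReparamOperator_zero (D : Set Pt) : IsReparamOperator D 0 := by
  refine ⟨0, 0, 0, ?_, by simp, fun z _ => ?_⟩
  · rintro f (rfl | rfl | rfl) <;> exact contDiffOn_const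
  · refine Prod.ext ?_ rfl
    ext i
    fin_cases i <;> rfl

lemma isGalileanOperator_zero (D : Set Pt) : IsGalileanOperator D 0 :=
  ⟨0, zero_mem _, fun _ _ => rfl⟩

lemma opY_zero : opY 0 0 0 = 0 := by
  funext z
  refine Prod.ext ?_ ?_
  · ext i
    fin_cases i <;> simp [opY]
  · simp [opY]

section Classification

variable {Q : Set (Indep × (Fin 3 → ℝ))} {Ω : Set (ℝ × ℝ)}

/-- The constants of the operator `opY` in a decomposition are unique. -/
lemma opY_constants_unique (hQo : IsOpen Q) (hQn : Q.Nonempty) (hΩo : IsOpen Ω)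
    (hΩc : IsConnected Ω) (hpos : ∀ w ∈ Ω, 0 < w.2) {c₁ c₂ c₃ d₁ d₂ d₃ : ℝ}
    (h : ∀ z ∈ dom Q Ω, (opY c₁ c₂ c₃ z).2.2 = (opY d₁ d₂ d₃ z).2.2) :
    c₁ = d₁ ∧ c₂ = d₂ ∧ c₃ = d₃ := by
  obtain ⟨z, hz⟩ := dom_nonempty hQn hΩc.nonempty
  obtain ⟨t, ht, hzt⟩ := exists_ne_zero_add_smul_mem (isOpen_dom hQo hΩo) hz eP
  have h1 := h z hz
  have h2 := h _ hzt
  simp only [opY, eP, Prod.mk.injEq, Prod.snd_add, Prod.fst_add, Prod.smul_mk, smul_eq_mul, mul_one,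
    mul_zero, add_zero] at h1 h2
  -- The `∂_ρ` coefficient at one point and the increment of the `∂_p` coefficient along `p` give
  -- two independent combinations of `c₁` and `c₂`.
  have e1 : 4 * c₂ - 10 * c₁ = 4 * d₂ - 10 * d₁ := mul_right_cancel₀ (hpos _ hz.2).ne' h1.2
  have e2 : 4 * c₂ - 8 * c₁ = 4 * d₂ - 8 * d₁ :=
    mul_right_cancel₀ ht (by linear_combination h2.1 - h1.1)
  refine ⟨by linarith, by linarith, ?_⟩
  linear_combination h1.1 - z.2.2.1 * e2

theorem admits_iff_exists (hQo : IsOpen Q) (hQc : Convex ℝ Q) (hQn : Q.Nonempty)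
    (hΩo : IsOpen Ω) (hΩc : IsConnected Ω) (hpos : ∀ w ∈ Ω, 0 < w.2) {h : ℝ × ℝ → ℝ}
    (hh : ContDiffOn ℝ ∞ h Ω) {X : Pt → Pt} : Admits Q Ω h X ↔
      ∃ A B c₁ c₂ c₃, IsReparamOperator (dom Q Ω) A ∧ IsGalileanOperator (dom Q Ω) B ∧
        ClassEq Ω h c₁ c₂ c₃ ∧ EqOn X (A + B + opY c₁ c₂ c₃) (dom Q Ω) := by
  constructor
  · intro hX
    obtain ⟨T, A, l, w, g, c, hX, hc⟩ := hX.hasSymmetryForm hQo hQc hQn hΩo hΩc hpos hh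
    obtain ⟨A', B', hA, hB, h⟩ := hX.exists_eqOn hQo hQc hQn hΩo hΩc
    exact ⟨A', B', _, _, _, hA, hB, hc, h⟩
  · rintro ⟨A, B, c₁, c₂, c₃, hA, hB, hc, hX⟩
    obtain ⟨s, w, g, hX⟩ := hasSymmetryForm_of_eqOn (isOpen_dom hQo hΩo) hA hB hX
    refine hX.admits hQo hΩo hh ?_
    convert hc using 1 <;> ring

/-- An admitted operator has some decomposition satisfying the classifying equation. Its constants
agree with the given ones, because the other two summands have no `∂_p` and `∂_ρ` components. -/
theorem admits_iff_classEq (hQo : IsOpen Q) (hQc : Convex ℝ Q) (hQn : Q.Nonempty)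
    (hΩo : IsOpen Ω) (hΩc : IsConnected Ω) (hpos : ∀ w ∈ Ω, 0 < w.2) {h : ℝ × ℝ → ℝ}
    (hh : ContDiffOn ℝ ∞ h Ω) {X A B : Pt → Pt} {c₁ c₂ c₃ : ℝ}
    (hA : IsReparamOperator (dom Q Ω) A) (hB : IsGalileanOperator (dom Q Ω) B)
    (hX : EqOn X (A + B + opY c₁ c₂ c₃) (dom Q Ω)) :
    Admits Q Ω h X ↔ ClassEq Ω h c₁ c₂ c₃ := by
  rw [admits_iff_exists hQo hQc hQn hΩo hΩc hpos hh]
  constructor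
  · rintro ⟨A', B', d₁, d₂, d₃, hA', hB', hc, hX'⟩
    obtain ⟨rfl, rfl, rfl⟩ := opY_constants_unique hQo hQn hΩo hΩc hpos
      (c₁ := c₁) (c₂ := c₂) (c₃ := c₃) (d₁ := d₁) (d₂ := d₂) (d₃ := d₃) fun z hz => by
        have e := (hX hz).symm.trans (hX' hz)
        simpa [hA.snd_eq_zero hz, hA'.snd_eq_zero hz, hB.snd_snd_eq_zero hz,
          hB'.snd_snd_eq_zero hz] using congrArg (fun y : Pt => y.2.2) e
    exact hc
  · exact fun hc => ⟨A, B, c₁, c₂, c₃, hA, hB, hc, hX⟩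

theorem inKernel_iff_constants (hQo : IsOpen Q) (hQc : Convex ℝ Q) (hQn : Q.Nonempty)
    (hΩo : IsOpen Ω) (hΩc : IsConnected Ω) (hpos : ∀ w ∈ Ω, 0 < w.2) {X A B : Pt → Pt}
    {c₁ c₂ c₃ : ℝ} (hA : IsReparamOperator (dom Q Ω) A) (hB : IsGalileanOperator (dom Q Ω) B)
    (hX : EqOn X (A + B + opY c₁ c₂ c₃) (dom Q Ω)) :
    InKernel Q Ω X ↔ c₁ = 0 ∧ c₂ = 0 ∧ c₃ = 0 := by
  have key : ∀ {h : ℝ × ℝ → ℝ}, ContDiffOn ℝ ∞ h Ω →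
      (Admits Q Ω h X ↔ ClassEq Ω h c₁ c₂ c₃) := fun hh =>
    admits_iff_classEq hQo hQc hQn hΩo hΩc hpos hh hA hB hX
  constructor
  · intro hK
    obtain ⟨z, hz⟩ := dom_nonempty hQn hΩc.nonempty
    obtain ⟨t, ht, hzt⟩ := exists_ne_zero_add_smul_mem (isOpen_dom hQo hΩo) hz eP
    -- For `h = 1` the classifying equation reads `2c₁ = 0`. For `h = p` it then becomes `4c₂ p + c₃
    -- = 0`, and two values of `p` give `c₂ = c₃ = 0`.
    have k1 := (key contDiffOn_const).1 (hK (fun _ => 1) contDiffOn_const) _ hz.2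
    have h1 : c₁ = 0 := by simpa using k1
    have k2 := (key contDiff_fst.contDiffOn).1 (hK Prod.fst contDiff_fst.contDiffOn)
    have k3 := k2 _ hz.2
    have k4 := k2 _ hzt.2
    simp only [fderiv_fst, ContinuousLinearMap.coe_fst', h1, eP, Prod.snd_add, Prod.fst_add,
      Prod.smul_mk, smul_eq_mul, mul_one, mul_zero, zero_mul, add_zero] at k3 k4
    have h2 : c₂ = 0 := by
      refine (mul_eq_zero.1 (?_ : c₂ * t = 0)).resolve_right ht
      linarith
    refine ⟨h1, h2, ?_⟩
    rw [h2] at k3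
    linarith
  · rintro ⟨rfl, rfl, rfl⟩ h hh
    exact (key hh).2 fun w _ => by ring

theorem inKernel_iff (hQo : IsOpen Q) (hQc : Convex ℝ Q) (hQn : Q.Nonempty)
    (hΩo : IsOpen Ω) (hΩc : IsConnected Ω) (hpos : ∀ w ∈ Ω, 0 < w.2) {X : Pt → Pt} :
    InKernel Q Ω X ↔ ∃ A B, IsReparamOperator (dom Q Ω) A ∧ IsGalileanOperator (dom Q Ω) B ∧
      EqOn X (A + B) (dom Q Ω) := by
  constructor
  · intro hX
    -- Any single `h` provides the decomposition; `h = 0` is used. The constants are then eliminated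
    -- by the other choices of `h`.
    obtain ⟨A, B, c₁, c₂, c₃, hA, hB, -, h⟩ := (admits_iff_exists hQo hQc hQn hΩo hΩc hpos
      contDiffOn_const).1 (hX (fun _ => 0) contDiffOn_const)
    obtain ⟨rfl, rfl, rfl⟩ := (inKernel_iff_constants hQo hQc hQn hΩo hΩc hpos hA hB h).1 hX
    exact ⟨A, B, hA, hB, by simpa [opY_zero] using h⟩
  · rintro ⟨A, B, hA, hB, h⟩
    refine (inKernel_iff_constants (c₁ := 0) (c₂ := 0) (c₃ := 0) hQo hQc hQn hΩo hΩc hpos hA hB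
      ?_).2 ⟨rfl, rfl, rfl⟩
    simpa [opY_zero] using h

theorem admits_iff_inKernel_add (hQo : IsOpen Q) (hQc : Convex ℝ Q) (hQn : Q.Nonempty)
    (hΩo : IsOpen Ω) (hΩc : IsConnected Ω) (hpos : ∀ w ∈ Ω, 0 < w.2) {h : ℝ × ℝ → ℝ}
    (hh : ContDiffOn ℝ ∞ h Ω) {X : Pt → Pt} : Admits Q Ω h X ↔
      ∃ K c₁ c₂ c₃, InKernel Q Ω K ∧ ClassEq Ω h c₁ c₂ c₃ ∧
        EqOn X (K + opY c₁ c₂ c₃) (dom Q Ω) := by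
  rw [admits_iff_exists hQo hQc hQn hΩo hΩc hpos hh]
  constructor
  · rintro ⟨A, B, c₁, c₂, c₃, hA, hB, hc, hX⟩
    exact ⟨A + B, c₁, c₂, c₃, (inKernel_iff hQo hQc hQn hΩo hΩc hpos).2
      ⟨A, B, hA, hB, fun _ _ => rfl⟩, hc, hX⟩
  · rintro ⟨K, c₁, c₂, c₃, hK, hc, hX⟩
    obtain ⟨A, B, hA, hB, h⟩ := (inKernel_iff hQo hQc hQn hΩo hΩc hpos).1 hK
    exact ⟨A, B, c₁, c₂, c₃, hA, hB, hc, fun z hz => by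
      rw [hX hz, Pi.add_apply, Pi.add_apply, h hz]⟩

lemma eqOn_opY (D : Set Pt) (c₁ c₂ c₃ : ℝ) :
    EqOn (opY c₁ c₂ c₃) (0 + 0 + opY c₁ c₂ c₃) D := fun _ _ => by simp

end Classification

/-! ### The structure of the kernel -/

/-- A reparametrization operator has no `∂_t` component, so `τ + s t` vanishes on an open set and `τ
= s = 0`. This kills the whole `∂_x` part of a Galilean operator, and the other components vanish by
the reparametrization form. -/
theorem IsReparamOperator.eqOn_zero {D : Set Pt} (hD : IsOpen D) {X : Pt → Pt}
    (hA : IsReparamOperator D X) (hB : IsGalileanOperator D X) : EqOn X 0 D := by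
  obtain ⟨τ, s, w, g, e, hB⟩ := isGalileanOperator_iff.1 hB
  obtain ⟨a, b₂, b₃, -, -, hA'⟩ := hA
  have h0 : ∀ z ∈ D, τ + s * z.1 0 = 0 := fun z hz => by
    have h := congrArg (fun y : Pt => y.1 0) ((hB hz).symm.trans (hA' z hz))
    simpa [galOp] using h
  intro z hz
  obtain ⟨t, ht, hzt⟩ := exists_ne_zero_add_smul_mem hD hz (eX 0)
  have h1 := h0 z hz
  have h2 := h0 _ hzt
  have hs : s = 0 := by
    refine (mul_eq_zero.1 (?_ : s * t = 0)).resolve_right ht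
    simp [eX] at h2
    linear_combination h2 - h1
  have hτ : τ = 0 := by simpa [hs] using h1
  refine Prod.ext ?_ (by rw [hA' z hz]; rfl)
  rw [hB hz]
  simp [galOp, hs, hτ]

theorem IsGalileanOperator.lieBracket {D : Set Pt} (hD : IsOpen D) {A B : Pt → Pt}
    (hA : IsGalileanOperator D A) (hB : IsGalileanOperator D B) :
    IsGalileanOperator D (VectorField.lieBracket ℝ A B) := by
  obtain ⟨τ, s, w, g, e, hA⟩ := isGalileanOperator_iff.1 hA
  obtain ⟨τ', s', w', g', e', hB⟩ := isGalileanOperator_iff.1 hB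
  refine isGalileanOperator_iff.2 ⟨s' * τ - s * τ', 0, w' ⨯₃ w, w' ⨯₃ g - w ⨯₃ g',
    s' • e - s • e' + (w' ⨯₃ e - w ⨯₃ e') + (τ • g' - τ' • g), fun z hz => ?_⟩
  rw [VectorField.lieBracket, EqOn.fderiv_eq_of_isOpen hD hA hz,
    EqOn.fderiv_eq_of_isOpen hD hB hz, hA hz, hB hz, fderiv_galOp, fderiv_galOp]
  -- The Jacobi identity of the cross product: the commutator of two rotations is a rotation.
  have hw : w' ⨯₃ (w ⨯₃ z.2.1) - w ⨯₃ (w' ⨯₃ z.2.1) = (w' ⨯₃ w) ⨯₃ z.2.1 := by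
    rw [leibniz_cross w' w z.2.1]
    abel
  refine Prod.ext ?_ (Prod.ext ?_ ?_)
  · ext i
    fin_cases i <;> simp [galOp] <;> ring
  · simp only [galOp, Prod.snd_sub, Prod.fst_sub, Pi.add_apply, Pi.single_eq_same, Pi.smul_apply,
      map_add, map_smul, smul_eq_mul, ← hw, zero_smul]
    module
  · simp [galOp]

/-! ### Commutators of planar fields -/

section Bracket

variable {S : Set (ℝ × ℝ)} {f₂ f₃ V₂ V₃ : ℝ × ℝ → ℝ}

lemma fderiv_fderiv_apply (hS : IsOpen S) (hf : ContDiffOn ℝ ∞ f₂ S)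
    (h₂ : ContDiffOn ℝ ∞ V₂ S) (h₃ : ContDiffOn ℝ ∞ V₃ S) {w : ℝ × ℝ} (hw : w ∈ S) :
    HasFDerivAt (fun w => fderiv ℝ f₂ w (V₂ w, V₃ w))
      ((fderiv ℝ f₂ w).comp ((fderiv ℝ V₂ w).prod (fderiv ℝ V₃ w))
        + (fderiv ℝ (fderiv ℝ f₂) w).flip (V₂ w, V₃ w)) w := by
  have d₂ := ((contDiffAt_of_mem h₂ hS hw).differentiableAt (by simp)).hasFDerivAt
  have d₃ := ((contDiffAt_of_mem h₃ hS hw).differentiableAt (by simp)).hasFDerivAt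
  exact (differentiableAt_fderiv hf hS hw).hasFDerivAt.clm_apply (d₂.prodMk d₃)

lemma contDiffOn_fderiv_apply (hS : IsOpen S) (hf : ContDiffOn ℝ ∞ f₂ S)
    (h₂ : ContDiffOn ℝ ∞ V₂ S) (h₃ : ContDiffOn ℝ ∞ V₃ S) :
    ContDiffOn ℝ ∞ (fun w => fderiv ℝ f₂ w (V₂ w, V₃ w)) S :=
  (hf.fderiv_of_isOpen hS (by simp)).clm_apply (h₂.prodMk h₃)

/-- Symmetry of second derivatives turns the sum into the derivative of the constant divergence in
the direction `v`. -/
lemma fderiv_divergence_eq_zero (hS : IsOpen S) (hf₂ : ContDiffOn ℝ ∞ f₂ S)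
    (hf₃ : ContDiffOn ℝ ∞ f₃ S) {d : ℝ}
    (hd : ∀ w ∈ S, fderiv ℝ f₂ w (1, 0) + fderiv ℝ f₃ w (0, 1) = d) {w : ℝ × ℝ} (hw : w ∈ S)
    (v : ℝ × ℝ) : fderiv ℝ (fderiv ℝ f₂) w (1, 0) v + fderiv ℝ (fderiv ℝ f₃) w (0, 1) v = 0 := by
  rw [fderiv_fderiv_comm hf₂ hS hw, fderiv_fderiv_comm hf₃ hS hw]
  have h₂ := (differentiableAt_fderiv hf₂ hS hw).hasFDerivAt.clm_apply
    (hasFDerivAt_const ((1, 0) : ℝ × ℝ) w)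
  have h₃ := (differentiableAt_fderiv hf₃ hS hw).hasFDerivAt.clm_apply
    (hasFDerivAt_const ((0, 1) : ℝ × ℝ) w)
  have h := (hasFDerivAt_const d w).unique ((h₂.add h₃).congr_of_eventuallyEq
    (by filter_upwards [hS.mem_nhds hw] with y hy using (hd y hy).symm))
  simpa using (congrArg (fun M => M v) h).symm

/-- The commutator of planar vector fields of constant divergence is divergence-free. -/
lemma divergence_commutator_eq_zero (hS : IsOpen S) (hf₂ : ContDiffOn ℝ ∞ f₂ S)
    (hf₃ : ContDiffOn ℝ ∞ f₃ S) (hV₂ : ContDiffOn ℝ ∞ V₂ S) (hV₃ : ContDiffOn ℝ ∞ V₃ S) {d d' : ℝ}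
    (hd : ∀ w ∈ S, fderiv ℝ f₂ w (1, 0) + fderiv ℝ f₃ w (0, 1) = d)
    (hd' : ∀ w ∈ S, fderiv ℝ V₂ w (1, 0) + fderiv ℝ V₃ w (0, 1) = d') {w : ℝ × ℝ} (hw : w ∈ S) :
    fderiv ℝ (fun w => fderiv ℝ f₂ w (V₂ w, V₃ w) - fderiv ℝ V₂ w (f₂ w, f₃ w)) w (1, 0)
      + fderiv ℝ (fun w => fderiv ℝ f₃ w (V₂ w, V₃ w) - fderiv ℝ V₃ w (f₂ w, f₃ w)) w (0, 1)
      = 0 := by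
  rw [((fderiv_fderiv_apply hS hf₂ hV₂ hV₃ hw).fun_sub
      (fderiv_fderiv_apply hS hV₂ hf₂ hf₃ hw)).fderiv,
    ((fderiv_fderiv_apply hS hf₃ hV₂ hV₃ hw).fun_sub
      (fderiv_fderiv_apply hS hV₃ hf₂ hf₃ hw)).fderiv]
  have e₁ := fderiv_divergence_eq_zero hS hf₂ hf₃ hd hw (V₂ w, V₃ w)
  have e₂ := fderiv_divergence_eq_zero hS hV₂ hV₃ hd' hw (f₂ w, f₃ w)
  simp only [sub_apply, add_apply, ContinuousLinearMap.comp_apply, ContinuousLinearMap.prod_apply,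
    ContinuousLinearMap.flip_apply]
  rw [pair_apply (fderiv ℝ f₂ w) (fderiv ℝ V₂ w _), pair_apply (fderiv ℝ f₃ w) (fderiv ℝ V₂ w _),
    pair_apply (fderiv ℝ V₂ w) (fderiv ℝ f₂ w _), pair_apply (fderiv ℝ V₃ w) (fderiv ℝ f₂ w _)]
  linear_combination e₁ - e₂

end Bracket

/-- Of the Galilean part only the scaling `s` interacts with a reparametrization operator. In the
`(ξ², ξ³)` plane it adds the radial field `s (ξ², ξ³)`, of constant divergence `2s`, so
`divergence_commutator_eq_zero` still applies. -/
theorem IsReparamOperator.lieBracket {D : Set Pt} (hD : IsOpen D) {A X A' B' : Pt → Pt}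
    (hA : IsReparamOperator D A) (hA' : IsReparamOperator D A') (hB' : IsGalileanOperator D B')
    (hX : EqOn X (A' + B') D) : IsReparamOperator D (VectorField.lieBracket ℝ X A) := by
  obtain ⟨a, b₂, b₃, hs, hdiv, hA⟩ := hA
  obtain ⟨a', b₂', b₃', hs', hdiv', hA'⟩ := hA'
  obtain ⟨τ, s, w, g, e, hB'⟩ := isGalileanOperator_iff.1 hB'
  have ha := hs a (by simp)
  have h₂ := hs b₂ (by simp)
  have h₃ := hs b₃ (by simp)
  have ha' := hs' a' (by simp)
  have h₂' := hs' b₂' (by simp)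
  have h₃' := hs' b₃' (by simp)
  have hS := isOpen_image_pξ hD
  have hV₂ : ContDiffOn ℝ ∞ (fun w => b₂' w + s * w.1) ((fun z : Pt => (z.1 2, z.1 3)) '' D) :=
    h₂'.add (by fun_prop)
  have hV₃ : ContDiffOn ℝ ∞ (fun w => b₃' w + s * w.2) ((fun z : Pt => (z.1 2, z.1 3)) '' D) :=
    h₃'.add (by fun_prop)
  have fV₂ : ∀ w ∈ (fun z : Pt => (z.1 2, z.1 3)) '' D, ∀ v : ℝ × ℝ,
      fderiv ℝ (fun w => b₂' w + s * w.1) w v = fderiv ℝ b₂' w v + s * v.1 := fun w hw v => by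
    have d := ((contDiffAt_of_mem h₂' hS hw).differentiableAt (by simp)).hasFDerivAt
    rw [(d.fun_add (hasFDerivAt_fst.const_mul s)).fderiv]
    simp
  have fV₃ : ∀ w ∈ (fun z : Pt => (z.1 2, z.1 3)) '' D, ∀ v : ℝ × ℝ,
      fderiv ℝ (fun w => b₃' w + s * w.2) w v = fderiv ℝ b₃' w v + s * v.2 := fun w hw v => by
    have d := ((contDiffAt_of_mem h₃' hS hw).differentiableAt (by simp)).hasFDerivAt
    rw [(d.fun_add (hasFDerivAt_snd.const_mul s)).fderiv]
    simp
  refine ⟨fun w => fderiv ℝ a w (b₂' w + s * w.1, b₃' w + s * w.2)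
      - (fderiv ℝ a' w (b₂ w, b₃ w) + s * a w),
    fun w => fderiv ℝ b₂ w (b₂' w + s * w.1, b₃' w + s * w.2)
      - fderiv ℝ (fun w => b₂' w + s * w.1) w (b₂ w, b₃ w),
    fun w => fderiv ℝ b₃ w (b₂' w + s * w.1, b₃' w + s * w.2)
      - fderiv ℝ (fun w => b₃' w + s * w.2) w (b₂ w, b₃ w), ?_, fun w hw => ?_, fun z hz => ?_⟩
  · rintro f (rfl | rfl | rfl)
    · exact (contDiffOn_fderiv_apply hS ha hV₂ hV₃).sub
        ((contDiffOn_fderiv_apply hS ha' h₂ h₃).add (contDiffOn_const.mul ha))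
    · exact (contDiffOn_fderiv_apply hS h₂ hV₂ hV₃).sub (contDiffOn_fderiv_apply hS hV₂ h₂ h₃)
    · exact (contDiffOn_fderiv_apply hS h₃ hV₂ hV₃).sub (contDiffOn_fderiv_apply hS hV₃ h₂ h₃)
  · refine divergence_commutator_eq_zero hS h₂ h₃ hV₂ hV₃ (d := 0) (d' := 2 * s) hdiv
      (fun w hw => ?_) hw
    rw [fV₂ w hw, fV₃ w hw]
    linear_combination hdiv' w hw
  · have hA1 : EqOn A (reparamOp a b₂ b₃) D := hA
    have hX1 : EqOn X (fun z => reparamOp a' b₂' b₃' z + galOp τ s w g e z) D := fun z hz => by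
      rw [hX hz, Pi.add_apply, hA' z hz, hB' hz]
      rfl
    have dR : DifferentiableAt ℝ (reparamOp a' b₂' b₃') z :=
      ((contDiffOn_reparamOp ha' h₂' h₃').contDiffAt (hD.mem_nhds hz)).differentiableAt (by simp)
    have dG := (contDiff_galOp τ s w g e).differentiable (by simp) z
    rw [VectorField.lieBracket, EqOn.fderiv_eq_of_isOpen hD hA1 hz,
      EqOn.fderiv_eq_of_isOpen hD hX1 hz, hA1 hz, hX1 hz, fderiv_fun_add dR dG, add_apply,
      fderiv_galOp, fderiv_reparamOp (differentiableAt_of_image hD ha hz)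
        (differentiableAt_of_image hD h₂ hz) (differentiableAt_of_image hD h₃ hz),
      fderiv_reparamOp (differentiableAt_of_image hD ha' hz)
        (differentiableAt_of_image hD h₂' hz) (differentiableAt_of_image hD h₃' hz)]
    have e₂ := fV₂ _ (mem_image_of_mem _ hz)
    have e₃ := fV₃ _ (mem_image_of_mem _ hz)
    refine Prod.ext ?_ ?_
    · ext i
      fin_cases i <;> simp [reparamOp, galOp, Matrix.vecHead, Matrix.vecTail, e₂, e₃]
    · simp [reparamOp, galOp]

/-! ### Finite reparametrizations -/

/-- The system is invariant under unimodular changes of the Lagrangian frame that fix `∂_t` and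
`∂_{ξ¹}`. -/
lemma SystemAt.of_unimodular {h : ℝ × ℝ → ℝ} {j k : Jet} {a₂ a₃ b₂₂ b₂₃ b₃₂ b₃₃ : ℝ}
    (hdet : b₂₂ * b₃₃ - b₂₃ * b₃₂ = 1) (hu : k.2.1 = j.2.1) (h0 : k.d1 0 = j.d1 0)
    (h1 : k.d1 1 = j.d1 1) (h2 : k.d1 2 = a₂ • j.d1 1 + b₂₂ • j.d1 2 + b₃₂ • j.d1 3)
    (h3 : k.d1 3 = a₃ • j.d1 1 + b₂₃ • j.d1 2 + b₃₃ • j.d1 3) (h00 : k.d2 0 0 = j.d2 0 0)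
    (h11 : k.d2 1 1 = j.d2 1 1) (h12 : k.d2 1 2 = a₂ • j.d2 1 1 + b₂₂ • j.d2 1 2 + b₃₂ • j.d2 1 3)
    (h13 : k.d2 1 3 = a₃ • j.d2 1 1 + b₂₃ • j.d2 1 2 + b₃₃ • j.d2 1 3) (hj : SystemAt h j) :
    SystemAt h k := by
  obtain ⟨hM, hC, hE⟩ := hj
  have hr : k.rho = j.rho := by rw [Jet.rho, hu]; rfl
  have g1 : k.g1 1 = j.g1 1 := congrArg Prod.fst h1
  have g2 : k.g1 2 = a₂ • j.g1 1 + b₂₂ • j.g1 2 + b₃₂ • j.g1 3 := congrArg Prod.fst h2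
  have g3 : k.g1 3 = a₃ • j.g1 1 + b₂₃ • j.g1 2 + b₃₃ • j.g1 3 := congrArg Prod.fst h3
  have r1 : k.rho1 1 = j.rho1 1 := congrArg (fun y : Dep => y.2.2) h1
  have r2 : k.rho1 2 = a₂ * j.rho1 1 + b₂₂ * j.rho1 2 + b₃₂ * j.rho1 3 :=
    congrArg (fun y : Dep => y.2.2) h2
  have r3 : k.rho1 3 = a₃ * j.rho1 1 + b₂₃ * j.rho1 2 + b₃₃ * j.rho1 3 :=
    congrArg (fun y : Dep => y.2.2) h3
  have p1 : k.p1 1 = j.p1 1 := congrArg (fun y : Dep => y.2.1) h1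
  have p2 : k.p1 2 = a₂ * j.p1 1 + b₂₂ * j.p1 2 + b₃₂ * j.p1 3 :=
    congrArg (fun y : Dep => y.2.1) h2
  have p3 : k.p1 3 = a₃ * j.p1 1 + b₂₃ * j.p1 2 + b₃₃ * j.p1 3 :=
    congrArg (fun y : Dep => y.2.1) h3
  have G00 : k.g2 0 0 = j.g2 0 0 := congrArg Prod.fst h00
  have G11 : k.g2 1 1 = j.g2 1 1 := congrArg Prod.fst h11
  have G12 : k.g2 1 2 = a₂ • j.g2 1 1 + b₂₂ • j.g2 1 2 + b₃₂ • j.g2 1 3 := congrArg Prod.fst h12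
  have G13 : k.g2 1 3 = a₃ • j.g2 1 1 + b₂₃ • j.g2 1 2 + b₃₃ • j.g2 1 3 := congrArg Prod.fst h13
  have P1 : k.totalPressure1 1 = j.totalPressure1 1 := by
    simp only [Jet.totalPressure1, hr, g1, r1, p1, G11]
  have P2 : k.totalPressure1 2 = a₂ * j.totalPressure1 1 + b₂₂ * j.totalPressure1 2
      + b₃₂ * j.totalPressure1 3 := by
    simp only [Jet.totalPressure1, hr, g1, r2, p2, G12, dotProduct_add, dotProduct_smul,
      smul_eq_mul]
    ring
  have P3 : k.totalPressure1 3 = a₃ * j.totalPressure1 1 + b₂₃ * j.totalPressure1 2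
      + b₃₃ * j.totalPressure1 3 := by
    simp only [Jet.totalPressure1, hr, g1, r3, p3, G13, dotProduct_add, dotProduct_smul,
      smul_eq_mul]
    ring
  refine ⟨?_, ?_, ?_⟩
  -- The pressure terms form an alternating trilinear expression in the three spatial derivatives,
  -- so the change of frame multiplies them by its determinant. The inertia and tension terms are
  -- unchanged.
  · have hM' : momentum k = momentum j + (b₂₂ * b₃₃ - b₂₃ * b₃₂ - 1) •
        (j.totalPressure1 1 • (j.g1 2 ⨯₃ j.g1 3) + j.totalPressure1 2 • (j.g1 3 ⨯₃ j.g1 1)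
          + j.totalPressure1 3 • (j.g1 1 ⨯₃ j.g1 2)) := by
      ext i
      simp only [momentum, P1, P2, P3, hr, r1, g1, g2, g3, G00, G11, cross_apply]
      fin_cases i <;> simp <;> ring
    rw [hM', hM, hdet]
    simp
  · have hC' : k.g1 1 ⬝ᵥ (k.g1 2 ⨯₃ k.g1 3)
        = (b₂₂ * b₃₃ - b₂₃ * b₃₂) * (j.g1 1 ⬝ᵥ (j.g1 2 ⨯₃ j.g1 3)) := by
      simp only [g1, g2, g3, cross_apply, dotProduct, Fin.sum_univ_three]
      simp
      ring
    rw [cauchy, hr, hC', hdet, one_mul]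
    exact hC
  · rw [constitutive] at hE ⊢
    simpa only [Jet.p1, Jet.rho1, h0, hu] using hE

section Reparam

variable {W : Set (ℝ × ℝ)} {a b₂ b₃ : ℝ × ℝ → ℝ}

lemma contDiffOn_reparam (hr : IsReparam W a b₂ b₃) :
    ContDiffOn ℝ ∞ (reparam a b₂ b₃) {x | (x 2, x 3) ∈ W} := by
  obtain ⟨ha, h₂, h₃, -⟩ := hr
  have hc : ∀ {f : ℝ × ℝ → ℝ}, ContDiffOn ℝ ∞ f W →
      ContDiffOn ℝ ∞ (fun x : Indep => f (x 2, x 3)) {x | (x 2, x 3) ∈ W} := fun hf =>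
    hf.comp (t := W) (by fun_prop) fun _ hx => hx
  rw [contDiffOn_pi]
  intro i
  fin_cases i
  · exact (contDiff_apply ℝ ℝ 0).contDiffOn
  · exact (contDiff_apply ℝ ℝ 1).contDiffOn.add (hc ha)
  · exact hc h₂
  · exact hc h₃

lemma isOpen_reparam_source (hW : IsOpen W) : IsOpen {x : Indep | (x 2, x 3) ∈ W} :=
  hW.preimage (by fun_prop : Continuous fun x : Indep => (x 2, x 3))

lemma fderiv_reparam (hW : IsOpen W) (hr : IsReparam W a b₂ b₃) {x : Indep} (hx : (x 2, x 3) ∈ W)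
    (v : Indep) : fderiv ℝ (reparam a b₂ b₃) x v =
      ![v 0, v 1 + fderiv ℝ a (x 2, x 3) (v 2, v 3), fderiv ℝ b₂ (x 2, x 3) (v 2, v 3),
        fderiv ℝ b₃ (x 2, x 3) (v 2, v 3)] := by
  have hd := contDiffAt_of_mem (contDiffOn_reparam hr) (isOpen_reparam_source hW) hx
  obtain ⟨ha, h₂, h₃, -⟩ := hr
  have hl : ∀ {f : ℝ × ℝ → ℝ}, ContDiffOn ℝ ∞ f W →
      HasDerivAt (fun t : ℝ => f ((x + t • v) 2, (x + t • v) 3))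
        (fderiv ℝ f (x 2, x 3) (v 2, v 3)) 0 := fun hf =>
    hasDerivAt_comp_pξ_line (z := (x, 0))
      ((contDiffAt_of_mem hf hW hx).differentiableAt (by simp)) (v, 0)
  have hi : ∀ i, HasDerivAt (fun t : ℝ => (x + t • v) i) (v i) 0 := fun i => by
    simpa using ((hasDerivAt_id (0 : ℝ)).mul_const (v i)).const_add (x i)
  refine fderiv_apply_eq_of_line (hd.differentiableAt (by simp)) ?_
  rw [hasDerivAt_pi]
  intro i
  fin_cases i
  · exact hi 0
  · exact (hi 1).add (hl ha)
  · exact hl h₂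
  · exact hl h₃

/-- By the chain rule the jets of `u ∘ φ` and `u` are related by a unimodular change of frame at
each point. Second derivatives of `φ` do not contribute to the entries that the system uses. -/
theorem IsSolution.comp_reparam {Ω : Set (ℝ × ℝ)} {h : ℝ × ℝ → ℝ} (hW : IsOpen W)
    (hr : IsReparam W a b₂ b₃) {V : Set Indep} {u : Indep → Dep} (hV : IsOpen V)
    (hu : IsSolution Ω h V u) :
    IsSolution Ω h {x | (x 2, x 3) ∈ W ∧ reparam a b₂ b₃ x ∈ V} (u ∘ reparam a b₂ b₃) := by
  set φ := reparam a b₂ b₃ with hφ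
  have hc := contDiffOn_reparam hr
  have hU : IsOpen {x | (x 2, x 3) ∈ W ∧ φ x ∈ V} :=
    hc.continuousOn.isOpen_inter_preimage (isOpen_reparam_source hW) hV
  have hcU : ContDiffOn ℝ ∞ φ {x | (x 2, x 3) ∈ W ∧ φ x ∈ V} := hc.mono fun _ hx => hx.1
  have hcv : ContDiffOn ℝ ∞ (u ∘ φ) {x | (x 2, x 3) ∈ W ∧ φ x ∈ V} :=
    hu.1.comp hcU fun _ hx => hx.2
  refine ⟨hcv, fun x hx => ⟨(hu.2 _ hx.2).1, ?_⟩⟩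
  have dφ : ∀ y ∈ {x | (x 2, x 3) ∈ W ∧ φ x ∈ V}, HasFDerivAt φ (fderiv ℝ φ y) y := fun y hy =>
    ((contDiffAt_of_mem hcU hU hy).differentiableAt (by simp)).hasFDerivAt
  have du : ∀ y ∈ {x | (x 2, x 3) ∈ W ∧ φ x ∈ V}, ∀ v,
      fderiv ℝ (u ∘ φ) y v = fderiv ℝ u (φ y) (fderiv ℝ φ y v) := fun y hy v => by
    have d := ((contDiffAt_of_mem hu.1 hV hy.2).differentiableAt (by simp)).hasFDerivAt
    rw [(d.comp y (dφ y hy)).fderiv]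
    rfl
  -- The derivative of `φ` fixes the directions `t` and `ξ¹` at every point, so differentiating once
  -- along them leaves no derivative of `φ` to differentiate again. The system needs only `γ_tt` and
  -- `γ_{ξ¹α}`.
  have d2u : ∀ e : Indep, e 2 = 0 → e 3 = 0 → ∀ v, fderiv ℝ (fderiv ℝ (u ∘ φ)) x v e
      = fderiv ℝ (fderiv ℝ u) (φ x) (fderiv ℝ φ x v) e := fun e e2 e3 v => by
    have h1 := map_fderiv_fderiv hcv hU hx e (ContinuousLinearMap.id ℝ Dep)
      (f := fun y => fderiv ℝ u (φ y) e) (fun y hy => by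
        have : fderiv ℝ φ y e = e := by
          rw [hφ, fderiv_reparam hW hr hy.1, e2, e3]
          ext i
          fin_cases i <;> simp [e2, e3, ← Prod.zero_eq_mk]
        rw [ContinuousLinearMap.id_apply, du y hy, this]) v
    have h2 : HasFDerivAt (fun y => fderiv ℝ u (φ y) e)
        (((fderiv ℝ (fderiv ℝ u) (φ x)).flip e).comp (fderiv ℝ φ x)) x := by
      have h3 : HasFDerivAt (fun y => fderiv ℝ u y e) ((fderiv ℝ (fderiv ℝ u) (φ x)).flip e)
          (φ x) := by
        simpa using (differentiableAt_fderiv hu.1 hV hx.2).hasFDerivAt.clm_apply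
          (hasFDerivAt_const e (φ x))
      exact h3.comp x (dφ x hx)
    rw [h2.fderiv] at h1
    exact h1
  have hdet := hr.2.2.2 _ hx.1
  have f0 : fderiv ℝ φ x (Pi.single 0 1) = Pi.single 0 1 := by
    rw [hφ, fderiv_reparam hW hr hx.1]
    ext i
    fin_cases i <;> simp [← Prod.zero_eq_mk]
  have f1 : fderiv ℝ φ x (Pi.single 1 1) = Pi.single 1 1 := by
    rw [hφ, fderiv_reparam hW hr hx.1]
    ext i
    fin_cases i <;> simp [← Prod.zero_eq_mk]
  have f2 : fderiv ℝ φ x (Pi.single 2 1) = fderiv ℝ a (x 2, x 3) (1, 0) • Pi.single 1 1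
      + fderiv ℝ b₂ (x 2, x 3) (1, 0) • Pi.single 2 1
      + fderiv ℝ b₃ (x 2, x 3) (1, 0) • Pi.single 3 1 := by
    rw [hφ, fderiv_reparam hW hr hx.1]
    ext i
    fin_cases i <;> simp
  have f3 : fderiv ℝ φ x (Pi.single 3 1) = fderiv ℝ a (x 2, x 3) (0, 1) • Pi.single 1 1
      + fderiv ℝ b₂ (x 2, x 3) (0, 1) • Pi.single 2 1
      + fderiv ℝ b₃ (x 2, x 3) (0, 1) • Pi.single 3 1 := by
    rw [hφ, fderiv_reparam hW hr hx.1]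
    ext i
    fin_cases i <;> simp
  have sv := fderiv_fderiv_comm hcv hU hx
  have su := fderiv_fderiv_comm hu.1 hV hx.2
  refine SystemAt.of_unimodular (a₂ := fderiv ℝ a (x 2, x 3) (1, 0))
    (a₃ := fderiv ℝ a (x 2, x 3) (0, 1)) hdet (j := jet u (φ x)) rfl ?_ ?_ ?_ ?_ ?_ ?_ ?_ ?_
    (hu.2 _ hx.2).2
  · simp only [jet, Jet.d1, du x hx, f0]
  · simp only [jet, Jet.d1, du x hx, f1]
  · simp only [jet, Jet.d1, du x hx, f2, map_add, map_smul]
  · simp only [jet, Jet.d1, du x hx, f3, map_add, map_smul]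
  · simp only [jet, Jet.d2]
    rw [d2u _ (by simp) (by simp), f0]
  · simp only [jet, Jet.d2]
    rw [d2u _ (by simp) (by simp), f1]
  · simp only [jet, Jet.d2]
    rw [sv, d2u _ (by simp) (by simp), su, f2, map_add, map_add, map_smul, map_smul, map_smul]
  · simp only [jet, Jet.d2]
    rw [sv, d2u _ (by simp) (by simp), su, f3, map_add, map_add, map_smul, map_smul, map_smul]

end Reparam

end MHD

end

theorem theorem2
    (Q : Set (MHD.Indep × (Fin 3 → ℝ))) (hQo : IsOpen Q) (hQc : Convex ℝ Q) (hQn : Q.Nonempty)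
    (Ω : Set (ℝ × ℝ)) (hΩo : IsOpen Ω) (hΩc : IsConnected Ω) (hΩpos : ∀ w ∈ Ω, 0 < w.2) :
    -- the kernel is the sum of the reparametrization and the extended Galilean operators
    (∀ X : MHD.Pt → MHD.Pt, MHD.InKernel Q Ω X ↔
      ∃ A B : MHD.Pt → MHD.Pt, MHD.IsReparamOperator (MHD.dom Q Ω) A ∧
        MHD.IsGalileanOperator (MHD.dom Q Ω) B ∧ EqOn X (A + B) (MHD.dom Q Ω)) ∧
    -- the sum is direct
    (∀ X : MHD.Pt → MHD.Pt, MHD.IsReparamOperator (MHD.dom Q Ω) X →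
      MHD.IsGalileanOperator (MHD.dom Q Ω) X → EqOn X 0 (MHD.dom Q Ω)) ∧
    -- the reparametrization operators form an ideal of the kernel
    (∀ A X : MHD.Pt → MHD.Pt, MHD.IsReparamOperator (MHD.dom Q Ω) A → MHD.InKernel Q Ω X →
      MHD.IsReparamOperator (MHD.dom Q Ω) (VectorField.lieBracket ℝ X A)) ∧
    -- the extended Galilean operators form a subalgebra
    (∀ A B : MHD.Pt → MHD.Pt, MHD.IsGalileanOperator (MHD.dom Q Ω) A →
      MHD.IsGalileanOperator (MHD.dom Q Ω) B →
      MHD.IsGalileanOperator (MHD.dom Q Ω) (VectorField.lieBracket ℝ A B)) ∧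
    -- every finite reparametrization takes solutions to solutions, whatever `h` is
    (∀ h : ℝ × ℝ → ℝ, ContDiffOn ℝ ∞ h Ω → ∀ (W : Set (ℝ × ℝ)) (a b₂ b₃ : ℝ × ℝ → ℝ),
      IsOpen W → MHD.IsReparam W a b₂ b₃ → ∀ (V : Set MHD.Indep) (u : MHD.Indep → MHD.Dep),
      IsOpen V → MHD.IsSolution Ω h V u →
      MHD.IsSolution Ω h {x | (x 2, x 3) ∈ W ∧ MHD.reparam a b₂ b₃ x ∈ V}
        (u ∘ MHD.reparam a b₂ b₃)) ∧
    -- for a given `h` the kernel is extended exactly by the operators `Y` whose constants satisfy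
    -- the classifying equation
    (∀ h : ℝ × ℝ → ℝ, ContDiffOn ℝ ∞ h Ω →
      (∀ X : MHD.Pt → MHD.Pt, MHD.Admits Q Ω h X ↔
        ∃ (K : MHD.Pt → MHD.Pt) (c₁ c₂ c₃ : ℝ), MHD.InKernel Q Ω K ∧
          MHD.ClassEq Ω h c₁ c₂ c₃ ∧ EqOn X (K + MHD.opY c₁ c₂ c₃) (MHD.dom Q Ω)) ∧
      ∀ c₁ c₂ c₃ : ℝ, MHD.Admits Q Ω h (MHD.opY c₁ c₂ c₃) ↔ MHD.ClassEq Ω h c₁ c₂ c₃) ∧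
    -- no nonzero `Y` lies in the kernel
    (∀ c₁ c₂ c₃ : ℝ, MHD.InKernel Q Ω (MHD.opY c₁ c₂ c₃) ↔ c₁ = 0 ∧ c₂ = 0 ∧ c₃ = 0) := by
  have hD := MHD.isOpen_dom hQo hΩo
  refine ⟨fun X => MHD.inKernel_iff hQo hQc hQn hΩo hΩc hΩpos,
    fun X hA hB => hA.eqOn_zero hD hB, fun A X hA hX => ?_, fun A B hA hB => hA.lieBracket hD hB,
    fun h _ W a b₂ b₃ hW hr V u hV hu => hu.comp_reparam hW hr hV,
    fun h hh => ⟨fun X => MHD.admits_iff_inKernel_add hQo hQc hQn hΩo hΩc hΩpos hh,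
      fun c₁ c₂ c₃ => MHD.admits_iff_classEq hQo hQc hQn hΩo hΩc hΩpos hh
        (MHD.isReparamOperator_zero _) (MHD.isGalileanOperator_zero _) (MHD.eqOn_opY _ _ _ _)⟩,
    fun c₁ c₂ c₃ => MHD.inKernel_iff_constants hQo hQc hQn hΩo hΩc hΩpos
      (MHD.isReparamOperator_zero _) (MHD.isGalileanOperator_zero _) (MHD.eqOn_opY _ _ _ _)⟩
  obtain ⟨A', B', hA', hB', h⟩ := (MHD.inKernel_iff hQo hQc hQn hΩo hΩc hΩpos).1 hX
  exact hA.lieBracket hD hA' hB' h
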